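/- Theorem 5.4. Let $K=\prod_j K_j$ be a CM algebra (a finite product of CM number fields) of degree $2g$ over $\mathbb{Q}$, with complex conjugation $x\mapsto\bar x$ (the complex conjugation on each $K_j$) and ring of integers $\mathcal{O}_K=\prod_j\mathcal{O}_{K_j}$. Let $t_0\in K$ be invertible and totally imaginary (i.e. $\rho(t_0)\in i\mathbb{R}$ for every algebra morphism $\rho:K\to\mathbb{C}$), let $$\omega_{t_0}(x,x')=\mathrm{Tr}_{K/\mathbb{Q}}\left(\frac{x\,\overline{x'}}{t_0}\right)\qquad (x,x'\in K),$$ and let $\Phi=\Phi_{t_0}=\{\rho\in\mathrm{Hom}_{\rm alg}(K,\mathbb{C}) : \mathrm{Im}\,\rho(t_0)>0\}$, a CM type of $K$; put $N_\Phi(x)=\prod_{\rho\in\Phi}\rho(x)$. Let $\Lambda\subset K$ be a lattice (an additive subgroup commensurable to $\mathcal{O}_K$) that is autodual: $\Lambda=\{x\in K : \omega_{t_0}(x,y)\in\mathbb{Z}\ \text{for all } y\in\Lambda\}$. Let $\mathbb{Z}_{(2)}$ be the ring of rational numbers with odd denominator and $\Lambda_{(2)}=\mathbb{Z}_{(2)}\Lambda$.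 Let $\nu\in K$ be an element of the theta subgroup $U_{K,\Lambda}^{\theta,2}$ of level $2$, that is, $\nu\bar\nu=1$, $(\nu-1)\Lambda_{(2)}\subset 2\Lambda_{(2)}$, and $\omega_{t_0}(\nu x,x)\in 4\mathbb{Z}_{(2)}$ for all $x\in\Lambda_{(2)}$. Let $G_\nu=\Lambda/(\Lambda\cap\nu\Lambda)$ and $d_\nu=|G_\nu|$. Then $G_\nu$ is a finite group of odd order, and, for each choice of the square root $N_\Phi(\nu)^{1/2}$, there exists $\kappa_\nu\in\mathbb{C}$ with $\kappa_\nu^4=1$ such that $$\lambda_\nu=\kappa_\nu\, d_\nu^{1/2}\,N_\Phi(\nu)^{1/2}$$ is a critical value on $G_\nu$, i.e. there is a nonzero function $f:G_\nu\to\mathbb{C}$ with $\sum_{\ell\in G_\nu}f(k+\ell)f(k-\ell)=\lambda_\nu f(k)^2$ for all $k\in G_\nu$. Moreover $\lambda_\nu$ is a $d_\nu$-Weil number: an algebraic integer all of whose Galois conjugates in $\mathbb{C}$ have modulus $\sqrt{d_\nu}$. -/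

import Mathlib

open scoped BigOperators

noncomputable section

namespace CMCritical

/-! ### Critical values on finite abelian groups of odd order -/

/-- `lam` is a critical value on the abelian group `G`: the group `G` is finite of odd order and
there is a nonzero `f : G → ℂ` with `∑ ℓ, f (k + ℓ) * f (k - ℓ) = lam * f k ^ 2` for all `k`. -/
def IsCriticalValue (G : Type*) [AddCommGroup G] (lam : ℂ) : Prop :=
  ∃ _ : Fintype G, Odd (Fintype.card G) ∧
    ∃ f : G → ℂ, f ≠ 0 ∧ ∀ k : G, ∑ l : G, f (k + l) * f (k - l) = lam * f k ^ 2

/-- An `m`-Weil number, for an integer `m ≥ 1`: an algebraic integer all of whose complex Galois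
conjugates have modulus `√m`. -/
def IsWeilNumber (m : ℕ) (z : ℂ) : Prop :=
  1 ≤ m ∧ IsIntegral ℤ z ∧ ∀ w : ℂ, IsConjRoot ℚ z w → ‖w‖ = Real.sqrt m

/-! ### CM algebras -/

section CMAlgebra

variable {ι : Type*} (F : ι → Type*) [∀ j, Field (F j)] [∀ j, NumberField (F j)]

/-- The subgroup `∏ j, 𝓞 (F j)` of the algebra `∏ j, F j`. -/
def ringOfIntegers : AddSubgroup (∀ j, F j) :=
  AddSubgroup.pi Set.univ fun j =>
    ((algebraMap (NumberField.RingOfIntegers (F j)) (F j)).range).toAddSubgroup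

/-- A lattice of the algebra `∏ j, F j` is an additive subgroup commensurable to the ring of
integers `∏ j, 𝓞 (F j)`. -/
def IsLattice (L : AddSubgroup (∀ j, F j)) : Prop :=
  L.Commensurable (ringOfIntegers F)

variable {F}

/-- An element of `∏ j, F j` is totally imaginary if all its conjugates in `ℂ` are imaginary. -/
def IsTotallyImaginary (t : ∀ j, F j) : Prop :=
  ∀ ρ : (∀ j, F j) →ₐ[ℚ] ℂ, (ρ t).re = 0

/-- The set `Φ_t` of all algebra morphisms `ρ : ∏ j, F j → ℂ` with `Im (ρ t) > 0`. When `t` is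
totally imaginary and invertible in a CM algebra, this is a CM type. -/
def cmType (t : ∀ j, F j) : Set ((∀ j, F j) →ₐ[ℚ] ℂ) :=
  {ρ | 0 < (ρ t).im}

/-- The reflex norm (type norm) `N_Φ(x) = ∏ ρ ∈ Φ, ρ x` of `x`. -/
def reflexNorm [Finite ι] (Φ : Set ((∀ j, F j) →ₐ[ℚ] ℂ)) (x : ∀ j, F j) : ℂ :=
  ∏ ρ ∈ Φ.toFinite.toFinset, ρ x

/-- The subgroup `ν L` of `∏ j, F j`. -/
def mulLattice (ν : ∀ j, F j) (L : AddSubgroup (∀ j, F j)) : AddSubgroup (∀ j, F j) :=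
  L.map (AddMonoidHom.mulLeft ν)

/-- The group `G_ν = L / (L ∩ ν L)`. -/
abbrev latticeQuotient (L : AddSubgroup (∀ j, F j)) (ν : ∀ j, F j) : Type _ :=
  L ⧸ (mulLattice ν L).addSubgroupOf L

variable [∀ j, NumberField.IsCMField (F j)]

/-- The complex conjugation of the CM algebra `∏ j, F j`: on each factor, it is the complex
conjugation of the CM field `F j`. -/
def conj (x : ∀ j, F j) : ∀ j, F j :=
  fun j => NumberField.IsCMField.complexConj (F j) (x j)

/-- The form `ω_t(x, x') = Tr_{K/ℚ} (x * conj x' / t)` on the CM algebra `K = ∏ j, F j`. -/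
def symplecticForm (t x x' : ∀ j, F j) : ℚ :=
  Algebra.trace ℚ (∀ j, F j) (x * conj x' / t)

/-- The subgroup `L` is autodual for `ω_t`: it equals its dual `{x | ω_t(x, L) ⊆ ℤ}`. -/
def IsAutodual (t : ∀ j, F j) (L : AddSubgroup (∀ j, F j)) : Prop :=
  ∀ x : ∀ j, F j, x ∈ L ↔ ∀ y ∈ L, ∃ n : ℤ, symplecticForm t x y = n

/-- The unitary group `U_K = {ν | ν * conj ν = 1}`. -/
def unitaryElements : Set (∀ j, F j) :=
  {ν | ν * conj ν = 1}

end CMAlgebra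

/-! ### The theta subgroup of level 2 -/

/-- The ring `ℤ_(2)` of rational numbers with odd denominator. -/
def ZTwo : Subring ℚ where
  carrier := {q | Odd q.den}
  mul_mem' {a b} ha hb := (ha.mul hb).of_dvd_nat (Rat.mul_den_dvd a b)
  one_mem' := by simp
  add_mem' {a b} ha hb := (ha.mul hb).of_dvd_nat (Rat.add_den_dvd a b)
  zero_mem' := by simp
  neg_mem' {a} ha := by simpa using ha

section Theta

variable {ι : Type*} {F : ι → Type*} [∀ j, Field (F j)] [∀ j, NumberField (F j)]

/-- The localization `L_(2) = ℤ_(2) L`, that is, the `ℤ_(2)`-submodule spanned by `L`. -/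
def localizeTwo (L : AddSubgroup (∀ j, F j)) : Submodule ZTwo (∀ j, F j) :=
  Submodule.span ZTwo (L : Set (∀ j, F j))

variable [∀ j, NumberField.IsCMField (F j)]

/-- The congruence subgroup `U_{K,L}^2 = {ν ∈ U_K | (ν - 1) L_(2) ⊆ 2 L_(2)}`. -/
def congruenceSubgroup (L : AddSubgroup (∀ j, F j)) : Set (∀ j, F j) :=
  {ν | ν ∈ unitaryElements ∧
    ∀ x ∈ localizeTwo L, ∃ y ∈ localizeTwo L, (ν - 1) * x = 2 * y}

/-- The theta subgroup
`U_{K,L}^{θ,2} = {ν ∈ U_{K,L}^2 | ω_t(ν x, x) ∈ 4 ℤ_(2) for all x ∈ L_(2)}`. -/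
def thetaSubgroup (t : ∀ j, F j) (L : AddSubgroup (∀ j, F j)) : Set (∀ j, F j) :=
  {ν | ν ∈ congruenceSubgroup L ∧
    ∀ x ∈ localizeTwo L, ∃ q ∈ ZTwo, symplecticForm t (ν * x) x = 4 * q}

end Theta

end CMCritical

end

/-! The critical function comes from theta functions. Write `ω` as `∑ wt ρ * Im (ρ x * conj (ρ y))`
over the CM type, with positive weights. A theta characteristic `q : L → {±1}` gives a theta
function `θ_q` on `K`. The parallelogram law expands `θ_q (k + x) * θ_q (k - x)` as a sum over `s ∈
L` of a factor in `k, s` times a Gaussian sum over the coset `x + L`, twisted by `c = -s / 2`.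
Summing over `x` in representatives of `ν⁻¹ L / (L ∩ ν⁻¹ L)` assembles these cosets into a sum over
`N = L + ν⁻¹ L`.

The transformation formula (`exists_tsum_term`) says that the sum over `N`, twisted by the phase
`phi`, is `lam` times the sum over `L`, with the same `lam` for every `c`. Hence `∑ θ_q (k + x) θ_q
(k - x) = lam * θ_q k ^ 2` (`sum_theta_mul_theta`), and `k ↦ q k * θ_q (ν⁻¹ k)` is a critical
function on `L / (L ∩ ν L)`. It is nonzero for a suitable `q` (`exists_isCharacteristic`).

For the formula, discard the factors where `ν = 1`; on the others the substitution `ξ = (c + n) / (1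
- ν⁻¹)` turns the terms into complex Gaussians with parameters `1 - ρ ν`. A quadratic character
`chi` remains; the theta condition makes it trivial on `R = (1 - ν⁻¹) L / 2`, so it lives on a
finite group `N₁ / R`. Poisson summation on the cosets of `R` gives `lam = κ * ∏ (1 - ρ ν)⁻¹ *
(Gauss sum of chi)` with `κ > 0`.

The fourth power of such a Gauss sum is real of sign `(-1) ^ r`, with `r` the rank of the 2-torsion
(`exists_gauss_pow_four`). Here `r` is even, because the 2-torsion is the radical of an alternating
form over `ZMod 2` in even dimension. As `|lam| ^ 2 = d` (`mul_conj_eq`) and `(1 - u) ^ 4 = u ^ 2 *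
|1 - u| ^ 4` for `|u| = 1`, one gets `conj lam ^ 4 = d ^ 2 * N_Φ(ν) ^ 2`, so `conj lam`, with the
conjugate function, is the value sought.

Critical values are algebraic integers by a pigeonhole argument. Conjugating the fourth power
relation, with every `|ρ ν| = 1`, gives the moduli of the conjugates. -/

open scoped BigOperators

namespace CMCritical

/-! ### Alternating pairings on finite groups -/

section Alternating

variable {V : Type*} [AddCommGroup V]

/-- A bimultiplicative complex pairing on an abelian group. -/
structure IsPairing (B : V → V → ℂ) : Prop where
  add_left : ∀ x y z, B (x + y) z = B x z * B y z
  add_right : ∀ x y z, B x (y + z) = B x y * B x z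
  ne_zero : ∀ x y, B x y ≠ 0

namespace IsPairing

variable {B : V → V → ℂ}

lemma zero_left (h : IsPairing B) (y : V) : B 0 y = 1 := by
  have := h.add_left 0 0 y
  rw [add_zero] at this
  exact (mul_eq_left₀ (h.ne_zero 0 y)).1 this.symm

lemma zero_right (h : IsPairing B) (x : V) : B x 0 = 1 := by
  have := h.add_right x 0 0
  rw [add_zero] at this
  exact (mul_eq_left₀ (h.ne_zero x 0)).1 this.symm

lemma neg_right (h : IsPairing B) (x y : V) : B x (-y) = (B x y)⁻¹ := by
  refine eq_inv_of_mul_eq_one_left ?_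
  rw [← h.add_right, neg_add_cancel, h.zero_right]

lemma neg_left (h : IsPairing B) (x y : V) : B (-x) y = (B x y)⁻¹ := by
  refine eq_inv_of_mul_eq_one_left ?_
  rw [← h.add_left, neg_add_cancel, h.zero_left]

lemma nsmul_left (h : IsPairing B) (n : ℕ) (x y : V) : B (n • x) y = B x y ^ n := by
  induction n with
  | zero => simp [h.zero_left]
  | succ k ih => rw [succ_nsmul, h.add_left, ih, pow_succ]

lemma nsmul_right (h : IsPairing B) (n : ℕ) (x y : V) : B x (n • y) = B x y ^ n := by
  induction n with
  | zero => simp [h.zero_right]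
  | succ k ih => rw [succ_nsmul, h.add_right, ih, pow_succ]

/-- The left orthogonal of an element. -/
def orth (h : IsPairing B) (x : V) : AddSubgroup V where
  carrier := {z | B z x = 1}
  add_mem' {a b} ha hb := by
    simp only [Set.mem_ofPred_eq] at *
    rw [h.add_left, ha, hb, one_mul]
  zero_mem' := h.zero_left x
  neg_mem' {a} ha := by
    simp only [Set.mem_ofPred_eq] at *
    rw [h.neg_left, ha, inv_one]

lemma mem_orth (h : IsPairing B) {x z : V} : z ∈ h.orth x ↔ B z x = 1 := Iff.rfl

/-- The left radical of a subgroup. -/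
def radical (h : IsPairing B) (H : AddSubgroup V) : AddSubgroup V where
  carrier := {z | z ∈ H ∧ ∀ w ∈ H, B z w = 1}
  add_mem' {a b} ha hb := ⟨H.add_mem ha.1 hb.1, fun w hw => by
    rw [h.add_left, ha.2 w hw, hb.2 w hw, one_mul]⟩
  zero_mem' := ⟨H.zero_mem, fun w _ => h.zero_left w⟩
  neg_mem' {a} ha := ⟨H.neg_mem ha.1, fun w hw => by rw [h.neg_left, ha.2 w hw, inv_one]⟩

/-- The map `z ↦ B z x` is a sign character of `H`, nontrivial because of `a`, so its kernel has
index two. -/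
lemma card_eq_two_mul (h : IsPairing B) [Finite V] (H : AddSubgroup V)
    {x a : V} (ha : a ∈ H) (hax : B a x = -1) (hH : ∀ z ∈ H, B z x = 1 ∨ B z x = -1) :
    Nat.card H = 2 * Nat.card (H ⊓ h.orth x : AddSubgroup V) := by
  have h1 : (h.orth x).relIndex H = 2 := by
    rw [AddSubgroup.relIndex, AddSubgroup.index_eq_two_iff]
    refine ⟨⟨a, ha⟩, fun b => ?_⟩
    simp only [AddSubgroup.mem_addSubgroupOf, AddSubgroup.coe_add, mem_orth, h.add_left, hax]
    rcases hH b b.2 with hb | hb <;> rw [hb] <;> norm_num [Xor]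
  have h3 : (H ⊓ h.orth x).relIndex H = 2 := by
    rw [inf_comm, AddSubgroup.inf_relIndex_right, h1]
  have h2 := AddSubgroup.relIndex_mul_relIndex ⊥ (H ⊓ h.orth x) H bot_le inf_le_left
  rw [h3, AddSubgroup.relIndex_bot_left, AddSubgroup.relIndex_bot_left] at h2
  omega

/-- The index of the radical of an alternating pairing with values `±1` is a power of four. -/
lemma exists_card_eq_radical_mul (h : IsPairing B) [Finite V]
    (hB : ∀ x y, B x y = 1 ∨ B x y = -1) (halt : ∀ x, B x x = 1) (H : AddSubgroup V) :
    ∃ m : ℕ, Nat.card H = Nat.card (h.radical H) * 4 ^ m := by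
  have hsymm : ∀ x y, B x y = B y x := by
    intro x y
    have h1 := halt (x + y)
    rw [h.add_left, h.add_right, h.add_right, halt, halt, one_mul, mul_one] at h1
    rcases hB x y with h2 | h2 <;> rcases hB y x with h3 | h3 <;> rw [h2, h3] at h1 ⊢ <;>
      norm_num at h1
  induction hn : Nat.card H using Nat.strong_induction_on generalizing H with
  | _ n ih =>
  by_cases hall : ∀ x ∈ H, ∀ y ∈ H, B x y = 1
  · refine ⟨0, ?_⟩
    have : h.radical H = H := le_antisymm (fun z hz => hz.1) fun z hz => ⟨hz, hall z hz⟩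
    rw [this, hn, pow_zero, mul_one]
  · push Not at hall
    obtain ⟨x, hx, y, hy, hxy⟩ := hall
    have hxy' : B x y = -1 := (hB x y).resolve_left hxy
    have hyx : B y x = -1 := by rw [hsymm, hxy']
    -- The pair `x, y` is a hyperbolic plane: its orthogonal `U` has index four in `H` and the same
    -- radical, so the induction divides by four each time.
    have c1 := h.card_eq_two_mul H hy hyx fun z _ => hB z x
    have c2 := h.card_eq_two_mul (H ⊓ h.orth x) (a := x) (x := y)
      ⟨hx, h.mem_orth.2 (halt x)⟩ hxy' fun z _ => hB z y
    set U := H ⊓ h.orth x ⊓ h.orth y with hU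
    have cpos : 0 < Nat.card U := Nat.card_pos
    obtain ⟨m, hm⟩ := ih (Nat.card U) (by omega) U rfl
    have hrad : h.radical U = h.radical H := by
      ext z
      constructor
      · rintro ⟨⟨⟨hz, hzx⟩, hzy⟩, hz2⟩
        refine ⟨hz, fun w hw => ?_⟩
        -- Adding `x` or `y` corrects the signs of `w` against `y` and `x`, and does not change its
        -- pairing with `z`.
        have key : ∃ i j : ℕ, w + i • x + j • y ∈ U := by
          rcases hB w x with h1 | h1 <;> rcases hB w y with h2 | h2
          · exact ⟨0, 0, by simpa using ⟨⟨hw, h1⟩, h2⟩⟩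
          · refine ⟨1, 0, ⟨⟨H.add_mem (H.add_mem hw (by simpa)) (by simp), ?_⟩, ?_⟩⟩ <;>
              simp [mem_orth, h.add_left, h1, h2, halt, hxy']
          · refine ⟨0, 1, ⟨⟨H.add_mem (H.add_mem hw (by simp)) (by simpa), ?_⟩, ?_⟩⟩ <;>
              simp [mem_orth, h.add_left, h1, h2, halt, hyx]
          · refine ⟨1, 1, ⟨⟨H.add_mem (H.add_mem hw (by simpa)) (by simpa), ?_⟩, ?_⟩⟩ <;>
              simp [mem_orth, h.add_left, h1, h2, halt, hyx, hxy']
        obtain ⟨i, j, hij⟩ := key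
        have := hz2 _ hij
        rw [h.add_right, h.add_right, h.nsmul_right, h.nsmul_right,
          h.mem_orth.1 hzx, h.mem_orth.1 hzy] at this
        simpa using this
      · rintro ⟨hz, hz2⟩
        exact ⟨⟨⟨hz, hz2 x hx⟩, hz2 y hy⟩, fun w hw => hz2 w hw.1.1⟩
    refine ⟨m + 1, ?_⟩
    rw [← hn, c1, c2, hm, hrad]
    ring

end IsPairing

end Alternating

/-! ### Gauss sums of quadratic characters -/

section Gauss

/-- A quadratic character of an abelian group: a unitary complex function which is even and
whose polarization is bimultiplicative. -/
structure IsQuadraticCharacter {G : Type*} [AddCommGroup G] (χ : G → ℂ) (B : G → G → ℂ) :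
    Prop where
  pairing : IsPairing B
  map_add : ∀ x y, χ (x + y) = χ x * χ y * B x y
  map_neg : ∀ x, χ (-x) = χ x
  norm_eq_one : ∀ x, ‖χ x‖ = 1

namespace IsQuadraticCharacter

variable {G : Type*} [AddCommGroup G] {χ : G → ℂ} {B : G → G → ℂ}

lemma ne_zero (h : IsQuadraticCharacter χ B) (x : G) : χ x ≠ 0 := by
  intro h0
  have := h.norm_eq_one x
  simp [h0] at this

lemma symm (h : IsQuadraticCharacter χ B) (x y : G) : B x y = B y x := by
  have h1 := h.map_add x y
  rw [add_comm, h.map_add y x, mul_comm (χ y)] at h1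
  exact (mul_left_cancel₀ (mul_ne_zero (h.ne_zero x) (h.ne_zero y)) h1).symm

lemma map_zero (h : IsQuadraticCharacter χ B) : χ 0 = 1 := by
  have h1 := h.map_add 0 0
  rw [add_zero, h.pairing.zero_left, mul_one] at h1
  exact (mul_eq_left₀ (h.ne_zero 0)).1 h1.symm

/-- Evaluate `χ` at `x + (-x)`; evenness is what makes the answer a square. -/
lemma self_eq_sq (h : IsQuadraticCharacter χ B) (x : G) : B x x = χ x ^ 2 := by
  have h1 := h.map_add x (-x)
  rw [add_neg_cancel, h.map_zero, h.map_neg, h.pairing.neg_right] at h1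
  have := h.pairing.ne_zero x x
  field_simp at h1
  exact h1

lemma map_nsmul (h : IsQuadraticCharacter χ B) (n : ℕ) (x : G) :
    χ (n • x) = χ x ^ (n ^ 2) := by
  induction n with
  | zero => simp [h.map_zero]
  | succ k ih =>
    rw [succ_nsmul, h.map_add, ih, h.pairing.nsmul_left, h.self_eq_sq]
    ring

lemma add_mul_sub (h : IsQuadraticCharacter χ B) (x y : G) :
    χ (x + y) * χ (x - y) = χ x ^ 2 * χ y ^ 2 := by
  rw [sub_eq_add_neg, h.map_add, h.map_add, h.map_neg, h.pairing.neg_right]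
  have := h.pairing.ne_zero x y
  field_simp

/-- A nondegenerate pairing on a finite group realizes all characters. -/
lemma exists_eq_addChar (h : IsQuadraticCharacter χ B) [Finite G]
    (hnd : ∀ x, (∀ y, B x y = 1) → x = 0) (ψ : AddChar G ℂ) : ∃ x, ∀ y, ψ y = B x y := by
  classical
  have := Fintype.ofFinite G
  let F : G → AddChar G ℂ := fun x =>
    { toFun := B x
      map_zero_eq_one' := h.pairing.zero_right x
      map_add_eq_mul' := h.pairing.add_right x }
  have hinj : Function.Injective F := by
    intro x y hxy
    rw [← sub_eq_zero]
    refine hnd _ fun z => ?_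
    have : B x z = B y z := DFunLike.congr_fun hxy z
    rw [sub_eq_add_neg, h.pairing.add_left, h.pairing.neg_left, this,
      mul_inv_cancel₀ (h.pairing.ne_zero y z)]
  have hbij : Function.Bijective F := by
    rw [Fintype.bijective_iff_injective_and_card]
    exact ⟨hinj, (AddChar.card_eq).symm⟩
  obtain ⟨x, hx⟩ := hbij.2 ψ
  exact ⟨x, fun y => by rw [← hx]; rfl⟩

/-- For a nondegenerate pairing, the orthogonal of the `2`-torsion consists of doubles. -/
lemma exists_double (h : IsQuadraticCharacter χ B) [Finite G]
    (hnd : ∀ x, (∀ y, B x y = 1) → x = 0) {t : G}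
    (ht : ∀ x, x + x = 0 → B x t = 1) : ∃ s, t = s + s := by
  classical
  have := Fintype.ofFinite G
  let D : AddSubgroup G := (nsmulAddMonoidHom (α := G) 2).range
  by_contra hs
  have htD : (t : G ⧸ D) ≠ 0 := by
    rw [Ne, QuotientAddGroup.eq_zero_iff]
    rintro ⟨s, rfl⟩
    exact hs ⟨s, by simp [two_nsmul]⟩
  obtain ⟨ψ, hψ⟩ := (AddChar.exists_apply_ne_zero (a := (t : G ⧸ D))).2 htD
  obtain ⟨x, hx⟩ := h.exists_eq_addChar hnd (ψ.compAddMonoidHom (QuotientAddGroup.mk' D))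
  refine hψ ?_
  have h1 := hx t
  rw [AddChar.compAddMonoidHom_apply, QuotientAddGroup.mk'_apply] at h1
  rw [h1]
  refine ht x (hnd _ fun y => ?_)
  rw [h.pairing.add_left, ← h.pairing.add_right, ← hx, AddChar.compAddMonoidHom_apply]
  have : QuotientAddGroup.mk' D (y + y) = 0 := by
    rw [QuotientAddGroup.mk'_apply, QuotientAddGroup.eq_zero_iff]
    exact ⟨y, by simp [two_nsmul]⟩
  rw [this, AddChar.map_zero_eq_one]

end IsQuadraticCharacter

end Gauss

end CMCritical

/-! ### The sign of the fourth power of a quadratic Gauss sum -/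

open scoped BigOperators

namespace CMCritical

namespace IsQuadraticCharacter

universe u

variable {G : Type u} [AddCommGroup G] {χ : G → ℂ} {B : G → G → ℂ}

/-- The `2`-torsion subgroup. -/
def twoTorsion (G : Type*) [AddCommGroup G] : AddSubgroup G where
  carrier := {x | x + x = 0}
  add_mem' {a b} ha hb := by
    simp only [Set.mem_ofPred_eq] at *
    rw [add_add_add_comm, ha, hb, add_zero]
  zero_mem' := by simp
  neg_mem' {a} ha := by
    simp only [Set.mem_ofPred_eq] at *
    rw [← neg_add, ha, neg_zero]

lemma mem_twoTorsion {x : G} : x ∈ twoTorsion G ↔ x + x = 0 := Iff.rfl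

/-- A prime `m = a ^ 2 + b ^ 2` with `m ≡ -1` modulo `n` gives the bijection `(x, y) ↦ (a x + b y, b
x - a y)` of `G × G`. It raises `χ x * χ y` to the power `m`, which is complex conjugation since the
values are `n`-th roots of unity. So the square of the sum equals its conjugate. -/
lemma gauss_sq_real_of_odd (h : IsQuadraticCharacter χ B) [Fintype G]
    (hodd : Odd (Nat.card G)) : ∃ t : ℝ, (∑ x, χ x) ^ 2 = t := by
  set n := Nat.card G with hn
  have hn0 : n ≠ 0 := Nat.card_pos.ne'
  have hzero : ∀ x : G, n • x = 0 := fun x => card_nsmul_eq_zero'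
  have hχn : ∀ x, χ x ^ n = 1 := by
    intro x
    have h1 : χ x ^ (n ^ 2) = 1 := by rw [← h.map_nsmul, hzero, h.map_zero]
    have h2 : χ x ^ (2 * n) = 1 := by
      rw [pow_mul, ← h.self_eq_sq, ← h.pairing.nsmul_left, hzero, h.pairing.zero_left]
    obtain ⟨k, hk⟩ := hodd
    have h3 : n ^ 2 = n + 2 * n * k := by rw [hk]; ring
    rw [h3, pow_add, pow_mul, h2, one_pow, mul_one] at h1
    exact h1
  -- Chinese remainders give the class `-1` modulo `n` and `1` modulo `4`, and Dirichlet gives a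
  -- prime in it. The congruence modulo `4` makes this prime a sum of two squares.
  obtain ⟨m, hm, hmn, hm4⟩ : ∃ m : ℕ, m.Prime ∧ n ∣ m + 1 ∧ m % 4 = 1 := by
    have hcop : n.Coprime 4 := by
      have : n.Coprime (2 ^ 2) := Nat.Coprime.pow_right 2 hodd.coprime_two_right
      simpa using this
    obtain ⟨a, ha1, ha2⟩ := Nat.chineseRemainder hcop (n - 1) 1
    have hq : NeZero (n * 4) := ⟨by positivity⟩
    have hunit : IsUnit ((a : ℕ) : ZMod (n * 4)) := by
      rw [ZMod.isUnit_iff_coprime]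
      refine Nat.Coprime.mul_right ?_ ?_
      · rw [Nat.Coprime, ha1.gcd_eq]
        rcases Nat.exists_eq_succ_of_ne_zero hn0 with ⟨k, hk⟩
        rw [hk, Nat.succ_sub_one]
        simp
      · rw [Nat.Coprime, ha2.gcd_eq]
        simp
    obtain ⟨p, hp0, hp, hpa⟩ := Nat.forall_exists_prime_gt_and_eq_mod hunit 0
    rw [ZMod.natCast_eq_natCast_iff] at hpa
    refine ⟨p, hp, ?_, ?_⟩
    · have h1 : p ≡ n - 1 [MOD n] := (hpa.of_mul_right 4).trans ha1
      have h2 : p + 1 ≡ n - 1 + 1 [MOD n] := h1.add_right 1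
      rw [Nat.sub_add_cancel (Nat.pos_of_ne_zero hn0)] at h2
      exact (Nat.modEq_zero_iff_dvd).1 (h2.trans (by simp [Nat.ModEq]))
    · have h1 : p ≡ 1 [MOD 4] := (hpa.of_mul_left n).trans ha2
      exact h1
  have := Fact.mk hm
  obtain ⟨a, b, hab⟩ := Nat.Prime.sq_add_sq (p := m) (by omega)
  have hpow : ∀ x, χ x ^ m = (starRingEnd ℂ) (χ x) := by
    intro x
    obtain ⟨k, hk⟩ := hmn
    have h1 : χ x ^ (m + 1) = 1 := by rw [hk, pow_mul, hχn, one_pow]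
    rw [pow_succ] at h1
    rw [eq_inv_of_mul_eq_one_left h1, Complex.inv_eq_conj (h.norm_eq_one x)]
  have hmx : ∀ x : G, m • x = 0 → x = 0 := by
    intro x hx
    obtain ⟨k, hk⟩ := hmn
    have h1 : (m + 1) • x = 0 := by rw [hk, mul_comm, mul_nsmul, hzero]
    rwa [succ_nsmul, hx, zero_add] at h1
  let T : G × G →+ G × G :=
    { toFun := fun p => (a • p.1 + b • p.2, b • p.1 - a • p.2)
      map_zero' := by simp
      map_add' := by
        intro p q
        ext
        · simp only [Prod.fst_add, Prod.snd_add, nsmul_add]; abel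
        · simp only [Prod.fst_add, Prod.snd_add, nsmul_add]; abel }
  have hT : Function.Bijective T := by
    rw [← Finite.injective_iff_bijective]
    rw [injective_iff_map_eq_zero]
    rintro ⟨x, y⟩ hxy
    have e1 : a • x + b • y = 0 := congrArg Prod.fst hxy
    have e2 : b • x - a • y = 0 := congrArg Prod.snd hxy
    have hx : x = 0 := by
      refine hmx x ?_
      have : m • x = a • (a • x + b • y) + b • (b • x - a • y) := by
        rw [← hab]; module
      rw [this, e1, e2]; simp
    have hy : y = 0 := by
      refine hmx y ?_
      have : m • y = b • (a • x + b • y) - a • (b • x - a • y) := by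
        rw [← hab]; module
      rw [this, e1, e2]; simp
    rw [hx, hy]; rfl
  have key : ∀ x y, χ (a • x + b • y) * χ (b • x - a • y) =
      (starRingEnd ℂ) (χ x) * (starRingEnd ℂ) (χ y) := by
    intro x y
    rw [← hpow, ← hpow, ← hab, sub_eq_add_neg, h.map_add, h.map_add, h.map_neg,
      h.map_nsmul, h.map_nsmul, h.map_nsmul, h.map_nsmul, h.pairing.nsmul_left,
      h.pairing.nsmul_left, h.pairing.neg_right, h.pairing.nsmul_right, h.pairing.nsmul_right,
      ← pow_mul, ← inv_pow, ← pow_mul, mul_comm b a]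
    have hB : B x y ^ (a * b) ≠ 0 := pow_ne_zero _ (h.pairing.ne_zero x y)
    rw [inv_pow]
    field_simp
    ring
  have hsq : (∑ x, χ x) ^ 2 = (starRingEnd ℂ) ((∑ x, χ x) ^ 2) := by
    have e1 : (∑ x, χ x) ^ 2 = ∑ p : G × G, χ p.1 * χ p.2 := by
      rw [sq, Finset.sum_mul_sum, ← Fintype.sum_prod_type' (fun x y => χ x * χ y)]
    rw [e1, map_sum]
    conv_lhs => rw [← Function.Bijective.sum_comp hT (fun p : G × G => χ p.1 * χ p.2)]
    simp only [map_mul]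
    exact Finset.sum_congr rfl fun p _ => key p.1 p.2
  obtain ⟨t, ht⟩ := Complex.conj_eq_iff_real.1 hsq.symm
  exact ⟨t, ht⟩

/-- The restriction of a quadratic character to a subgroup. -/
lemma restrict (h : IsQuadraticCharacter χ B) (H : AddSubgroup G) :
    IsQuadraticCharacter (fun x : H => χ x) (fun x y : H => B x y) where
  pairing := ⟨fun x y z => h.pairing.add_left x y z, fun x y z => h.pairing.add_right x y z,
    fun x y => h.pairing.ne_zero x y⟩
  map_add x y := h.map_add x y
  map_neg x := h.map_neg x
  norm_eq_one x := h.norm_eq_one x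

/-- Translation by `x₀` exchanges the orthogonal of `x₀` with its complement and multiplies `χ` by
`χ x₀` there. -/
lemma sum_eq_mul_sum_orth (h : IsQuadraticCharacter χ B) [Fintype G] {x₀ : G}
    (hB : ∀ y, B y x₀ = 1 ∨ B y x₀ = -1) (h0 : B x₀ x₀ = -1) [Fintype (h.pairing.orth x₀)] :
    ∑ x, χ x = (1 + χ x₀) * ∑ x : h.pairing.orth x₀, χ x := by
  classical
  have h1 : ∑ x, χ x = ∑ x ∈ Finset.univ.filter (fun x => B x x₀ = 1), χ x +
      ∑ x ∈ Finset.univ.filter (fun x => ¬ B x x₀ = 1), χ x :=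
    (Finset.sum_filter_add_sum_filter_not _ _ _).symm
  have h2 : ∑ x ∈ Finset.univ.filter (fun x => ¬ B x x₀ = 1), χ x =
      ∑ x ∈ Finset.univ.filter (fun x => B x x₀ = 1), χ x₀ * χ x := by
    symm
    refine Finset.sum_bij' (fun x _ => x + x₀) (fun x _ => x - x₀) ?_ ?_ ?_ ?_ ?_
    · intro x hx
      simp only [Finset.mem_filter, Finset.mem_univ, true_and] at hx ⊢
      rw [h.pairing.add_left, hx, h0]; norm_num
    · intro x hx
      simp only [Finset.mem_filter, Finset.mem_univ, true_and] at hx ⊢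
      rw [sub_eq_add_neg, h.pairing.add_left, (hB x).resolve_left hx, h.pairing.neg_left, h0]
      norm_num
    · intro x _; simp
    · intro x _; simp
    · intro x hx
      simp only [Finset.mem_filter, Finset.mem_univ, true_and] at hx
      rw [h.map_add, hx]; ring
  have h3 : ∑ x : h.pairing.orth x₀, χ x = ∑ x ∈ Finset.univ.filter (fun x => B x x₀ = 1), χ x := by
    rw [Finset.sum_subtype (p := fun x => x ∈ h.pairing.orth x₀)]
    intro x
    simp [IsPairing.mem_orth]
  rw [h1, h2, h3, ← Finset.mul_sum]
  ring


section Descent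

/-- When `χ ^ 2` is trivial on the `2`-torsion, it descends to the quotient by the `2`-torsion. -/
lemma exists_descent (h : IsQuadraticCharacter χ B)
    (h2 : ∀ x ∈ twoTorsion G, χ x ^ 2 = 1) (hnd : ∀ x, (∀ y, B x y = 1) → x = 0) :
    ∃ (χ' : G ⧸ twoTorsion G → ℂ) (B' : G ⧸ twoTorsion G → G ⧸ twoTorsion G → ℂ),
      IsQuadraticCharacter χ' B' ∧ (∀ x, (∀ y, B' x y = 1) → x = 0) ∧
      ∀ x : G, χ' x = χ x ^ 2 := by
  have hBS : ∀ x ∈ twoTorsion G, ∀ y, B x y ^ 2 = 1 := by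
    intro x hx y
    rw [sq, ← h.pairing.add_left, mem_twoTorsion.1 hx, h.pairing.zero_left]
  have hsub : ∀ {a b : G}, QuotientAddGroup.leftRel (twoTorsion G) a b → b - a ∈ twoTorsion G := by
    intro a b hab
    rw [QuotientAddGroup.leftRel_apply] at hab
    rwa [sub_eq_neg_add]
  have hB1 : ∀ a b y, QuotientAddGroup.leftRel (twoTorsion G) a b → B a y ^ 2 = B b y ^ 2 := by
    intro a b y hab
    have h3 : b = (b - a) + a := by abel
    rw [h3, h.pairing.add_left, mul_pow, hBS _ (hsub hab), one_mul]
  let χ' : G ⧸ twoTorsion G → ℂ := Quotient.lift (fun x => χ x ^ 2) (by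
    intro a b hab
    have h3 : b = (b - a) + a := by abel
    rw [h3, h.map_add, mul_pow, mul_pow, h2 _ (hsub hab), hBS _ (hsub hab), one_mul, mul_one])
  let B' : G ⧸ twoTorsion G → G ⧸ twoTorsion G → ℂ := Quotient.lift₂ (fun x y => B x y ^ 2) (by
    intro a b c d hac hbd
    rw [hB1 a c b hac, h.symm, hB1 b d c hbd, h.symm])
  refine ⟨χ', B', ⟨⟨?_, ?_, ?_⟩, ?_, ?_, ?_⟩, ?_, fun x => rfl⟩
  · rintro ⟨x⟩ ⟨y⟩ ⟨z⟩
    change B (x + y) z ^ 2 = B x z ^ 2 * B y z ^ 2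
    rw [h.pairing.add_left, mul_pow]
  · rintro ⟨x⟩ ⟨y⟩ ⟨z⟩
    change B x (y + z) ^ 2 = B x y ^ 2 * B x z ^ 2
    rw [h.pairing.add_right, mul_pow]
  · rintro ⟨x⟩ ⟨y⟩
    exact pow_ne_zero _ (h.pairing.ne_zero x y)
  · rintro ⟨x⟩ ⟨y⟩
    change χ (x + y) ^ 2 = χ x ^ 2 * χ y ^ 2 * B x y ^ 2
    rw [h.map_add, mul_pow, mul_pow]
  · rintro ⟨x⟩
    change χ (-x) ^ 2 = χ x ^ 2
    rw [h.map_neg]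
  · rintro ⟨x⟩
    change ‖χ x ^ 2‖ = 1
    rw [norm_pow, h.norm_eq_one, one_pow]
  · rintro ⟨x⟩ hx
    refine (QuotientAddGroup.eq_zero_iff x).2 (hnd _ fun y => ?_)
    rw [h.pairing.add_left, ← sq]
    exact hx y

/-- The square of the sum is `∑ t, ∑ u, χ (u + t) * χ u`, where only doubles `t` contribute. The
square on the right is the same sum with `t = y + y`, by `add_mul_sub`, so that each double is
counted once per element of the 2-torsion. -/
lemma card_mul_sq_sum (h : IsQuadraticCharacter χ B) [Fintype G]
    (h2 : ∀ x ∈ twoTorsion G, χ x ^ 2 = 1) (hnd : ∀ x, (∀ y, B x y = 1) → x = 0) :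
    (Nat.card (twoTorsion G) : ℂ) * (∑ x, χ x) ^ 2 = (∑ x, χ x ^ 2) ^ 2 := by
  classical
  -- Some 2-torsion `x` has `B x t ≠ 1` when `t` is not a double, and translating `u` by `x`
  -- multiplies the inner sum by `B x t`.
  have hA : ∀ t, (∃ s, t = s + s) ∨ ∑ u, χ (u + t) * χ u = 0 := by
    intro t
    by_cases ht : ∀ x, x + x = 0 → B x t = 1
    · exact Or.inl (h.exists_double hnd ht)
    · push Not at ht
      obtain ⟨x, hx, hxt⟩ := ht
      right
      have h1 : ∑ u, χ (u + t) * χ u = B x t * ∑ u, χ (u + t) * χ u := by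
        conv_lhs => rw [← Equiv.sum_comp (Equiv.addRight x)]
        rw [Finset.mul_sum]
        refine Finset.sum_congr rfl fun u _ => ?_
        simp only [Equiv.coe_addRight]
        have e1 : u + x + t = u + t + x := by abel
        rw [e1, h.map_add (u + t) x, h.map_add u x, h.pairing.add_left]
        have e2 : χ x * χ x = 1 := by rw [← sq]; exact h2 x hx
        have e3 : B u x * B u x = 1 := by
          rw [← h.pairing.add_right, hx, h.pairing.zero_right]
        rw [h.symm t x]
        linear_combination (χ (u + t) * χ u * B x t) * (e2 * B u x * B u x + e3)
      have h3 : (B x t - 1) * ∑ u, χ (u + t) * χ u = 0 := by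
        rw [sub_mul, ← h1]; ring
      exact (mul_eq_zero.1 h3).resolve_left (sub_ne_zero.2 hxt)
  have hfib : ∀ t, ((Finset.univ.filter fun y : G => y + y = t).card : ℂ) *
      (∑ u, χ (u + t) * χ u) = Nat.card (twoTorsion G) * ∑ u, χ (u + t) * χ u := by
    intro t
    rcases hA t with ⟨s, rfl⟩ | h0
    · congr 2
      rw [← SetLike.coe_sort_coe, Nat.card_eq_card_toFinset]
      refine Finset.card_bij' (fun y _ => y - s) (fun y _ => y + s) ?_ ?_ ?_ ?_
      · intro y hy
        simp only [Finset.mem_filter, Finset.mem_univ, true_and, Set.mem_toFinset,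
          SetLike.mem_coe, mem_twoTorsion] at hy ⊢
        rw [sub_add_sub_comm, hy, sub_self]
      · intro y hy
        simp only [Finset.mem_filter, Finset.mem_univ, true_and, Set.mem_toFinset,
          SetLike.mem_coe, mem_twoTorsion] at hy ⊢
        rw [add_add_add_comm, hy, zero_add]
      · intro y _; simp
      · intro y _; simp
    · rw [h0, mul_zero, mul_zero]
  have e1 : (∑ x, χ x) ^ 2 = ∑ t, ∑ u, χ (u + t) * χ u := by
    rw [sq, Finset.sum_mul_sum, Finset.sum_comm, Finset.sum_comm (f := fun t u => χ (u + t) * χ u)]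
    refine Finset.sum_congr rfl fun u _ => ?_
    exact (Equiv.sum_comp (Equiv.addLeft u) (fun x => χ x * χ u)).symm
  have e2 : (∑ x, χ x ^ 2) ^ 2 = ∑ y, ∑ u, χ (u + (y + y)) * χ u := by
    rw [sq, Finset.sum_mul_sum, Finset.sum_comm]
    refine Finset.sum_congr rfl fun y _ => ?_
    rw [← Equiv.sum_comp (Equiv.addRight y) (fun x => χ x ^ 2 * χ y ^ 2)]
    refine Finset.sum_congr rfl fun u _ => ?_
    simp only [Equiv.coe_addRight]
    rw [← h.add_mul_sub, add_sub_cancel_right, add_assoc]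
  rw [e1, e2, Finset.mul_sum]
  rw [← Finset.sum_fiberwise (s := Finset.univ) (g := fun y : G => y + y)
    (f := fun y => ∑ u, χ (u + (y + y)) * χ u)]
  refine Finset.sum_congr rfl fun t _ => ?_
  have e3 : ∑ y ∈ Finset.univ.filter (fun y : G => y + y = t), ∑ u, χ (u + (y + y)) * χ u =
      ∑ y ∈ Finset.univ.filter (fun y : G => y + y = t), ∑ u, χ (u + t) * χ u :=
    Finset.sum_congr rfl fun y hy => by rw [(Finset.mem_filter.1 hy).2]
  rw [← hfib, e3, Finset.sum_const, nsmul_eq_mul]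

lemma sum_descent [Fintype G] {χ' : G ⧸ twoTorsion G → ℂ} {ψ : G → ℂ}
    [Fintype (G ⧸ twoTorsion G)]
    (hχ' : ∀ x : G, χ' x = ψ x) : ∑ x, ψ x = Nat.card (twoTorsion G) * ∑ x, χ' x := by
  classical
  rw [← Finset.sum_fiberwise (s := Finset.univ) (g := fun y : G => (y : G ⧸ twoTorsion G)),
    Finset.mul_sum]
  refine Finset.sum_congr rfl fun q _ => ?_
  have e1 : ∑ y ∈ Finset.univ.filter (fun y : G => (y : G ⧸ twoTorsion G) = q), ψ y =
      ∑ y ∈ Finset.univ.filter (fun y : G => (y : G ⧸ twoTorsion G) = q), χ' q :=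
    Finset.sum_congr rfl fun y hy => by rw [← hχ', (Finset.mem_filter.1 hy).2]
  have e2 : Nat.card (twoTorsion G) =
      (Finset.univ.filter (fun y : G => (y : G ⧸ twoTorsion G) = q)).card := by
    obtain ⟨x, rfl⟩ := QuotientAddGroup.mk_surjective q
    rw [← SetLike.coe_sort_coe, Nat.card_eq_card_toFinset]
    refine Finset.card_bij' (fun y _ => x + y) (fun y _ => -x + y) ?_ ?_ ?_ ?_
    · intro y hy
      simpa using hy
    · intro y hy
      simp only [Finset.mem_filter, Finset.mem_univ, true_and, Set.mem_toFinset,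
        SetLike.mem_coe] at hy ⊢
      exact QuotientAddGroup.eq.1 hy.symm
    · intro y _; simp
    · intro y _; simp
  rw [e1, Finset.sum_const, nsmul_eq_mul, e2]

/-- As `χ ^ 2 = 1` on the 2-torsion `S`, the pairing restricted to `S` is alternating with signs as
values, so its radical has index a power of four. Doubling identifies the 2-torsion of `G ⧸ S` with
this radical, which is `S ∩ 2 G` by `exists_double`. -/
lemma exists_card_twoTorsion_eq (h : IsQuadraticCharacter χ B) [Finite G]
    (h2 : ∀ x ∈ twoTorsion G, χ x ^ 2 = 1) (hnd : ∀ x, (∀ y, B x y = 1) → x = 0) :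
    ∃ m : ℕ, Nat.card (twoTorsion G) = Nat.card (twoTorsion (G ⧸ twoTorsion G)) * 4 ^ m := by
  let S := twoTorsion G
  have hS := h.restrict S
  obtain ⟨m, hm⟩ := hS.pairing.exists_card_eq_radical_mul (fun x y => by
    have : B x y ^ 2 = 1 := by
      rw [sq, ← h.pairing.add_left, mem_twoTorsion.1 x.2, h.pairing.zero_left]
    exact sq_eq_one_iff.1 this) (fun x => by
      rw [h.self_eq_sq]; exact h2 x x.2) ⊤
  refine ⟨m, ?_⟩
  rw [Nat.card_congr (AddSubgroup.topEquiv (G := S)).toEquiv] at hm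
  rw [hm]
  congr 1
  let dbl : G ⧸ S →+ G := QuotientAddGroup.lift S (nsmulAddMonoidHom 2) (fun x hx => by
    simpa [two_nsmul] using mem_twoTorsion.1 hx)
  have hdbl : ∀ x : G, dbl x = x + x := fun x => two_nsmul x
  have hinj : Function.Injective dbl := by
    rw [injective_iff_map_eq_zero]
    rintro ⟨x⟩ hx
    exact (QuotientAddGroup.eq_zero_iff x).2 (mem_twoTorsion.2 ((hdbl x).symm.trans hx))
  refine (Nat.card_congr (Equiv.ofBijective (fun x : twoTorsion (G ⧸ S) =>
    (⟨⟨dbl x, ?_⟩, ?_⟩ : hS.pairing.radical ⊤)) ⟨?_, ?_⟩)).symm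
  · rw [mem_twoTorsion, ← _root_.map_add, mem_twoTorsion.1 x.2, _root_.map_zero]
  · refine ⟨AddSubgroup.mem_top _, fun w _ => ?_⟩
    obtain ⟨⟨x⟩, hx⟩ := x
    change B (dbl (x : G ⧸ S)) w = 1
    rw [hdbl, h.pairing.add_left, ← h.pairing.add_right, mem_twoTorsion.1 w.2,
      h.pairing.zero_right]
  · intro x y hxy
    have := congrArg (fun z : hS.pairing.radical ⊤ => ((z : S) : G)) hxy
    exact Subtype.ext (hinj this)
  · rintro ⟨⟨t, ht⟩, -, ht2⟩
    obtain ⟨s, rfl⟩ := h.exists_double hnd (t := t) (fun x hx => by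
      rw [h.symm]; exact ht2 ⟨x, hx⟩ (AddSubgroup.mem_top _))
    refine ⟨⟨(s : G ⧸ S), ?_⟩, ?_⟩
    · refine mem_twoTorsion.2 (hinj ?_)
      rw [_root_.map_add, _root_.map_zero, hdbl]
      exact mem_twoTorsion.1 ht
    · exact Subtype.ext (Subtype.ext (hdbl s))

end Descent

/-- The fourth power of the Gauss sum of a nondegenerate quadratic character on a finite group `G`
is real, and its sign is `(-1) ^ r`, where `r` is the rank of the `2`-torsion of `G`. -/
theorem exists_gauss_pow_four (h : IsQuadraticCharacter χ B) [Fintype G]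
    (hnd : ∀ x, (∀ y, B x y = 1) → x = 0) :
    ∃ (r : ℕ) (t : ℝ), Nat.card (twoTorsion G) = 2 ^ r ∧ 0 ≤ t ∧
      (∑ x, χ x) ^ 4 = (-1) ^ r * t := by
  classical
  have main : ∀ n : ℕ, ∀ (G : Type u) [AddCommGroup G] (χ : G → ℂ) (B : G → G → ℂ) [Fintype G],
      Nat.card G = n → IsQuadraticCharacter χ B → (∀ x, (∀ y, B x y = 1) → x = 0) →
      ∃ (r : ℕ) (t : ℝ), Nat.card (twoTorsion G) = 2 ^ r ∧ 0 ≤ t ∧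
        (∑ x, χ x) ^ 4 = (-1) ^ r * t := by
    intro n
    induction n using Nat.strong_induction_on with
    | _ n ih =>
    intro G _ χ B _ hn h hnd
    by_cases hS : twoTorsion G = ⊥
    -- Without 2-torsion the order is odd, the square of the sum is real and its fourth power is
    -- nonnegative.
    · have hodd : Odd (Nat.card G) := by
        rw [← Nat.not_even_iff_odd]
        intro hev
        have : Fact (Nat.Prime 2) := ⟨Nat.prime_two⟩
        obtain ⟨x, hx⟩ := exists_prime_addOrderOf_dvd_card' 2 (even_iff_two_dvd.1 hev)
        have hx2 : x ∈ twoTorsion G := by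
          rw [mem_twoTorsion, ← two_nsmul, ← hx, addOrderOf_nsmul_eq_zero]
        rw [hS, AddSubgroup.mem_bot] at hx2
        rw [hx2, addOrderOf_zero] at hx
        norm_num at hx
      obtain ⟨t, ht⟩ := h.gauss_sq_real_of_odd hodd
      refine ⟨0, t ^ 2, by rw [hS]; simp, sq_nonneg t, ?_⟩
      rw [show 4 = 2 * 2 by norm_num, pow_mul, ht]
      push_cast; ring
    -- Here `χ x₀ = ±i` and `G` is the orthogonal sum of `⟨x₀⟩` and its orthogonal. The rank drops
    -- by one, and the sign changes because `(1 ± i) ^ 4 = -4`.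
    by_cases hA : ∃ x₀ ∈ twoTorsion G, χ x₀ ^ 2 ≠ 1
    · obtain ⟨x₀, hx₀, hχ⟩ := hA
      have hBx : ∀ y, B y x₀ = 1 ∨ B y x₀ = -1 := by
        intro y
        refine sq_eq_one_iff.1 ?_
        rw [sq, ← h.pairing.add_right, mem_twoTorsion.1 hx₀, h.pairing.zero_right]
      have h00 : B x₀ x₀ = -1 := by
        refine (hBx x₀).resolve_left ?_
        rwa [h.self_eq_sq]
      let H := h.pairing.orth x₀
      have hH := h.restrict H
      have hsplit : ∀ y, y ∈ H ∨ y + x₀ ∈ H := by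
        intro y
        rcases hBx y with hy | hy
        · exact Or.inl hy
        · right
          rw [IsPairing.mem_orth, h.pairing.add_left, hy, h00]; norm_num
      have hndH : ∀ x : H, (∀ y : H, B x y = 1) → x = 0 := by
        intro x hx
        refine Subtype.ext (hnd _ fun y => ?_)
        rcases hsplit y with hy | hy
        · exact hx ⟨y, hy⟩
        · have h1 : B x (y + x₀) = 1 := hx ⟨_, hy⟩
          rw [h.pairing.add_right, h.pairing.mem_orth.1 x.2, mul_one] at h1
          exact h1
      have c1 := h.pairing.card_eq_two_mul ⊤ (AddSubgroup.mem_top x₀) h00 fun z _ => hBx z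
      have c2 := h.pairing.card_eq_two_mul (twoTorsion G) hx₀ h00 fun z _ => hBx z
      rw [AddSubgroup.card_top, top_inf_eq] at c1
      change Nat.card G = 2 * Nat.card H at c1
      have hpos : 0 < Nat.card H := Nat.card_pos
      obtain ⟨r, t, hr, ht, hsum⟩ := ih (Nat.card H) (by omega) H (fun x : H => χ x)
        (fun x y : H => B x y) rfl hH hndH
      have c3 : Nat.card (twoTorsion H) = Nat.card (twoTorsion G ⊓ H : AddSubgroup G) := by
        refine Nat.card_congr ⟨fun x => ⟨x.1, congrArg Subtype.val (mem_twoTorsion.1 x.2), x.1.2⟩,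
          fun x => ⟨⟨x, x.2.2⟩, Subtype.ext (mem_twoTorsion.1 x.2.1)⟩, fun x => rfl, fun x => rfl⟩
      refine ⟨r + 1, 4 * t, by rw [c2, ← c3, hr, pow_succ, mul_comm], by positivity, ?_⟩
      have e1 : (1 + χ x₀) ^ 4 = -4 := by
        have : χ x₀ ^ 2 = -1 := by rw [← h.self_eq_sq, h00]
        linear_combination (χ x₀ ^ 2 + 4 * χ x₀ + 5) * this
      rw [h.sum_eq_mul_sum_orth hBx h00, mul_pow, e1, hsum]
      push_cast; ring
    -- Now `χ ^ 2` descends to the quotient by the 2-torsion. The sums differ by a positive factor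
    -- after raising to the fourth power, and the ranks have the same parity.
    · push Not at hA
      obtain ⟨χ', B', h', hnd', hχ'⟩ := h.exists_descent hA hnd
      have := Fintype.ofFinite (G ⧸ twoTorsion G)
      have c1 := AddSubgroup.card_eq_card_quotient_mul_card_addSubgroup (twoTorsion G)
      have hlt : Nat.card (G ⧸ twoTorsion G) < n := by
        have h1 : 1 < Nat.card (twoTorsion G) := by
          rw [AddSubgroup.one_lt_card_iff_ne_bot]
          exact hS
        have h2 : 0 < Nat.card (G ⧸ twoTorsion G) := Nat.card_pos
        rw [← hn, c1]
        nlinarith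
      obtain ⟨r, t, hr, ht, hsum⟩ := ih _ hlt (G ⧸ twoTorsion G) χ' B' rfl h' hnd'
      obtain ⟨m, hm⟩ := h.exists_card_twoTorsion_eq hA hnd
      have e1 := h.card_mul_sq_sum hA hnd
      rw [sum_descent hχ'] at e1
      set s : ℂ := ((Nat.card (twoTorsion G) : ℕ) : ℂ) with hs
      have hs0 : s ≠ 0 := Nat.cast_ne_zero.2 (Nat.card_pos (α := twoTorsion G)).ne'
      have e2 : (∑ x, χ x) ^ 2 = s * (∑ x, χ' x) ^ 2 := by
        refine mul_left_cancel₀ hs0 ?_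
        rw [e1]; ring
      refine ⟨r + 2 * m, (Nat.card (twoTorsion G)) ^ 2 * t, ?_, by positivity, ?_⟩
      · rw [hm, hr, pow_add, pow_mul]
        norm_num
      · have e3 : (∑ x, χ x) ^ 4 = s ^ 2 * (∑ x, χ' x) ^ 4 := by
          rw [show 4 = 2 * 2 by norm_num, pow_mul, e2]; ring
        rw [e3, hsum, pow_add, pow_mul]
        push_cast
        rw [← hs]; ring
  exact main _ G χ B rfl h hnd



end IsQuadraticCharacter

end CMCritical

open scoped BigOperators
open MeasureTheory

namespace CMCritical

/-! ### Poisson summation in several variables -/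

section Poisson

variable {I : Type*} [Fintype I]

/-- A finite set of indices lies in a box, over which the sum is a product of one-variable sums. -/
lemma summable_pi_prod {α : Type*} {f : α → ℝ} (hf : Summable f) (h0 : ∀ a, 0 ≤ f a) :
    Summable fun m : I → α => ∏ i, f (m i) := by
  classical
  refine summable_of_sum_le (fun m => Finset.prod_nonneg fun i _ => h0 _)
    (c := ∏ _i : I, ∑' a, f a) fun s => ?_
  calc ∑ m ∈ s, ∏ i, f (m i)
      ≤ ∑ m ∈ Fintype.piFinset (fun i => s.image (fun m => m i)), ∏ i, f (m i) := by
        refine Finset.sum_le_sum_of_subset_of_nonneg (fun m hm => ?_)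
          fun m _ _ => Finset.prod_nonneg fun i _ => h0 _
        exact Fintype.mem_piFinset.2 fun i => Finset.mem_image_of_mem _ hm
    _ = ∏ i, ∑ a ∈ s.image (fun m => m i), f a := by
        rw [Finset.prod_univ_sum]
    _ ≤ ∏ _i : I, ∑' a, f a :=
        Finset.prod_le_prod (fun i _ => Finset.sum_nonneg fun a _ => h0 a)
          fun i _ => hf.sum_le_tsum _ fun a _ => h0 a

/-- A function of exponential decay. -/
def HasExpDecay (f : (I → ℝ) → ℂ) : Prop :=
  ∃ C : ℝ, ∀ x, ‖f x‖ ≤ C * ∏ i, Real.exp (-|x i|)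

lemma summable_exp_neg_abs_int : Summable fun m : ℤ => Real.exp (-|(m : ℝ)|) := by
  have h : Summable fun n : ℕ => Real.exp (-(n : ℝ)) := Real.summable_exp_neg_nat
  refine Summable.of_nat_of_neg ?_ ?_
  · simpa using h
  · simpa using h

lemma summable_prod_exp_neg_abs :
    Summable fun m : I → ℤ => ∏ i, Real.exp (-|(m i : ℝ)|) :=
  summable_pi_prod (f := fun m : ℤ => Real.exp (-|(m : ℝ)|)) summable_exp_neg_abs_int
    fun _ => (Real.exp_pos _).le

lemma prod_exp_neg_abs_add_le (x y : I → ℝ) :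
    ∏ i, Real.exp (-|x i + y i|) ≤ (∏ i, Real.exp |x i|) * ∏ i, Real.exp (-|y i|) := by
  rw [← Finset.prod_mul_distrib]
  refine Finset.prod_le_prod (fun i _ => (Real.exp_pos _).le) fun i _ => ?_
  rw [← Real.exp_add, Real.exp_le_exp]
  have := abs_sub (x i + y i) (x i)
  rw [add_sub_cancel_left] at this
  linarith

lemma HasExpDecay.exists_nonneg {f : (I → ℝ) → ℂ} (hf : HasExpDecay f) :
    ∃ C : ℝ, 0 ≤ C ∧ ∀ x, ‖f x‖ ≤ C * ∏ i, Real.exp (-|x i|) := by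
  obtain ⟨C, hC⟩ := hf
  refine ⟨|C|, abs_nonneg C, fun x => (hC x).trans ?_⟩
  exact mul_le_mul_of_nonneg_right (le_abs_self C)
    (Finset.prod_nonneg fun i _ => (Real.exp_pos _).le)

lemma HasExpDecay.norm_add_le {f : (I → ℝ) → ℂ} (hf : HasExpDecay f) :
    ∃ C : ℝ, 0 ≤ C ∧ ∀ x y, ‖f (x + y)‖ ≤
      C * (∏ i, Real.exp |x i|) * ∏ i, Real.exp (-|y i|) := by
  obtain ⟨C, hC0, hC⟩ := hf.exists_nonneg
  refine ⟨C, hC0, fun x y => (hC _).trans ?_⟩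
  rw [mul_assoc]
  exact mul_le_mul_of_nonneg_left (prod_exp_neg_abs_add_le x y) hC0

lemma HasExpDecay.integrable {f : (I → ℝ) → ℂ} (hf : HasExpDecay f) (hc : Continuous f) :
    Integrable f := by
  obtain ⟨C, -, hC⟩ := hf.exists_nonneg
  have h1 : Integrable fun x : ℝ => Real.exp (-|x|) := by
    rw [← integrableOn_univ, ← Set.Iic_union_Ioi (a := (0 : ℝ))]
    refine IntegrableOn.union ?_ ?_
    · refine (integrableOn_exp_Iic 0).congr_fun (fun x hx => ?_) measurableSet_Iic
      simp only [abs_of_nonpos (Set.mem_Iic.1 hx), neg_neg]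
    · refine (exp_neg_integrableOn_Ioi 0 one_pos).congr_fun (fun x hx => ?_) measurableSet_Ioi
      simp only [abs_of_pos (Set.mem_Ioi.1 hx), neg_mul, one_mul]
  have h2 : Integrable fun x : I → ℝ => ∏ i, Real.exp (-|x i|) :=
    Integrable.fintype_prod (f := fun _ : I => fun x : ℝ => Real.exp (-|x|)) fun _ => h1
  exact Integrable.mono' (h2.const_mul C) hc.aestronglyMeasurable
    (Filter.Eventually.of_forall hC)

/-- The unit box. -/
def unitBox (I : Type*) : Set (I → ℝ) := {x | ∀ i, x i ∈ Set.Ioc (0 : ℝ) (0 + 1)}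

lemma measurableSet_unitBox : MeasurableSet (unitBox I) :=
  MeasurableSet.univ_pi' fun _ => measurableSet_Ioc

/-- The integral translates of the half-open box tile the space. -/
lemma hasSum_integral_unitBox {E : Type*} [NormedAddCommGroup E] [NormedSpace ℝ E]
    {f : (I → ℝ) → E} (hf : Integrable f) :
    HasSum (fun m : I → ℤ => ∫ x in unitBox I, f (x + fun i => (m i : ℝ))) (∫ x, f x) := by
  have hm : ∀ m : I → ℤ, MeasurableSet
      ((fun x : I → ℝ => x - fun i => (m i : ℝ)) ⁻¹' unitBox I) := fun m =>
    (measurable_id.sub_const _) measurableSet_unitBox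
  have hU : (⋃ m : I → ℤ, (fun x : I → ℝ => x - fun i => (m i : ℝ)) ⁻¹' unitBox I) =
      Set.univ := by
    -- The box is open at `0` and closed at `1`, so the integral part here is `⌈x⌉ - 1`.
    refine Set.eq_univ_of_forall fun x => Set.mem_iUnion.2 ⟨fun i => ⌈x i⌉ - 1, fun i => ?_⟩
    have h1 := Int.ceil_lt_add_one (x i)
    have h2 := Int.le_ceil (x i)
    simp only [Pi.sub_apply, Int.cast_sub, Int.cast_one, Set.mem_Ioc]
    constructor <;> linarith
  have hd : Pairwise (Function.onFun Disjoint fun m : I → ℤ =>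
      (fun x : I → ℝ => x - fun i => (m i : ℝ)) ⁻¹' unitBox I) := by
    intro m n hmn
    refine Set.disjoint_left.2 fun x hx hy => hmn (funext fun i => ?_)
    have h1 := hx i
    have h2 := hy i
    simp only [Pi.sub_apply, Set.mem_Ioc] at h1 h2
    have h3 : (m i : ℝ) < n i + 1 := by linarith
    have h4 : (n i : ℝ) < m i + 1 := by linarith
    have h5 : m i < n i + 1 := by exact_mod_cast h3
    have h6 : n i < m i + 1 := by exact_mod_cast h4
    omega
  have := hasSum_integral_iUnion hm hd (f := f) (μ := volume) (by rw [hU]; exact hf.integrableOn)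
  rw [hU, Measure.restrict_univ] at this
  convert this using 2 with m
  have h1 := (measurePreserving_sub_right (volume : Measure (I → ℝ))
    (fun i => (m i : ℝ))).setIntegral_preimage_emb
    (measurableEmbedding_subRight _) (fun x => f (x + fun i => (m i : ℝ))) (unitBox I)
  rw [← h1]
  simp

/-- The Fourier coefficient of a function on `ℝ ^ I` at an integral frequency. -/
noncomputable def intFourier (f : (I → ℝ) → ℂ) (n : I → ℤ) : ℂ :=
  ∫ x, Complex.exp (-(2 * Real.pi * Complex.I * ∑ i, (n i : ℂ) * x i)) * f x

lemma mFourier_coe (n : I → ℤ) (x : I → ℝ) :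
    UnitAddTorus.mFourier n (fun i => (x i : UnitAddCircle)) =
      Complex.exp (2 * Real.pi * Complex.I * ∑ i, (n i : ℂ) * x i) := by
  simp only [UnitAddTorus.mFourier, ContinuousMap.coe_mk, fourier_coe_apply]
  rw [← Complex.exp_sum, Finset.mul_sum]
  congr 1
  refine Finset.sum_congr rfl fun i _ => ?_
  push_cast
  ring

/-- On a ball of radius one the series is dominated by a fixed summable family. -/
lemma continuous_tsum_translate {f : (I → ℝ) → ℂ} (hc : Continuous f) (hf : HasExpDecay f) :
    Continuous fun x : I → ℝ => ∑' m : I → ℤ, f (x + fun i => (m i : ℝ)) := by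
  obtain ⟨C, hC0, hC⟩ := hf.norm_add_le
  rw [continuous_iff_continuousAt]
  intro x₀
  have hb : ∀ x ∈ Metric.ball x₀ 1, ∏ i, Real.exp |x i| ≤ ∏ i, Real.exp (|x₀ i| + 1) := by
    intro x hx
    refine Finset.prod_le_prod (fun i _ => (Real.exp_pos _).le) fun i _ => Real.exp_le_exp.2 ?_
    have h1 := dist_le_pi_dist x x₀ i
    rw [Real.dist_eq] at h1
    have h2 := Metric.mem_ball.1 hx
    have h3 := abs_sub_abs_le_abs_sub (x i) (x₀ i)
    linarith
  have hcont : ContinuousOn (fun x : I → ℝ => ∑' m : I → ℤ, f (x + fun i => (m i : ℝ)))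
      (Metric.ball x₀ 1) := by
    refine continuousOn_tsum (fun m => (hc.comp (continuous_id.add continuous_const)).continuousOn)
      (summable_prod_exp_neg_abs.mul_left (C * ∏ i, Real.exp (|x₀ i| + 1))) ?_
    intro m x hx
    refine (hC x _).trans ?_
    refine mul_le_mul_of_nonneg_right (mul_le_mul_of_nonneg_left (hb x hx) hC0) ?_
    exact Finset.prod_nonneg fun i _ => (Real.exp_pos _).le
  exact hcont.continuousAt (Metric.ball_mem_nhds _ one_pos)

/-- **Poisson summation formula** on `ℤ ^ I`. -/
theorem tsum_eq_tsum_intFourier {f : (I → ℝ) → ℂ} (hc : Continuous f) (hf : HasExpDecay f)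
    (hs : Summable (intFourier f)) :
    ∑' m : I → ℤ, f (fun i => (m i : ℝ)) = ∑' n : I → ℤ, intFourier f n := by
  have hq : Topology.IsQuotientMap (Pi.map fun (_ : I) (x : ℝ) => (x : UnitAddCircle)) :=
    (IsOpenQuotientMap.piMap fun _ => QuotientAddGroup.isOpenQuotientMap_mk).isQuotientMap
  -- The periodization of `f`, which descends to a continuous function `F` on the torus. The formula
  -- is the Fourier series of `F` evaluated at `0`.
  let g : C(I → ℝ, ℂ) := ⟨_, continuous_tsum_translate hc hf⟩
  let π : C(I → ℝ, UnitAddTorus I) := ⟨_, hq.continuous⟩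
  have hπ : ∀ x y : I → ℝ, π x = π y → g x = g y := by
    intro x y hxy
    have h1 : ∀ i, ∃ k : ℤ, x i - y i = k := by
      intro i
      have := congrFun hxy i
      change (x i : UnitAddCircle) = y i at this
      rw [QuotientAddGroup.eq, AddSubgroup.mem_zmultiples_iff] at this
      obtain ⟨k, hk⟩ := this
      refine ⟨-k, ?_⟩
      simp only [zsmul_eq_mul, mul_one] at hk
      push_cast
      linarith
    choose k hk using h1
    change ∑' m : I → ℤ, f (x + fun i => (m i : ℝ)) = ∑' m : I → ℤ, f (y + fun i => (m i : ℝ))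
    rw [← (Equiv.addRight k).tsum_eq fun m : I → ℤ => f (y + fun i => (m i : ℝ))]
    refine tsum_congr fun m => congrArg f (funext fun i => ?_)
    simp only [Pi.add_apply, Equiv.coe_addRight, Int.cast_add]
    linarith [hk i]
  have hπq : Topology.IsQuotientMap π := hq
  let F : C(UnitAddTorus I, ℂ) := hπq.lift g hπ
  have hF : ∀ x : I → ℝ, F (fun i => (x i : UnitAddCircle)) = g x := fun x =>
    DFunLike.congr_fun (hπq.lift_comp g hπ) x
  -- Unfolding: the exponential is periodic, so integrating it against the periodization over one
  -- box is integrating against `f` over the whole space.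
  have hcoef : ∀ n : I → ℤ, UnitAddTorus.mFourierCoeff F n = intFourier f n := by
    intro n
    let e : (I → ℝ) → ℂ := fun x =>
      Complex.exp (-(2 * Real.pi * Complex.I * ∑ i, (n i : ℂ) * x i))
    have hen : ∀ x, ‖e x‖ = 1 := by
      intro x
      have : -(2 * Real.pi * Complex.I * ∑ i, (n i : ℂ) * x i) =
          ((-(2 * Real.pi * ∑ i, (n i : ℝ) * x i) : ℝ) : ℂ) * Complex.I := by
        push_cast; ring
      simp only [e, this, Complex.norm_exp_ofReal_mul_I]
    have hee : ∀ x, UnitAddTorus.mFourier (-n) (fun i => (x i : UnitAddCircle)) = e x := by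
      intro x
      rw [mFourier_coe]
      simp [e]
    have hper : ∀ (x : I → ℝ) (m : I → ℤ), e (x + fun i => (m i : ℝ)) = e x := by
      intro x m
      rw [← hee, ← hee]
      congr 1
      funext i
      simp only [Pi.add_apply]
      have h0 : ((m i : ℝ) : UnitAddCircle) = 0 := (AddCircle.coe_eq_zero_iff 1).2 ⟨m i, by simp⟩
      rw [AddCircle.coe_add, h0, add_zero]
    have hec : Continuous e := by fun_prop
    have hef : Integrable fun x => e x * f x := by
      refine (hf.integrable hc).bdd_mul hec.aestronglyMeasurable (c := 1)
        (Filter.Eventually.of_forall fun x => (hen x).le)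
    rw [UnitAddTorus.mFourierCoeff_eq_integral F n 0]
    have h1 := hasSum_integral_unitBox hef
    have h2 := (hasSum_integral_unitBox hef.norm).summable
    have h3 := hasSum_integral_of_summable_integral_norm (μ := volume.restrict (unitBox I))
      (F := fun (m : I → ℤ) x => e (x + fun i => (m i : ℝ)) * f (x + fun i => (m i : ℝ)))
      (fun m => (hef.comp_add_right (fun i => (m i : ℝ))).restrict) h2
    rw [intFourier, h1.unique h3]
    change ∫ x in unitBox I, _ = _
    refine integral_congr_ae (Filter.Eventually.of_forall fun x => ?_)
    simp only [hF, hee, hper, smul_eq_mul]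
    rw [tsum_mul_left]
    rfl
  have hs' : Summable (UnitAddTorus.mFourierCoeff F) := by
    rw [funext hcoef]; exact hs
  have h4 := (UnitAddTorus.hasSum_mFourier_series_apply_of_summable hs' 0).tsum_eq
  have h5 : F 0 = ∑' m : I → ℤ, f (fun i => (m i : ℝ)) := by
    have := hF 0
    simp only [g, ContinuousMap.coe_mk, zero_add] at this
    rw [← this]
    congr 1
  rw [← h5, ← h4]
  refine tsum_congr fun n => ?_
  have h6 : UnitAddTorus.mFourier n (0 : UnitAddTorus I) = 1 := by
    simp [UnitAddTorus.mFourier]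
  rw [hcoef, h6, smul_eq_mul, mul_one]

end Poisson

end CMCritical

open scoped BigOperators
open MeasureTheory

namespace CMCritical

/-! ### Poisson summation for complex Gaussians on lattices -/

section Gaussian

variable {I ι : Type*} [Fintype I] [Fintype ι]

/-- An injective linear map is antilipschitz, which bounds `∑ |t i|` by a multiple `L` of `∑ |A t
j|`. Completing the square gives `L * |y| ≤ ε * y ^ 2 + L ^ 2 / (4 * ε)`. -/
lemma exists_gaussian_le (A : (I → ℝ) →ₗ[ℝ] (ι → ℝ)) (hA : Function.Injective A)
    (ε : ι → ℝ) (hε : ∀ j, 0 < ε j) (v : ι → ℝ) :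
    ∃ C : ℝ, ∀ t, Real.exp (-∑ j, ε j * (v j + A t j) ^ 2) ≤ C * ∏ i, Real.exp (-|t i|) := by
  obtain ⟨K, -, hK⟩ := A.exists_antilipschitzWith (LinearMap.ker_eq_bot.2 hA)
  set L : ℝ := Fintype.card I * K with hL
  refine ⟨Real.exp (L * ∑ j, |v j| + ∑ j, L ^ 2 / (4 * ε j)), fun t => ?_⟩
  rw [← Real.exp_sum, ← Real.exp_add, Real.exp_le_exp]
  have h1 : ∀ i, |t i| ≤ K * ∑ j, |A t j| := by
    intro i
    have h2 : ‖t‖ ≤ K * ‖A t‖ := by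
      have := hK.le_mul_dist t 0
      simpa using this
    have h3 : ‖A t‖ ≤ ∑ j, |A t j| := by
      rw [pi_norm_le_iff_of_nonneg (Finset.sum_nonneg fun j _ => abs_nonneg _)]
      intro j
      exact Finset.single_le_sum (f := fun j => |A t j|) (fun j _ => abs_nonneg _)
        (Finset.mem_univ j)
    calc |t i| ≤ ‖t‖ := norm_le_pi_norm t i
      _ ≤ K * ‖A t‖ := h2
      _ ≤ _ := mul_le_mul_of_nonneg_left h3 K.2
  have h2 : ∑ i, |t i| ≤ L * ∑ j, |A t j| := by
    calc ∑ i, |t i| ≤ ∑ _i : I, K * ∑ j, |A t j| := Finset.sum_le_sum fun i _ => h1 i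
      _ = L * ∑ j, |A t j| := by
        rw [Finset.sum_const, Finset.card_univ, nsmul_eq_mul, hL, mul_assoc]
  have hL0 : 0 ≤ L := by positivity
  have h3 : L * ∑ j, |A t j| ≤ L * ∑ j, |v j| + L * ∑ j, |v j + A t j| := by
    rw [← mul_add, ← Finset.sum_add_distrib]
    refine mul_le_mul_of_nonneg_left (Finset.sum_le_sum fun j _ => ?_) hL0
    have := abs_sub (v j + A t j) (v j)
    rw [add_sub_cancel_left] at this
    linarith
  have h4 : L * ∑ j, |v j + A t j| ≤
      ∑ j, ε j * (v j + A t j) ^ 2 + ∑ j, L ^ 2 / (4 * ε j) := by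
    rw [Finset.mul_sum, ← Finset.sum_add_distrib]
    refine Finset.sum_le_sum fun j _ => ?_
    have hj := hε j
    have h5 : 0 ≤ ε j * (|v j + A t j| - L / (2 * ε j)) ^ 2 := by positivity
    have h6 : ε j * (|v j + A t j| - L / (2 * ε j)) ^ 2 =
        ε j * (v j + A t j) ^ 2 + L ^ 2 / (4 * ε j) - L * |v j + A t j| := by
      rw [← sq_abs (v j + A t j)]
      field_simp
      ring
    linarith
  rw [Finset.sum_neg_distrib]
  linarith

lemma norm_cexp_neg_sum_add (b : ι → ℂ) (v l : ι → ℝ) :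
    ‖Complex.exp (-∑ j, b j * (v j : ℂ) ^ 2 + 2 * Real.pi * Complex.I * ∑ j, (l j : ℂ) * v j)‖ =
      Real.exp (-∑ j, (b j).re * v j ^ 2) := by
  rw [Complex.norm_exp]
  congr 1
  have h2 : (2 * Real.pi * Complex.I * ∑ j, (l j : ℂ) * v j) =
      ((2 * Real.pi * ∑ j, l j * v j : ℝ) : ℂ) * Complex.I := by push_cast; ring
  rw [h2, Complex.add_re, Complex.re_ofReal_mul, Complex.I_re, mul_zero, add_zero, Complex.neg_re,
    Complex.re_sum]
  congr 1
  refine Finset.sum_congr rfl fun j _ => ?_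
  rw [← Complex.ofReal_pow, Complex.re_mul_ofReal]

/-- The image of Lebesgue measure is a Haar measure, hence a multiple of Lebesgue measure. Only the
positivity of the factor matters later, so no determinant is computed. -/
lemma exists_integral_comp_linearEquiv (A : (I → ℝ) ≃ₗ[ℝ] (ι → ℝ)) :
    ∃ κ : ℝ, 0 < κ ∧ ∀ (F : (ι → ℝ) → ℂ) (v : ι → ℝ), ∫ t, F (v + A t) = κ * ∫ x, F x := by
  let A' := A.toContinuousLinearEquiv
  have hA : (Measure.map A' (volume : Measure (I → ℝ))).IsAddHaarMeasure :=
    A'.isAddHaarMeasure_map _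
  have hc := Measure.isAddLeftInvariant_eq_smul
    (Measure.map A' (volume : Measure (I → ℝ))) (volume : Measure (ι → ℝ))
  set c := Measure.addHaarScalarFactor (Measure.map A' (volume : Measure (I → ℝ)))
    (volume : Measure (ι → ℝ)) with hcdef
  have hc0 : 0 < c := Measure.addHaarScalarFactor_pos_of_isAddHaarMeasure _ _
  refine ⟨c, hc0, fun F v => ?_⟩
  have h1 : ∫ t, F (v + A t) = ∫ x, F (v + x) ∂(Measure.map A' volume) :=
    (A'.toHomeomorph.measurableEmbedding.integral_map (fun x => F (v + x))).symm
  rw [h1, hc, integral_smul_nnreal_measure, integral_add_left_eq_self (fun x => F x) v]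
  rfl

/-- **Poisson summation** for complex Gaussians on the lattice `A (ℤ ^ I)`. The map `W`
parametrizes the dual lattice. -/
theorem exists_tsum_gaussian_eq (A : (I → ℝ) ≃ₗ[ℝ] (ι → ℝ)) (W : (I → ℝ) →ₗ[ℝ] (ι → ℝ))
    (hW : ∀ k t, ∑ j, W k j * A t j = ∑ i, k i * t i) :
    ∃ κ : ℝ, 0 < κ ∧ ∀ (b : ι → ℂ), (∀ j, 0 < (b j).re) → ∀ v l : ι → ℝ,
      ∑' m : I → ℤ, Complex.exp (-∑ j, b j * ((v j + A (fun i => (m i : ℝ)) j : ℝ) : ℂ) ^ 2 +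
        2 * Real.pi * Complex.I * ∑ j, (l j : ℂ) * (v j + A (fun i => (m i : ℝ)) j : ℝ)) =
      κ * (∏ j, (Real.pi / b j) ^ (1 / 2 : ℂ)) *
        ∑' k : I → ℤ, Complex.exp (2 * Real.pi * Complex.I *
          ∑ j, (W (fun i => (k i : ℝ)) j : ℂ) * v j) *
          Complex.exp (-∑ j, (Real.pi ^ 2 / b j) *
            ((l j - W (fun i => (k i : ℝ)) j : ℝ) : ℂ) ^ 2) := by
  obtain ⟨κ, hκ, hint⟩ := exists_integral_comp_linearEquiv A
  refine ⟨κ, hκ, fun b hb v l => ?_⟩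
  -- The duality relation at `t = k` is `∑ k i ^ 2`. Injectivity yields the decay of the dual
  -- Gaussian, hence the summability that Poisson summation requires.
  have hWinj : Function.Injective W := by
    rw [injective_iff_map_eq_zero]
    intro k hk
    have := hW k k
    simp only [hk, Pi.zero_apply, zero_mul, Finset.sum_const_zero] at this
    funext i
    have h2 := (Finset.sum_eq_zero_iff_of_nonneg
      (fun i _ => mul_self_nonneg (k i))).1 this.symm i (Finset.mem_univ i)
    exact mul_self_eq_zero.1 h2
  let G : (ι → ℝ) → ℂ := fun x =>
    Complex.exp (-∑ j, b j * (x j : ℂ) ^ 2 + 2 * Real.pi * Complex.I * ∑ j, (l j : ℂ) * x j)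
  let f : (I → ℝ) → ℂ := fun t => G (v + A t)
  have hGc : Continuous G := by fun_prop
  have hAc : Continuous A := A.toContinuousLinearEquiv.continuous
  have hfc : Continuous f := hGc.comp (continuous_const.add hAc)
  have hfd : HasExpDecay f := by
    obtain ⟨C, hC⟩ := exists_gaussian_le (A : (I → ℝ) →ₗ[ℝ] (ι → ℝ)) A.injective
      (fun j => (b j).re) hb v
    refine ⟨C, fun t => ?_⟩
    change ‖Complex.exp _‖ ≤ _
    rw [norm_cexp_neg_sum_add]
    exact hC t
  have hcoef : ∀ k : I → ℤ, intFourier f k = κ * (∏ j, (Real.pi / b j) ^ (1 / 2 : ℂ)) *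
      (Complex.exp (2 * Real.pi * Complex.I * ∑ j, (W (fun i => (k i : ℝ)) j : ℂ) * v j) *
        Complex.exp (-∑ j, (Real.pi ^ 2 / b j) *
          ((l j - W (fun i => (k i : ℝ)) j : ℝ) : ℂ) ^ 2)) := by
    intro k
    set w := W (fun i => (k i : ℝ)) with hw
    have h1 : ∀ t : I → ℝ, Complex.exp (-(2 * Real.pi * Complex.I * ∑ i, (k i : ℂ) * t i)) * f t =
        Complex.exp (2 * Real.pi * Complex.I * ∑ j, (w j : ℂ) * v j) *
          Complex.exp (-∑ j, b j * ((v + A t) j : ℂ) ^ 2 +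
            ∑ j, (2 * Real.pi * Complex.I * (l j - w j)) * ((v + A t) j : ℝ)) := by
      intro t
      have h2 : ∑ i, (k i : ℂ) * t i = ∑ j, (w j : ℂ) * A t j := by
        have := hW (fun i => (k i : ℝ)) t
        rw [← hw] at this
        exact_mod_cast this.symm
      rw [h2]
      simp only [f, G]
      rw [← Complex.exp_add, ← Complex.exp_add]
      congr 1
      simp only [Pi.add_apply, Complex.ofReal_add, Finset.mul_sum, mul_add, mul_sub, sub_mul,
        Finset.sum_add_distrib, Finset.sum_sub_distrib]
      simp only [mul_assoc]
      ring
    rw [intFourier, funext h1, hint (fun x => Complex.exp (2 * Real.pi * Complex.I *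
      ∑ j, (w j : ℂ) * v j) * Complex.exp (-∑ j, b j * (x j : ℂ) ^ 2 +
            ∑ j, (2 * Real.pi * Complex.I * (l j - w j)) * (x j : ℝ))) v,
      integral_const_mul, GaussianFourier.integral_cexp_neg_sum_mul_add hb,
      Finset.prod_mul_distrib, ← Complex.exp_sum]
    have h3 : ∑ j, (2 * Real.pi * Complex.I * (l j - w j)) ^ 2 / (4 * b j) =
        -∑ j, (Real.pi ^ 2 / b j) * ((l j - w j : ℝ) : ℂ) ^ 2 := by
      rw [← Finset.sum_neg_distrib]
      refine Finset.sum_congr rfl fun j _ => ?_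
      have hbj : b j ≠ 0 := fun h => by simpa [h] using hb j
      push_cast
      field_simp
      rw [Complex.I_sq]
      ring
    rw [h3]
    ring
  have hsum : Summable (intFourier f) := by
    rw [funext hcoef]
    refine Summable.mul_left _ ?_
    obtain ⟨C, hC⟩ := exists_gaussian_le W hWinj (fun j => Real.pi ^ 2 * ((b j)⁻¹).re)
      (fun j => by
        have hbj : b j ≠ 0 := fun h => by simpa [h] using hb j
        rw [Complex.inv_re]
        have := hb j
        have := Complex.normSq_pos.2 hbj
        positivity) (fun j => - l j)
    refine Summable.of_norm_bounded (summable_prod_exp_neg_abs.mul_left C) fun k => ?_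
    refine le_trans (le_of_eq ?_) (hC fun i => (k i : ℝ))
    have h5 : (2 * Real.pi * Complex.I * ∑ j, (W (fun i => (k i : ℝ)) j : ℂ) * v j) =
      ((2 * Real.pi * ∑ j, W (fun i => (k i : ℝ)) j * v j : ℝ) : ℂ) * Complex.I := by
        push_cast; ring
    rw [norm_mul, h5, Complex.norm_exp_ofReal_mul_I, one_mul, Complex.norm_exp]
    congr 1
    rw [Complex.neg_re, Complex.re_sum]
    congr 1
    refine Finset.sum_congr rfl fun j _ => ?_
    rw [← Complex.ofReal_pow (l j - _) 2, Complex.re_mul_ofReal, div_eq_mul_inv,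
      ← Complex.ofReal_pow, Complex.re_ofReal_mul]
    ring
  have := tsum_eq_tsum_intFourier hfc hfd hsum
  rw [← tsum_mul_left, ← funext hcoef, ← this]
  rfl

end Gaussian

end CMCritical

open scoped BigOperators ComplexConjugate
open MeasureTheory

namespace CMCritical

/-! ### Lattices in a ring with complex embeddings -/

section Coordinates

variable {K : Type*} [CommRing K] {S I : Type*} [Fintype S] [Fintype I]

/-- The alternating form `∑ ρ, a_ρ Im (ρ x * conj (ρ y))`. -/
noncomputable def imForm (emb : S → K →+* ℂ) (wt : S → ℝ) (x y : K) : ℝ :=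
  ∑ ρ, wt ρ * (emb ρ x * conj (emb ρ y)).im

/-- The real coordinates of an element. -/
def realCoord (emb : S → K →+* ℂ) (x : K) : S × Bool → ℝ
  | (ρ, false) => (emb ρ x).re
  | (ρ, true) => (emb ρ x).im

/-- The coordinates of the linear form `imForm emb wt x`. -/
def dualCoord (emb : S → K →+* ℂ) (wt : S → ℝ) (x : K) : S × Bool → ℝ
  | (ρ, false) => wt ρ * (emb ρ x).im
  | (ρ, true) => -(wt ρ * (emb ρ x).re)

variable (emb : S → K →+* ℂ) (wt : S → ℝ)

lemma sum_prod_bool {M : Type*} [AddCommMonoid M] (f : S × Bool → M) :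
    ∑ j, f j = ∑ ρ, (f (ρ, false) + f (ρ, true)) := by
  rw [Fintype.sum_prod_type]
  refine Finset.sum_congr rfl fun ρ _ => ?_
  rw [Fintype.sum_bool, add_comm]

lemma sum_dualCoord_mul (x y : K) :
    ∑ j, dualCoord emb wt x j * realCoord emb y j = imForm emb wt x y := by
  rw [sum_prod_bool, imForm]
  refine Finset.sum_congr rfl fun ρ _ => ?_
  simp only [dualCoord, realCoord, Complex.mul_im, Complex.conj_re, Complex.conj_im]
  ring

lemma sum_realCoord_sq (b : S → ℂ) (x : K) :
    ∑ j, b j.1 * ((realCoord emb x j : ℝ) : ℂ) ^ 2 = ∑ ρ, b ρ * ((‖emb ρ x‖ ^ 2 : ℝ) : ℂ) := by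
  rw [sum_prod_bool]
  refine Finset.sum_congr rfl fun ρ _ => ?_
  simp only [realCoord]
  rw [← Complex.normSq_eq_norm_sq, Complex.normSq_apply]
  push_cast
  ring

lemma realCoord_add (x y : K) : realCoord emb (x + y) = realCoord emb x + realCoord emb y := by
  ext ⟨ρ, _ | _⟩ <;> simp [realCoord]

lemma dualCoord_add (x y : K) :
    dualCoord emb wt (x + y) = dualCoord emb wt x + dualCoord emb wt y := by
  ext ⟨ρ, _ | _⟩ <;> simp [dualCoord] <;> ring

/-- `realCoord` as an additive map. -/
def realCoordHom : K →+ (S × Bool → ℝ) :=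
  AddMonoidHom.mk' (realCoord emb) (realCoord_add emb)

/-- `dualCoord` as an additive map. -/
def dualCoordHom : K →+ (S × Bool → ℝ) :=
  AddMonoidHom.mk' (dualCoord emb wt) (dualCoord_add emb wt)

/-- The integral combination of a family. -/
def intComb (e : I → K) (m : I → ℤ) : K := ∑ i, m i • e i

lemma linearCombination_realCoord (e : I → K) (m : I → ℤ) :
    Fintype.linearCombination ℝ (fun i => realCoord emb (e i)) (fun i => (m i : ℝ)) =
      realCoord emb (intComb e m) := by
  rw [Fintype.linearCombination_apply]
  change _ = realCoordHom emb (intComb e m)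
  rw [intComb, map_sum]
  refine Finset.sum_congr rfl fun i _ => ?_
  rw [map_zsmul, Int.cast_smul_eq_zsmul]
  rfl

lemma linearCombination_dualCoord (e : I → K) (m : I → ℤ) :
    Fintype.linearCombination ℝ (fun i => dualCoord emb wt (e i)) (fun i => (m i : ℝ)) =
      dualCoord emb wt (intComb e m) := by
  rw [Fintype.linearCombination_apply]
  change _ = dualCoordHom emb wt (intComb e m)
  rw [intComb, map_sum]
  refine Finset.sum_congr rfl fun i _ => ?_
  rw [map_zsmul, Int.cast_smul_eq_zsmul]
  rfl

variable {emb wt}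

lemma sum_linearCombination_mul [DecidableEq I] {e f : I → K}
    (hef : ∀ i j, imForm emb wt (f j) (e i) = if i = j then 1 else 0) (k t : I → ℝ) :
    ∑ j, Fintype.linearCombination ℝ (fun i => dualCoord emb wt (f i)) k j *
      Fintype.linearCombination ℝ (fun i => realCoord emb (e i)) t j = ∑ i, k i * t i := by
  simp only [Fintype.linearCombination_apply, Finset.sum_apply, Pi.smul_apply, smul_eq_mul,
    Finset.sum_mul_sum]
  rw [Finset.sum_comm]
  refine Finset.sum_congr rfl fun i _ => ?_
  rw [Finset.sum_comm]
  have h1 : ∀ i', ∑ j, k i * dualCoord emb wt (f i) j * (t i' * realCoord emb (e i') j) =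
      if i' = i then k i * t i' else 0 := by
    intro i'
    have := hef i' i
    rw [← sum_dualCoord_mul] at this
    calc _ = k i * t i' * ∑ j, dualCoord emb wt (f i) j * realCoord emb (e i') j := by
          rw [Finset.mul_sum]
          refine Finset.sum_congr rfl fun j _ => by ring
      _ = _ := by rw [this]; split_ifs <;> simp
  simp only [h1, Finset.sum_ite_eq', Finset.mem_univ, if_true]

/-- Pairing a vanishing combination with the same combination of the dual family gives `∑ t i ^ 2 =
0`. -/
lemma linearCombination_realCoord_injective [DecidableEq I] {e f : I → K}
    (hef : ∀ i j, imForm emb wt (f j) (e i) = if i = j then 1 else 0) :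
    Function.Injective (Fintype.linearCombination ℝ (fun i => realCoord emb (e i))) := by
  rw [injective_iff_map_eq_zero]
  intro t ht
  have := sum_linearCombination_mul hef t t
  simp only [ht, Pi.zero_apply, mul_zero, Finset.sum_const_zero] at this
  funext i
  have h2 := (Finset.sum_eq_zero_iff_of_nonneg
    (fun i _ => mul_self_nonneg (t i))).1 this.symm i (Finset.mem_univ i)
  exact mul_self_eq_zero.1 h2

/-- By independence of characters, the real coordinates of a family spanning the ring up to
torsion span the coordinate space. -/
lemma linearCombination_realCoord_surjective {e : I → K}
    (hinj : Function.Injective emb) (hconj : ∀ ρ ρ', emb ρ ≠ (starRingEnd ℂ).comp (emb ρ'))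
    (hspan : ∀ x : K, ∃ (n : ℕ) (m : I → ℤ), n ≠ 0 ∧ ∀ ρ, emb ρ (n • x) = emb ρ (intComb e m)) :
    Function.Surjective (Fintype.linearCombination ℝ (fun i => realCoord emb (e i))) := by
  classical
  rw [← LinearMap.range_eq_top]
  by_contra hne
  obtain ⟨F, hF0, hF⟩ := Submodule.exists_le_ker_of_lt_top _ (lt_top_iff_ne_top.2 hne)
  let y : S × Bool → ℝ := fun j => F (Pi.single j 1)
  have hFy : ∀ x : S × Bool → ℝ, F x = ∑ j, x j * y j := by
    intro x
    conv_lhs => rw [← Finset.univ_sum_single x]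
    rw [map_sum]
    refine Finset.sum_congr rfl fun j _ => ?_
    have : (Pi.single j (x j) : S × Bool → ℝ) = x j • Pi.single j (1 : ℝ) := by
      rw [← Pi.single_smul, smul_eq_mul, mul_one]
    rw [this, map_smul, smul_eq_mul]
  have hK : ∀ x : K, F (realCoord emb x) = 0 := by
    intro x
    obtain ⟨n, m, hn, hm⟩ := hspan x
    have h1 : realCoord emb (n • x) = realCoord emb (intComb e m) := by
      ext ⟨ρ, _ | _⟩ <;> simp only [realCoord, hm]
    have h2 : F (realCoord emb (n • x)) = 0 := by
      rw [h1, ← linearCombination_realCoord]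
      exact hF (LinearMap.mem_range_self _ _)
    have h3 : realCoord emb (n • x) = (n : ℝ) • realCoord emb x := by
      change realCoordHom emb (n • x) = (n : ℝ) • realCoordHom emb x
      rw [map_nsmul, Nat.cast_smul_eq_nsmul]
    rw [h3, map_smul, smul_eq_mul] at h2
    exact (mul_eq_zero.1 h2).resolve_left (Nat.cast_ne_zero.2 hn)
  -- The embeddings and their conjugates are pairwise distinct characters, so they are linearly
  -- independent over `ℂ`.
  let hom : S ⊕ S → (K →* ℂ) := Sum.elim (fun ρ => (emb ρ : K →* ℂ))
    (fun ρ => ((starRingEnd ℂ).comp (emb ρ) : K →+* ℂ))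
  have hhom : Function.Injective hom := by
    have hcoe : ∀ f g : K →+* ℂ, (f : K →* ℂ) = g → f = g := fun f g h =>
      RingHom.ext fun x => DFunLike.congr_fun h x
    rintro (ρ | ρ) (ρ' | ρ') h
    · exact congrArg _ (hinj (hcoe _ _ h))
    · exact absurd (hcoe _ _ h) (hconj ρ ρ')
    · exact absurd (hcoe _ _ h).symm (hconj ρ' ρ)
    · refine congrArg _ (hinj (RingHom.ext fun x => ?_))
      exact (starRingEnd ℂ).injective (DFunLike.congr_fun h x)
  have hind := (linearIndependent_monoidHom K ℂ).comp hom hhom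
  rw [Fintype.linearIndependent_iff] at hind
  -- A real functional with coefficients `y` is the real part of `∑ conj (z ρ) * ρ x`; its double is
  -- a linear relation between the embeddings and their conjugates.
  let z : S → ℂ := fun ρ => ⟨y (ρ, false), y (ρ, true)⟩
  have h0 := hind (Sum.elim (fun ρ => conj (z ρ)) z) (by
    funext x
    have h1 := hK x
    rw [hFy, sum_prod_bool] at h1
    simp only [Fintype.sum_sum_type, Sum.elim_inl, Sum.elim_inr, Function.comp_apply, hom]
    simp only [Pi.add_apply, Finset.sum_apply, Pi.smul_apply, smul_eq_mul, Pi.zero_apply]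
    rw [← Finset.sum_add_distrib]
    have h2 : ((2 * ∑ ρ, (realCoord emb x (ρ, false) * y (ρ, false) +
      realCoord emb x (ρ, true) * y (ρ, true)) : ℝ) : ℂ) = 0 := by rw [h1]; simp
    rw [← h2, Complex.ofReal_mul, Complex.ofReal_sum, Finset.mul_sum]
    refine Finset.sum_congr rfl fun ρ _ => ?_
    apply Complex.ext <;> simp [realCoord, z] <;> ring)
  refine hF0 (LinearMap.ext fun x => ?_)
  rw [hFy]
  refine Finset.sum_eq_zero fun j _ => ?_
  obtain ⟨ρ, s⟩ := j
  have hz : z ρ = 0 := h0 (Sum.inr ρ)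
  have hy : y (ρ, s) = 0 := by
    cases s
    · exact congrArg Complex.re hz
    · exact congrArg Complex.im hz
  rw [hy, mul_zero]

lemma one_sub_re_pos {u : ℂ} (h1 : ‖u‖ = 1) (h2 : u ≠ 1) : 0 < (1 - u).re := by
  rw [Complex.sub_re, Complex.one_re, sub_pos]
  refine lt_of_le_of_ne ((Complex.re_le_norm u).trans h1.le) fun h => h2 ?_
  have h3 : ‖u‖ ^ 2 = u.re * u.re + u.im * u.im := by
    rw [← Complex.normSq_eq_norm_sq, Complex.normSq_apply]
  rw [h1, h] at h3
  have h4 : u.im = 0 := by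
    have : u.im * u.im = 0 := by linarith
    exact mul_self_eq_zero.1 this
  exact Complex.ext h (by simpa using h4)

/-- Poisson summation for the complex Gaussian attached to a unitary element. -/
theorem exists_tsum_unitary_gaussian [DecidableEq I] (hwt : ∀ ρ, 0 < wt ρ) {e f : I → K}
    (hef : ∀ i j, imForm emb wt (f j) (e i) = if i = j then 1 else 0)
    (hinj : Function.Injective emb) (hconj : ∀ ρ ρ', emb ρ ≠ (starRingEnd ℂ).comp (emb ρ'))
    (hspan : ∀ x : K, ∃ (n : ℕ) (m : I → ℤ), n ≠ 0 ∧ ∀ ρ, emb ρ (n • x) = emb ρ (intComb e m))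
    {u : S → ℂ} (hu : ∀ ρ, ‖u ρ‖ = 1) (hu1 : ∀ ρ, u ρ ≠ 1) :
    ∃ κ : ℝ, 0 < κ ∧ ∀ z c : K,
      ∑' m : I → ℤ, Complex.exp
        (-∑ ρ, 2 * Real.pi * wt ρ * (1 - u ρ) * ((‖emb ρ (z + intComb e m)‖ ^ 2 : ℝ) : ℂ) +
          2 * Real.pi * Complex.I * (-imForm emb wt c (z + intComb e m) : ℝ)) =
      κ * (∏ ρ, (1 - u ρ)⁻¹) *
        ∑' k : I → ℤ, Complex.exp (2 * Real.pi * Complex.I * (imForm emb wt (intComb f k) z : ℝ)) *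
          Complex.exp (-∑ ρ, (Real.pi * wt ρ / 2) * (1 - u ρ)⁻¹ *
            ((‖emb ρ (c + intComb f k)‖ ^ 2 : ℝ) : ℂ)) := by
  let A := LinearEquiv.ofBijective (Fintype.linearCombination ℝ (fun i => realCoord emb (e i)))
    ⟨linearCombination_realCoord_injective hef,
      linearCombination_realCoord_surjective hinj hconj hspan⟩
  let W := Fintype.linearCombination ℝ (fun i => dualCoord emb wt (f i))
  obtain ⟨κ, hκ, h⟩ := exists_tsum_gaussian_eq A W (sum_linearCombination_mul hef)
  have hpos : ∀ ρ, 0 < (1 - u ρ).re := fun ρ => one_sub_re_pos (hu ρ) (hu1 ρ)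
  have hne : ∀ ρ, 1 - u ρ ≠ 0 := fun ρ h0 => by simpa [h0] using hpos ρ
  let b : S → ℂ := fun ρ => 2 * Real.pi * wt ρ * (1 - u ρ)
  have hb : ∀ ρ, 0 < (b ρ).re := by
    intro ρ
    have : b ρ = ((2 * Real.pi * wt ρ : ℝ) : ℂ) * (1 - u ρ) := by simp [b]
    rw [this, Complex.re_ofReal_mul]
    have := hwt ρ
    have := hpos ρ
    positivity
  -- `π / b ρ` is `(2 * wt ρ)⁻¹ * (1 - u ρ)⁻¹`; its positive part goes into the constant.
  refine ⟨κ * ∏ ρ, (2 * wt ρ)⁻¹, by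
    have : 0 < ∏ ρ, (2 * wt ρ)⁻¹ := Finset.prod_pos fun ρ _ => by
      have := hwt ρ
      positivity
    positivity, fun z c => ?_⟩
  have hA : ∀ m : I → ℤ, ∀ j, realCoord emb z j + A (fun i => (m i : ℝ)) j =
      realCoord emb (z + intComb e m) j := by
    intro m j
    rw [realCoord_add, Pi.add_apply, ← linearCombination_realCoord]
    rfl
  have hW : ∀ k : I → ℤ, W (fun i => (k i : ℝ)) = dualCoord emb wt (intComb f k) := fun k =>
    linearCombination_dualCoord emb wt f k
  have h' := h (fun j => b j.1) (fun j => hb j.1) (realCoord emb z) (-dualCoord emb wt c)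
  simp only [hA, hW] at h'
  convert h' using 2
  · funext m
    congr 2
    · rw [sum_realCoord_sq]
    · congr 1
      rw [← sum_dualCoord_mul]
      push_cast
      rw [← Finset.sum_neg_distrib]
      refine Finset.sum_congr rfl fun j _ => ?_
      simp
  · rw [Fintype.prod_prod_type]
    push_cast
    rw [mul_assoc, ← Finset.prod_mul_distrib]
    congr 1
    refine Finset.prod_congr rfl fun ρ _ => ?_
    have h2 : (Real.pi : ℂ) / b ρ = (2 * wt ρ : ℂ)⁻¹ * (1 - u ρ)⁻¹ := by
      have := hne ρ
      have h3 : (wt ρ : ℂ) ≠ 0 := Complex.ofReal_ne_zero.2 (hwt ρ).ne'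
      have h4 : (Real.pi : ℂ) ≠ 0 := Complex.ofReal_ne_zero.2 Real.pi_ne_zero
      simp only [b]
      field_simp
    -- Each embedding has two real coordinates with the same square root factor, so the product
    -- involves no choice of branch.
    rw [Fintype.prod_bool, ← h2, ← Complex.cpow_add _ _ (by
      have : b ρ ≠ 0 := fun h0 => by simpa [h0] using hb ρ
      exact div_ne_zero (Complex.ofReal_ne_zero.2 Real.pi_ne_zero) this)]
    norm_num
  · refine tsum_congr fun k => ?_
    congr 2
    · congr 1
      rw [← sum_dualCoord_mul]
      push_cast
      rfl
    · congr 1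
      rw [sum_prod_bool]
      refine Finset.sum_congr rfl fun ρ _ => ?_
      have := hne ρ
      have h3 : (wt ρ : ℂ) ≠ 0 := Complex.ofReal_ne_zero.2 (hwt ρ).ne'
      have h4 : (Real.pi : ℂ) ≠ 0 := Complex.ofReal_ne_zero.2 Real.pi_ne_zero
      simp only [dualCoord, Pi.neg_apply, b]
      rw [← Complex.normSq_eq_norm_sq, Complex.normSq_apply]
      simp only [map_add, Complex.add_re, Complex.add_im]
      push_cast
      field_simp
      ring

end Coordinates

end CMCritical

open scoped BigOperators ComplexConjugate

namespace CMCritical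

/-! ### Phases -/

/-- The phase `exp (2πiq)`. -/
noncomputable def phase (q : ℚ) : ℂ := Complex.exp (2 * Real.pi * Complex.I * ((q : ℝ) : ℂ))

lemma phase_add (p q : ℚ) : phase (p + q) = phase p * phase q := by
  rw [phase, phase, phase, ← Complex.exp_add]
  congr 1
  push_cast
  ring

lemma phase_neg (q : ℚ) : phase (-q) = (phase q)⁻¹ := by
  rw [phase, phase, ← Complex.exp_neg]
  congr 1
  push_cast
  ring

lemma phase_eq_one_iff {q : ℚ} : phase q = 1 ↔ ∃ n : ℤ, q = n := by
  rw [phase, Complex.exp_eq_one_iff]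
  refine exists_congr fun n => ?_
  have h : (2 * Real.pi * Complex.I : ℂ) ≠ 0 := Complex.two_pi_I_ne_zero
  rw [mul_comm, mul_left_inj' h]
  constructor
  · intro h2
    exact_mod_cast h2
  · rintro rfl
    push_cast
    rfl

lemma phase_int (n : ℤ) : phase n = 1 := phase_eq_one_iff.2 ⟨n, rfl⟩

lemma phase_zero : phase 0 = 1 := by simpa using phase_int 0

lemma norm_phase (q : ℚ) : ‖phase q‖ = 1 := by
  have : phase q = Complex.exp (((2 * Real.pi * q : ℝ) : ℂ) * Complex.I) := by
    rw [phase]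
    congr 1
    push_cast
    ring
  rw [this, Complex.norm_exp_ofReal_mul_I]

lemma conj_phase (q : ℚ) : conj (phase q) = phase (-q) := by
  rw [phase_neg, Complex.inv_eq_conj (norm_phase q)]

lemma phase_eq_of_sub {p q : ℚ} (n : ℤ) (h : p - q = n) : phase p = phase q := by
  have : p = q + n := by linarith
  rw [this, phase_add, phase_int, mul_one]

lemma eq_zero_of_nsmul {V : Type*} [AddCommGroup V] [Module ℚ V] {n : ℕ} (hn : n ≠ 0) {x : V}
    (h : n • x = 0) : x = 0 := by
  rw [← Nat.cast_smul_eq_nsmul ℚ] at h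
  exact (smul_eq_zero.1 h).resolve_left (Nat.cast_ne_zero.2 hn)

/-! ### Polarized lattices -/

/-- An autodual full lattice `L` for a symplectic form on a `ℚ`-algebra which is positive with
respect to a family of complex embeddings. -/
structure PolarizedLattice (K Φ : Type*) [CommRing K] [Algebra ℚ K] [Fintype Φ] where
  /-- the complex embeddings -/
  emb : Φ → K →+* ℂ
  emb_injective : Function.Injective emb
  emb_ne_conj : ∀ ρ ρ', emb ρ ≠ (starRingEnd ℂ).comp (emb ρ')
  /-- the weights -/
  wt : Φ → ℝ
  wt_pos : ∀ ρ, 0 < wt ρ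
  /-- the symplectic form -/
  form : K →ₗ[ℚ] K →ₗ[ℚ] ℚ
  form_eq : ∀ x y, (form x y : ℝ) = imForm emb wt x y
  form_nondeg : ∀ x, (∀ y, form x y = 0) → x = 0
  /-- the lattice -/
  L : AddSubgroup K
  mem_iff : ∀ x, x ∈ L ↔ ∀ y ∈ L, ∃ n : ℤ, form x y = n
  fg : L.FG
  exists_nsmul_mem : ∀ x, ∃ n : ℕ, n ≠ 0 ∧ n • x ∈ L

namespace PolarizedLattice

variable {K Φ : Type*} [CommRing K] [Algebra ℚ K] [Fintype Φ] (D : PolarizedLattice K Φ)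

lemma form_comm (x y : K) : D.form x y = -D.form y x := by
  have : (D.form x y : ℝ) = ((-D.form y x : ℚ) : ℝ) := by
    push_cast
    rw [D.form_eq, D.form_eq, imForm, imForm, ← Finset.sum_neg_distrib]
    refine Finset.sum_congr rfl fun ρ _ => ?_
    simp only [Complex.mul_im, Complex.conj_re, Complex.conj_im]
    ring
  exact_mod_cast this

lemma form_self (x : K) : D.form x x = 0 := by
  have := D.form_comm x x
  linarith

lemma form_adj {a b : K} (h : ∀ ρ, D.emb ρ b = conj (D.emb ρ a)) (x y : K) :
    D.form (a * x) y = D.form x (b * y) := by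
  have : (D.form (a * x) y : ℝ) = (D.form x (b * y) : ℝ) := by
    rw [D.form_eq, D.form_eq, imForm, imForm]
    refine Finset.sum_congr rfl fun ρ _ => ?_
    rw [_root_.map_mul, _root_.map_mul, h, _root_.map_mul, Complex.conj_conj]
    congr 2
    ring
  exact_mod_cast this

lemma form_int {x y : K} (hx : x ∈ D.L) (hy : y ∈ D.L) : ∃ n : ℤ, D.form x y = n :=
  (D.mem_iff x).1 hx y hy

/-- Elements paired to zero with the lattice vanish. -/
lemma eq_zero_of_form_lattice {x : K} (h : ∀ y ∈ D.L, D.form x y = 0) : x = 0 := by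
  refine D.form_nondeg x fun y => ?_
  obtain ⟨n, hn, hy⟩ := D.exists_nsmul_mem y
  have h1 := h _ hy
  rw [_root_.map_nsmul, nsmul_eq_mul] at h1
  exact (mul_eq_zero.1 h1).resolve_left (Nat.cast_ne_zero.2 hn)

/-- Multiplication by a fixed element maps the lattice into a multiple of itself. -/
lemma exists_nsmul_mul_mem (a : K) : ∃ n : ℕ, n ≠ 0 ∧ ∀ x ∈ D.L, n • (a * x) ∈ D.L := by
  obtain ⟨s, hs⟩ := D.fg
  choose N hN hNm using D.exists_nsmul_mem
  refine ⟨∏ x ∈ s, N (a * x), Finset.prod_ne_zero_iff.2 fun x _ => hN _, fun x hx => ?_⟩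
  rw [← hs] at hx
  induction hx using AddSubgroup.closure_induction with
  | mem x hx =>
    obtain ⟨k, hk⟩ := Finset.dvd_prod_of_mem (fun x => N (a * x)) hx
    rw [hk, mul_comm, mul_smul]
    exact D.L.nsmul_mem (hNm _) k
  | zero => simp
  | add x y _ _ hx hy =>
    rw [mul_add, smul_add]
    exact D.L.add_mem hx hy
  | neg x _ hx =>
    rw [mul_neg, smul_neg]
    exact D.L.neg_mem hx

/-! #### The Gaussian -/

/-- The positive definite quadratic form of the polarization. -/
noncomputable def norm2 (x : K) : ℝ := ∑ ρ, D.wt ρ * ‖D.emb ρ x‖ ^ 2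

/-- The Gaussian `exp (-π |x|²)`. -/
noncomputable def gauss (x : K) : ℝ := Real.exp (-(Real.pi * D.norm2 x))

lemma gauss_pos (x : K) : 0 < D.gauss x := Real.exp_pos _

lemma norm2_mul {u : K} (hu : ∀ ρ, ‖D.emb ρ u‖ = 1) (x : K) : D.norm2 (u * x) = D.norm2 x := by
  simp only [norm2, _root_.map_mul, norm_mul, hu, one_mul]

lemma gauss_mul {u : K} (hu : ∀ ρ, ‖D.emb ρ u‖ = 1) (x : K) : D.gauss (u * x) = D.gauss x := by
  rw [gauss, gauss, D.norm2_mul hu]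

lemma norm2_parallelogram (x y : K) :
    D.norm2 (x + y) + D.norm2 (x - y) = 2 * D.norm2 x + 2 * D.norm2 y := by
  simp only [norm2, Finset.mul_sum, ← Finset.sum_add_distrib]
  refine Finset.sum_congr rfl fun ρ _ => ?_
  rw [_root_.map_add, _root_.map_sub]
  have := parallelogram_law_with_norm ℝ (D.emb ρ x) (D.emb ρ y)
  have h2 : ∀ r : ℝ, r ^ 2 = r * r := fun r => sq r
  simp only [h2]
  linear_combination D.wt ρ * this

end PolarizedLattice

end CMCritical

open scoped BigOperators ComplexConjugate

namespace CMCritical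

/-! ### Dual bases and summability -/

section IntComb

variable {K I : Type*} [CommRing K] [Fintype I]

lemma intComb_sub (e : I → K) (m m' : I → ℤ) :
    intComb e (m - m') = intComb e m - intComb e m' := by
  simp only [intComb, Pi.sub_apply, sub_smul, Finset.sum_sub_distrib]

lemma intComb_smul [Algebra ℚ K] (r : ℚ) (e : I → K) (m : I → ℤ) :
    intComb (fun i => r • e i) m = r • intComb e m := by
  simp only [intComb, Finset.smul_sum]
  exact Finset.sum_congr rfl fun i _ => smul_comm _ _ _

lemma intComb_mul (a : K) (e : I → K) (m : I → ℤ) :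
    intComb (fun i => a * e i) m = a * intComb e m := by
  simp only [intComb, Finset.mul_sum]
  exact Finset.sum_congr rfl fun i _ => (mul_smul_comm _ _ _).symm

lemma intComb_mem {P : AddSubgroup K} {e : I → K} (he : ∀ i, e i ∈ P) (m : I → ℤ) :
    intComb e m ∈ P :=
  P.sum_mem fun i _ => P.zsmul_mem (he i) _

lemma intComb_zsmul (e : I → K) (n : ℤ) (m : I → ℤ) :
    intComb e (n • m) = n • intComb e m := by
  simp only [intComb, Finset.smul_sum, Pi.smul_apply, smul_eq_mul, mul_smul]

end IntComb

lemma exists_int_basis {K : Type*} [CommRing K] [Algebra ℚ K] {P : AddSubgroup K} (hP : P.FG) :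
    ∃ (n : ℕ) (e : Fin n → K), LinearIndependent ℚ e ∧ ∀ x, x ∈ P ↔ ∃ m, x = intComb e m := by
  have h1 : AddGroup.FG P := (AddGroup.fg_iff_addSubgroup_fg P).2 hP
  have h2 : Module.Finite ℤ P := Module.Finite.iff_addGroup_fg.2 h1
  have h3 : IsAddTorsionFree K := IsAddTorsionFree.of_module_rat K
  have h4 : IsAddTorsionFree P := inferInstance
  let b := Module.finBasis ℤ P
  refine ⟨_, fun i => (b i : K), ?_, fun x => ⟨fun hx => ⟨b.repr ⟨x, hx⟩, ?_⟩, ?_⟩⟩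
  · rw [← LinearIndependent.iff_fractionRing ℤ ℚ]
    exact b.linearIndependent.map' (P.subtype.toIntLinearMap)
      (LinearMap.ker_eq_bot.2 P.subtype_injective)
  · have := congrArg P.subtype (b.sum_repr ⟨x, hx⟩)
    rw [map_sum] at this
    simpa [intComb] using this.symm
  · rintro ⟨m, rfl⟩
    exact intComb_mem (fun i => (b i).2) m

namespace PolarizedLattice

variable {K Φ : Type*} [CommRing K] [Algebra ℚ K] [Fintype Φ] (D : PolarizedLattice K Φ)

/-- The image of the lattice under multiplication by an element. -/
def mulImage (a : K) : AddSubgroup K := D.L.map (AddMonoidHom.mulLeft a)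

lemma mem_mulImage {a x : K} : x ∈ D.mulImage a ↔ ∃ y ∈ D.L, a * y = x := Iff.rfl

lemma mulImage_fg (a : K) : (D.mulImage a).FG := by
  classical
  obtain ⟨s, hs⟩ := D.fg
  refine ⟨s.image (AddMonoidHom.mulLeft a), ?_⟩
  rw [mulImage, ← hs, AddMonoidHom.map_closure, Finset.coe_image]

lemma finiteDimensional (D : PolarizedLattice K Φ) : FiniteDimensional ℚ K := by
  obtain ⟨s, hs⟩ := D.fg
  refine ⟨⟨s, ?_⟩⟩
  rw [eq_top_iff]
  intro x _
  obtain ⟨n, hn, hx⟩ := D.exists_nsmul_mem x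
  have h1 : n • x ∈ Submodule.span ℚ (s : Set K) := by
    rw [← hs] at hx
    have : AddSubgroup.closure (s : Set K) ≤ (Submodule.span ℚ (s : Set K)).toAddSubgroup := by
      rw [AddSubgroup.closure_le]
      exact Submodule.subset_span
    exact this hx
  rw [← Nat.cast_smul_eq_nsmul ℚ] at h1
  have h2 := Submodule.smul_mem _ ((n : ℚ)⁻¹) h1
  rwa [inv_smul_smul₀ (Nat.cast_ne_zero.2 hn)] at h2

lemma exists_form_eq (g : K →ₗ[ℚ] ℚ) : ∃ v, ∀ x, D.form v x = g x := by
  have := D.finiteDimensional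
  have hinj : Function.Injective D.form := by
    rw [injective_iff_map_eq_zero]
    exact fun x hx => D.form_nondeg x fun y => by rw [hx, LinearMap.zero_apply]
  have hsurj := (LinearMap.injective_iff_surjective_of_finrank_eq_finrank
    (f := D.form) (Subspace.dual_finrank_eq (K := ℚ) (V := K)).symm).1 hinj
  obtain ⟨v, hv⟩ := hsurj g
  exact ⟨v, fun x => by rw [hv]⟩

/-- An embedding sends an idempotent to `0` or `1`, which is real, so multiplication by it is
self-adjoint. -/
lemma form_idem {e : K} (he : e * e = e) (x y : K) : D.form (e * x) y = D.form x (e * y) := by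
  refine D.form_adj (fun ρ => ?_) x y
  have h : D.emb ρ e * D.emb ρ e = D.emb ρ e := by rw [← _root_.map_mul, he]
  rcases IsIdempotentElem.iff_eq_zero_or_one.1 h with h | h <;> simp [h]

/-- Dual bases for the direct factor of an idempotent: `e` is a basis of the projection of the
lattice, and `f` is a basis of its intersection with the factor. -/
lemma exists_dual_bases {ε : K} (hε : ε * ε = ε) :
    ∃ (n : ℕ) (e f : Fin n → K), (∀ i j, D.form (f j) (e i) = if i = j then 1 else 0) ∧
      (∀ x, x ∈ D.mulImage ε ↔ ∃ m, x = intComb e m) ∧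
      ∀ x, (x ∈ D.L ∧ ε * x = x) ↔ ∃ m, x = intComb f m := by
  obtain ⟨n, e, hind, he⟩ := exists_int_basis (D.mulImage_fg ε)
  obtain ⟨p, hp⟩ := LinearMap.exists_leftInverse_of_injective (Fintype.linearCombination ℚ e)
    (LinearMap.ker_eq_bot.2 (linearIndependent_iff_injective_fintypeLinearCombination.1 hind))
  have hpe : ∀ m : Fin n → ℤ, p (intComb e m) = fun i => (m i : ℚ) := by
    intro m
    have : intComb e m = Fintype.linearCombination ℚ e (fun i => (m i : ℚ)) := by
      rw [Fintype.linearCombination_apply, intComb]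
      exact Finset.sum_congr rfl fun i _ => (Int.cast_smul_eq_zsmul ℚ _ _).symm
    rw [this]
    exact LinearMap.congr_fun hp _
  -- The vector `f j` represents, through the form, the `j`-th coordinate of `ε * x` in the basis
  -- `e`. It takes integral values on `L`, so autoduality puts it in `L`.
  choose f hf using fun j : Fin n => D.exists_form_eq
    (LinearMap.proj j ∘ₗ p ∘ₗ LinearMap.mulLeft ℚ ε)
  have hf' : ∀ j x, D.form (f j) x = p (ε * x) j := fun j x => hf j x
  have hei : ∀ i, e i = intComb e (Pi.single i 1) := by
    intro i
    rw [intComb, Finset.sum_eq_single i] <;> simp +contextual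
  have hεe : ∀ i, ε * e i = e i := by
    intro i
    obtain ⟨y, -, hy⟩ := (he _).2 ⟨_, hei i⟩
    rw [← hy, AddMonoidHom.coe_mulLeft, ← mul_assoc, hε]
  have hef : ∀ i j, D.form (f j) (e i) = if i = j then 1 else 0 := by
    intro i j
    rw [hf', hεe, hei, hpe]
    simp only [Pi.single_apply]
    by_cases h : i = j
    · simp [h]
    · simp [h, Ne.symm h]
  have hεf : ∀ j, ε * f j = f j := by
    intro j
    refine sub_eq_zero.1 (D.form_nondeg _ fun y => ?_)
    rw [_root_.map_sub, LinearMap.sub_apply, D.form_idem hε, hf', hf', ← mul_assoc, hε, sub_self]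
  have hfL : ∀ j, f j ∈ D.L := by
    intro j
    rw [D.mem_iff]
    intro y hy
    obtain ⟨m, hm⟩ := (he (ε * y)).1 ⟨y, hy, rfl⟩
    exact ⟨m j, by rw [hf', hm, hpe]⟩
  refine ⟨n, e, f, hef, he, fun x => ⟨?_, ?_⟩⟩
  · rintro ⟨hx, hεx⟩
    have h1 : ∀ i, ∃ k : ℤ, D.form x (e i) = k := by
      intro i
      obtain ⟨y, hy, hy2⟩ := (he _).2 ⟨_, hei i⟩
      rw [← hy2, AddMonoidHom.coe_mulLeft, ← D.form_idem hε, hεx]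
      exact D.form_int hx hy
    choose k hk using h1
    refine ⟨k, sub_eq_zero.1 (D.eq_zero_of_form_lattice fun y hy => ?_)⟩
    obtain ⟨m, hm⟩ := (he (ε * y)).1 ⟨y, hy, rfl⟩
    have h2 : D.form x y = ∑ i, (k i : ℚ) * m i := by
      rw [← hεx, D.form_idem hε, hm, intComb, map_sum]
      refine Finset.sum_congr rfl fun i _ => ?_
      rw [map_zsmul, hk, zsmul_eq_mul, mul_comm]
    have h3 : D.form (intComb f k) y = ∑ i, (k i : ℚ) * m i := by
      rw [intComb, map_sum, LinearMap.sum_apply]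
      refine Finset.sum_congr rfl fun i _ => ?_
      rw [map_zsmul, LinearMap.smul_apply, hf', hm, hpe, zsmul_eq_mul]
    rw [_root_.map_sub, LinearMap.sub_apply, h2, h3, sub_self]
  · rintro ⟨m, rfl⟩
    refine ⟨intComb_mem hfL m, ?_⟩
    rw [← intComb_mul]
    simp only [hεf]

/-- Since `k • H` lies in `L`, the elements of `H` have integral coordinates in the basis `e / k`,
where the Gaussian bound applies. -/
lemma summable_exp_norm2 {t : ℝ} (ht : 0 < t) {H : AddSubgroup K} {k : ℕ} (hk : k ≠ 0)
    (hH : ∀ h ∈ H, k • h ∈ D.L) (c : K) :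
    Summable fun h : H => Real.exp (-(t * D.norm2 (c + h))) := by
  classical
  obtain ⟨n, e, f, hef, he, -⟩ := D.exists_dual_bases (ε := 1) (one_mul 1)
  have he' : ∀ x ∈ D.L, ∃ m, x = intComb e m := fun x hx => (he x).1 ⟨x, hx, one_mul x⟩
  have hk' : (k : ℚ) ≠ 0 := Nat.cast_ne_zero.2 hk
  choose co hco using fun h : H => he' _ (hH h h.2)
  have hco' : ∀ h : H, (h : K) = intComb (fun i => (k : ℚ)⁻¹ • e i) (co h) := by
    intro h
    rw [intComb_smul, ← hco, ← Nat.cast_smul_eq_nsmul ℚ, inv_smul_smul₀ hk']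
  have hinj : Function.Injective co := fun h h' hh => Subtype.ext (by rw [hco' h, hco' h', hh])
  have hef' : ∀ i j, imForm D.emb D.wt ((k : ℚ) • f j) ((k : ℚ)⁻¹ • e i) =
      if i = j then 1 else 0 := by
    intro i j
    rw [← D.form_eq, map_smul, map_smul, LinearMap.smul_apply, hef, smul_smul,
      inv_mul_cancel₀ hk', one_smul]
    split_ifs <;> simp
  obtain ⟨C, hC⟩ := exists_gaussian_le _ (linearCombination_realCoord_injective hef')
    (fun j => t * D.wt j.1) (fun j => mul_pos ht (D.wt_pos _)) (realCoord D.emb c)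
  have h1 := ((summable_prod_exp_neg_abs (I := Fin n)).mul_left C).comp_injective hinj
  refine Summable.of_nonneg_of_le (fun h => (Real.exp_pos _).le) (fun h => ?_) h1
  refine le_trans (le_of_eq ?_) (hC fun i => (co h i : ℝ))
  rw [norm2, linearCombination_realCoord, ← hco']
  congr 2
  rw [Finset.mul_sum, sum_prod_bool]
  refine Finset.sum_congr rfl fun ρ _ => ?_
  simp only [← Pi.add_apply, ← realCoord_add]
  rw [← Complex.normSq_eq_norm_sq, Complex.normSq_apply, realCoord, realCoord]
  ring

/-- Gaussian sums over subgroups commensurable to the lattice converge. -/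
lemma summable_gauss {H : AddSubgroup K} {k : ℕ} (hk : k ≠ 0) (hH : ∀ h ∈ H, k • h ∈ D.L) (c : K) :
    Summable fun h : H => D.gauss (c + h) :=
  D.summable_exp_norm2 Real.pi_pos hk hH c

end PolarizedLattice

end CMCritical

open scoped BigOperators ComplexConjugate

namespace CMCritical

/-- A quadratic character which is trivial on a subgroup of the radical descends to the
quotient. -/
lemma IsQuadraticCharacter.exists_quotient {V : Type*} [AddCommGroup V] {χ : V → ℂ}
    {B : V → V → ℂ} (h : IsQuadraticCharacter χ B) {R : AddSubgroup V}
    (hχ : ∀ r ∈ R, χ r = 1) (hB : ∀ r ∈ R, ∀ v, B r v = 1) :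
    ∃ (χ' : V ⧸ R → ℂ) (B' : V ⧸ R → V ⧸ R → ℂ), IsQuadraticCharacter χ' B' ∧
      (∀ x : V, χ' x = χ x) ∧ ∀ x y : V, B' x y = B x y := by
  have hsub : ∀ {a b : V}, QuotientAddGroup.leftRel R a b → b - a ∈ R := by
    intro a b hab
    rw [QuotientAddGroup.leftRel_apply] at hab
    rwa [sub_eq_neg_add]
  have hB1 : ∀ a b y, QuotientAddGroup.leftRel R a b → B a y = B b y := by
    intro a b y hab
    have h3 : b = (b - a) + a := by abel
    rw [h3, h.pairing.add_left, hB _ (hsub hab), one_mul]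
  let χ' : V ⧸ R → ℂ := Quotient.lift χ (by
    intro a b hab
    have h3 : b = (b - a) + a := by abel
    rw [h3, h.map_add, hχ _ (hsub hab), hB _ (hsub hab), one_mul, mul_one])
  let B' : V ⧸ R → V ⧸ R → ℂ := Quotient.lift₂ B (by
    intro a b c d hac hbd
    rw [hB1 a c b hac, h.symm, hB1 b d c hbd, h.symm])
  refine ⟨χ', B', ⟨⟨?_, ?_, ?_⟩, ?_, ?_, ?_⟩, fun x => rfl, fun x y => rfl⟩
  · rintro ⟨x⟩ ⟨y⟩ ⟨z⟩
    exact h.pairing.add_left x y z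
  · rintro ⟨x⟩ ⟨y⟩ ⟨z⟩
    exact h.pairing.add_right x y z
  · rintro ⟨x⟩ ⟨y⟩
    exact h.pairing.ne_zero x y
  · rintro ⟨x⟩ ⟨y⟩
    exact h.map_add x y
  · rintro ⟨x⟩
    exact h.map_neg x
  · rintro ⟨x⟩
    exact h.norm_eq_one x

/-! ### Unitary elements of the theta group -/

/-- A unitary element `ν` of the theta group of a polarized lattice, with inverse `ν'`, an odd
denominator `o`, the idempotent `ε` of the factors where `ν ≠ 1`, and the inverse `δ` of
`1 - ν'` on these factors. -/
structure ThetaElement {K Φ : Type*} [CommRing K] [Algebra ℚ K] [Fintype Φ]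
    (D : PolarizedLattice K Φ) where
  /-- the unitary element -/
  ν : K
  /-- its inverse -/
  ν' : K
  mul_inv : ν * ν' = 1
  norm_emb : ∀ ρ, ‖D.emb ρ ν‖ = 1
  /-- an odd denominator -/
  o : ℕ
  odd : Odd o
  smul_mem : ∀ x ∈ D.L, o • (ν * x) ∈ D.L
  smul_mem' : ∀ x ∈ D.L, o • (ν' * x) ∈ D.L
  half : ∀ x ∈ D.L, ν * x ∈ D.L → ∃ y ∈ D.L, ν * x - x = y + y
  theta : ∀ x ∈ D.L, ν * x ∈ D.L → ∃ n : ℤ, D.form (ν * x) x = 4 * n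
  /-- the idempotent of the factors where `ν ≠ 1` -/
  ε : K
  /-- the inverse of `1 - ν'` on these factors -/
  δ : K
  ε_idem : ε * ε = ε
  δ_mul : δ * (1 - ν') = ε
  δ_mul_ε : δ * ε = δ
  one_sub_mul : (1 - ν) * (1 - ε) = 0

namespace ThetaElement

variable {K Φ : Type*} [CommRing K] [Algebra ℚ K] [Fintype Φ] {D : PolarizedLattice K Φ}
  (T : ThetaElement D)

lemma emb_inv (ρ : Φ) : D.emb ρ T.ν' = conj (D.emb ρ T.ν) := by
  have h : D.emb ρ T.ν * D.emb ρ T.ν' = 1 := by rw [← map_mul, T.mul_inv, map_one]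
  rw [← Complex.inv_eq_conj (T.norm_emb ρ)]
  exact eq_inv_of_mul_eq_one_right h

lemma inv_mul_cancel (x : K) : T.ν' * (T.ν * x) = x := by
  rw [← mul_assoc, mul_comm T.ν', T.mul_inv, one_mul]

lemma mul_inv_cancel (x : K) : T.ν * (T.ν' * x) = x := by
  rw [← mul_assoc, T.mul_inv, one_mul]

lemma form_ν (x y : K) : D.form (T.ν * x) y = D.form x (T.ν' * y) := D.form_adj T.emb_inv x y

lemma form_ν' (x y : K) : D.form (T.ν' * x) y = D.form x (T.ν * y) :=
  D.form_adj (fun ρ => by rw [T.emb_inv, Complex.conj_conj]) x y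

lemma form_ν_ν (x y : K) : D.form (T.ν * x) (T.ν * y) = D.form x y := by
  rw [T.form_ν, T.inv_mul_cancel]

lemma form_ν'_ν' (x y : K) : D.form (T.ν' * x) (T.ν' * y) = D.form x y := by
  rw [T.form_ν', T.mul_inv_cancel]

lemma emb_ε (ρ : Φ) : D.emb ρ T.ε = if D.emb ρ T.ν = 1 then 0 else 1 := by
  split_ifs with h
  · rw [← T.δ_mul, map_mul, map_sub, map_one, T.emb_inv, h, map_one, sub_self, mul_zero]
  · have h1 := congrArg (D.emb ρ) T.one_sub_mul
    rw [map_mul, map_sub, map_sub, map_one, map_zero] at h1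
    exact (sub_eq_zero.1 ((mul_eq_zero.1 h1).resolve_left (sub_ne_zero.2 (Ne.symm h)))).symm

lemma emb_δ (ρ : Φ) : D.emb ρ T.δ =
    if D.emb ρ T.ν = 1 then 0 else (1 - conj (D.emb ρ T.ν))⁻¹ := by
  have h1 := T.emb_ε ρ
  split_ifs at h1 ⊢ with h
  · rw [← T.δ_mul_ε, map_mul, h1, mul_zero]
  · refine eq_inv_of_mul_eq_one_left ?_
    have h2 := congrArg (D.emb ρ) T.δ_mul
    rwa [map_mul, map_sub, map_one, T.emb_inv, h1] at h2

lemma one_sub_mul_ε : (1 - T.ν) * T.ε = 1 - T.ν := by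
  linear_combination -T.one_sub_mul

lemma one_sub_inv_mul_ε : (1 - T.ν') * T.ε = 1 - T.ν' := by
  linear_combination T.ν' * T.one_sub_mul + T.mul_inv * (1 - T.ε)

lemma inv_mul_δ : T.ν' * T.δ = T.δ - T.ε := by
  rw [← T.δ_mul]
  ring

/-- For `|u| = 1`, the conjugate of `(1 - conj u)⁻¹` is `-conj u * (1 - conj u)⁻¹`, so the adjoint
of `δ` is `-ν⁻¹ δ`. -/
lemma form_δ (x y : K) : D.form (T.δ * x) y = -D.form x (T.ν' * T.δ * y) := by
  rw [D.form_adj (a := T.δ) (b := -(T.ν' * T.δ)), neg_mul, map_neg]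
  intro ρ
  rw [map_neg, map_mul, T.emb_δ, T.emb_inv]
  split_ifs with h
  · simp
  · have h1 : D.emb ρ T.ν * conj (D.emb ρ T.ν) = 1 := by
      rw [← T.emb_inv, ← map_mul, T.mul_inv, map_one]
    have h2 : 1 - D.emb ρ T.ν ≠ 0 := sub_ne_zero.2 (Ne.symm h)
    have h3 : 1 - conj (D.emb ρ T.ν) ≠ 0 := by
      rw [← map_one (starRingEnd ℂ), ← map_sub]
      exact (map_ne_zero _).2 h2
    rw [map_inv₀, map_sub, map_one, Complex.conj_conj]
    field_simp
    linear_combination h1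

/-- The lattice `ν⁻¹ L`. -/
def L' : AddSubgroup K := D.L.comap (AddMonoidHom.mulLeft T.ν)

lemma mem_L' {x : K} : x ∈ T.L' ↔ T.ν * x ∈ D.L := Iff.rfl

/-- The sum of the lattices `L` and `ν⁻¹ L`. -/
def N : AddSubgroup K := D.L ⊔ T.L'

lemma mem_N {n : K} : n ∈ T.N ↔ ∃ l ∈ D.L, ∃ x ∈ T.L', l + x = n := AddSubgroup.mem_sup

lemma inv_mul_mem {l : K} (hl : l ∈ D.L) : T.ν' * l ∈ T.L' := by
  rwa [mem_L', T.mul_inv_cancel]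

lemma form_int' {x y : K} (hx : x ∈ T.L') (hy : y ∈ T.L') : ∃ n : ℤ, D.form x y = n := by
  rw [← T.form_ν_ν]
  exact D.form_int hx hy

open Classical in
/-- The phase `l + x ↦ exp (-2πi ω(l, x))` on `N`. -/
noncomputable def phi (n : K) : ℂ :=
  if h : ∃ l ∈ D.L, ∃ x ∈ T.L', l + x = n then
    phase (-D.form h.choose h.choose_spec.2.choose) else 0

/-- Two decompositions differ by an element of `L ∩ ν⁻¹ L`, and `ω` is integral on both lattices, so
the phase does not depend on the choice. -/
lemma phi_add {l x : K} (hl : l ∈ D.L) (hx : x ∈ T.L') :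
    T.phi (l + x) = phase (-D.form l x) := by
  have h : ∃ l' ∈ D.L, ∃ x' ∈ T.L', l' + x' = l + x := ⟨l, hl, x, hx, rfl⟩
  rw [phi, dif_pos h]
  suffices h0 : ∀ l' x', l' ∈ D.L → x' ∈ T.L' → l' + x' = l + x →
      phase (-D.form l' x') = phase (-D.form l x) from
    h0 _ _ h.choose_spec.1 h.choose_spec.2.choose_spec.1 h.choose_spec.2.choose_spec.2
  intro l' x' h1 h2 h3
  have e1 : l' = l - (x' - x) := by linear_combination h3
  have h4 : x' - x ∈ D.L := by
    have : x' - x = l - l' := by linear_combination h3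
    rw [this]
    exact D.L.sub_mem hl h1
  obtain ⟨a, ha⟩ := D.form_int hl h4
  obtain ⟨b, hb⟩ := T.form_int' (T.L'.sub_mem h2 hx) hx
  have h5 := D.form_self (x' - x)
  apply phase_eq_of_sub (b - a)
  rw [e1]
  simp only [map_sub, LinearMap.sub_apply] at *
  push_cast
  linarith

/-- The quadratic form `x ↦ ω(δx, ν⁻¹δx)`. -/
noncomputable def quad (x : K) : ℚ := D.form (T.δ * x) (T.ν' * (T.δ * x))

lemma quad_add (x y : K) :
    T.quad (x + y) = T.quad x + T.quad y + D.form x (2 * (T.δ * y) - T.ε * y) := by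
  have h1 : D.form (T.δ * x) (T.ν' * (T.δ * y)) + D.form (T.δ * y) (T.ν' * (T.δ * x)) =
      D.form x (2 * (T.δ * y) - T.ε * y) := by
    rw [D.form_comm (T.δ * y), T.form_ν', T.form_δ, T.form_δ, neg_neg, neg_add_eq_sub,
      ← map_sub]
    congr 1
    linear_combination (-(T.ν' * T.δ + (T.δ - T.ε)) * T.inv_mul_δ + 2 * T.δ_mul_ε - T.ε_idem
      + T.δ * T.δ * T.mul_inv) * y
  simp only [quad, mul_add, map_add, LinearMap.add_apply] at *
  linarith

lemma quad_neg (x : K) : T.quad (-x) = T.quad x := by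
  simp only [quad, mul_neg, map_neg, LinearMap.neg_apply, neg_neg]

lemma quad_inv_mul (x : K) : T.quad (T.ν' * x) = T.quad x := by
  rw [quad, quad, mul_left_comm, T.form_ν'_ν']

/-- The part of `N` in the factors where `ν ≠ 1`. -/
def N₁ : AddSubgroup K where
  carrier := {n | n ∈ T.N ∧ T.ε * n = n}
  add_mem' {a b} ha hb := ⟨T.N.add_mem ha.1 hb.1, by rw [mul_add, ha.2, hb.2]⟩
  zero_mem' := ⟨T.N.zero_mem, mul_zero _⟩
  neg_mem' {a} ha := ⟨T.N.neg_mem ha.1, by rw [mul_neg, ha.2]⟩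

/-- The quadratic character on `N₁`. -/
noncomputable def chi (n : K) : ℂ := T.phi n * phase (-T.quad n)

/-- Of the cross terms of `phi` and `quad`, `ω(l, l')` and `ω(x, x')` are integers and `ω(l, x')`
cancels; the displayed phase is what remains. Only the second argument needs to lie in the factor of
`ε`. -/
lemma chi_add {l x l' x' : K} (hl : l ∈ D.L) (hx : x ∈ T.L') (hl' : l' ∈ D.L) (hx' : x' ∈ T.L')
    (h : T.ε * (l' + x') = l' + x') :
    T.chi (l + x + (l' + x')) = T.chi (l + x) * T.chi (l' + x') *
      phase (2 * D.form x l' - 2 * D.form (l + x) (T.δ * (l' + x'))) := by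
  obtain ⟨a, ha⟩ := D.form_int hl hl'
  obtain ⟨b, hb⟩ := T.form_int' hx hx'
  have h1 : l + x + (l' + x') = (l + l') + (x + x') := by ring
  have h2 := D.form_comm l' x
  have h3 := T.quad_add (l + x) (l' + x')
  rw [h] at h3
  simp only [chi]
  rw [T.phi_add hl hx, T.phi_add hl' hx', h3, h1,
    T.phi_add (D.L.add_mem hl hl') (T.L'.add_mem hx hx')]
  simp only [← phase_add]
  apply phase_eq_of_sub (a + b)
  have h4 : ∀ z : K, 2 * z = z + z := two_mul
  simp only [h4, map_add, map_sub, mul_add, LinearMap.add_apply] at *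
  push_cast
  linarith

lemma norm_phi {n : K} (hn : n ∈ T.N) : ‖T.phi n‖ = 1 := by
  obtain ⟨l, hl, x, hx, rfl⟩ := T.mem_N.1 hn
  rw [T.phi_add hl hx, norm_phase]

lemma phi_neg {n : K} (hn : n ∈ T.N) : T.phi (-n) = T.phi n := by
  obtain ⟨l, hl, x, hx, rfl⟩ := T.mem_N.1 hn
  rw [neg_add, T.phi_add (D.L.neg_mem hl) (T.L'.neg_mem hx), T.phi_add hl hx]
  simp

/-- The polarization of `chi`. -/
noncomputable def pol (m n : K) : ℂ := T.chi (m + n) * (T.chi m)⁻¹ * (T.chi n)⁻¹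

lemma norm_chi {n : K} (hn : n ∈ T.N) : ‖T.chi n‖ = 1 := by
  rw [chi, norm_mul, T.norm_phi hn, norm_phase, one_mul]

lemma chi_ne_zero {n : K} (hn : n ∈ T.N) : T.chi n ≠ 0 := by
  intro h
  simpa [h] using T.norm_chi hn

lemma add_mem_N {l x : K} (hl : l ∈ D.L) (hx : x ∈ T.L') : l + x ∈ T.N :=
  T.mem_N.2 ⟨l, hl, x, hx, rfl⟩

lemma pol_eq {l x l' x' : K} (hl : l ∈ D.L) (hx : x ∈ T.L') (hl' : l' ∈ D.L) (hx' : x' ∈ T.L')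
    (h : T.ε * (l' + x') = l' + x') :
    T.pol (l + x) (l' + x') =
      phase (2 * D.form x l' - 2 * D.form (l + x) (T.δ * (l' + x'))) := by
  have h1 := T.chi_ne_zero (T.add_mem_N hl hx)
  have h2 := T.chi_ne_zero (T.add_mem_N hl' hx')
  rw [pol, T.chi_add hl hx hl' hx' h]
  field_simp

lemma pol_comm (m n : K) : T.pol m n = T.pol n m := by
  rw [pol, pol, add_comm, mul_right_comm]

lemma pol_add_left {m n p : K} (hm : m ∈ T.N₁) (hn : n ∈ T.N₁) (hp : p ∈ T.N₁) :
    T.pol (m + n) p = T.pol m p * T.pol n p := by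
  obtain ⟨l, hl, x, hx, rfl⟩ := T.mem_N.1 hm.1
  obtain ⟨l', hl', x', hx', rfl⟩ := T.mem_N.1 hn.1
  obtain ⟨k, hk, y, hy, rfl⟩ := T.mem_N.1 hp.1
  have h1 : l + x + (l' + x') = (l + l') + (x + x') := by ring
  rw [T.pol_eq hl hx hk hy hp.2, T.pol_eq hl' hx' hk hy hp.2, h1,
    T.pol_eq (D.L.add_mem hl hl') (T.L'.add_mem hx hx') hk hy hp.2, ← phase_add]
  congr 1
  simp only [map_add, LinearMap.add_apply]
  ring

lemma isQuadraticCharacter_chi :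
    IsQuadraticCharacter (fun n : T.N₁ => T.chi n) (fun m n : T.N₁ => T.pol m n) where
  pairing := ⟨fun x y z => T.pol_add_left x.2 y.2 z.2, fun x y z => by
      simp only [T.pol_comm (x : K)]
      exact T.pol_add_left y.2 z.2 x.2, fun x y => by
      simp only [pol]
      exact mul_ne_zero (mul_ne_zero (T.chi_ne_zero (T.N₁.add_mem x.2 y.2).1)
        (inv_ne_zero (T.chi_ne_zero x.2.1))) (inv_ne_zero (T.chi_ne_zero y.2.1))⟩
  map_add x y := by
    have h1 := T.chi_ne_zero x.2.1
    have h2 := T.chi_ne_zero y.2.1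
    simp only [pol, AddSubgroup.coe_add]
    field_simp
  map_neg x := by
    simp only [chi, AddSubgroup.coe_neg, T.phi_neg x.2.1, T.quad_neg]
  norm_eq_one x := T.norm_chi x.2.1

lemma chi_inv_mul {v : K} (hv : v ∈ D.L) : T.chi (-(T.ν' * v)) = phase (-T.quad v) := by
  have h := T.phi_add D.L.zero_mem (T.L'.neg_mem (T.inv_mul_mem hv))
  rw [zero_add] at h
  rw [chi, h, T.quad_neg, T.quad_inv_mul]
  simp [phase_zero]

/-- Pairing with `ν⁻¹ L` reads off `2 ω(v, δ n)`. This serves both to prove nondegeneracy and to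
absorb the phases on the dual side of Poisson summation. -/
lemma pol_inv_mul {v n : K} (hv : v ∈ D.L) (hn : n ∈ T.N₁) :
    T.pol (-(T.ν' * v)) n = phase (2 * D.form v (T.δ * n)) := by
  obtain ⟨l, hl, x, hx, rfl⟩ := T.mem_N.1 hn.1
  have h := T.pol_eq D.L.zero_mem (T.L'.neg_mem (T.inv_mul_mem hv)) hl hx hn.2
  rw [zero_add] at h
  rw [h]
  obtain ⟨a, ha⟩ := D.form_int hv hx
  apply phase_eq_of_sub (2 * a)
  have h1 : T.ν * (T.δ * (l + x)) = T.δ * (l + x) + T.ν * (l + x) := by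
    have := hn.2
    linear_combination T.ν * (l + x) * T.δ_mul + T.ν * this + T.δ * (l + x) * T.mul_inv
  simp only [map_neg, LinearMap.neg_apply, T.form_ν', h1, AddMonoidHom.coe_mulLeft] at *
  simp only [mul_add, map_add] at *
  push_cast
  linarith

/-- The lattice `(1 - ν⁻¹) L / 2`. -/
def R : AddSubgroup K := D.mulImage ((2⁻¹ : ℚ) • (1 - T.ν'))

lemma mem_R {x : K} : x ∈ T.R ↔ ∃ y ∈ D.L, (2⁻¹ : ℚ) • ((1 - T.ν') * y) = x := by
  simp only [R, D.mem_mulImage, smul_mul_assoc]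

/-- The half condition applies only to vectors that `ν` keeps in `L`, such as `o • y`. With `o = 2 k
+ 1`, the half of `(1 - ν⁻¹) y` is that of `(1 - ν⁻¹) (o y)` minus `k (1 - ν⁻¹) y`. Hence `R ≤ N`.
-/
lemma exists_decomposition {y : K} (hy : y ∈ D.L) : ∃ (k : ℤ) (z : K), z ∈ T.L' ∧
    (T.o : ℤ) = 2 * k + 1 ∧ z = (2⁻¹ : ℚ) • ((1 - T.ν') * (T.o • y)) + k • (T.ν' * y) ∧
    (2⁻¹ : ℚ) • ((1 - T.ν') * y) = -(k • y) + z := by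
  obtain ⟨k, hk⟩ := T.odd
  have h1 : T.ν * (T.o • y) ∈ D.L := by
    rw [mul_smul_comm]
    exact T.smul_mem y hy
  obtain ⟨w, hw, hw2⟩ := T.half _ (D.L.nsmul_mem hy T.o) h1
  refine ⟨k, _, ?_, by rw [hk]; push_cast; ring, rfl, ?_⟩
  · rw [mem_L']
    have h2 : T.ν * ((2⁻¹ : ℚ) • ((1 - T.ν') * (T.o • y)) + (k : ℤ) • (T.ν' * y)) =
        w + (k : ℤ) • y := by
      have h3 : T.ν * ((1 - T.ν') * (T.o • y)) = w + w := by
        rw [← hw2]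
        linear_combination -(T.o • y) * T.mul_inv
      rw [mul_add, mul_smul_comm, h3, mul_smul_comm, T.mul_inv_cancel, ← two_smul ℚ w,
        inv_smul_smul₀ two_ne_zero]
    rw [h2]
    exact D.L.add_mem hw (D.L.zsmul_mem hy _)
  · have h3 : T.o • y = (2 : ℚ) • ((k : ℤ) • y) + y := by
      rw [hk, two_smul, add_smul, mul_smul, two_smul, one_smul, natCast_zsmul]
    rw [h3, mul_add, smul_add, mul_smul_comm, inv_smul_smul₀ two_ne_zero, mul_smul_comm,
      show (1 - T.ν') * y = y - T.ν' * y by ring, smul_sub, smul_sub]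
    abel

lemma R_le : T.R ≤ T.N₁ := by
  intro r hr
  obtain ⟨y, hy, rfl⟩ := T.mem_R.1 hr
  obtain ⟨k, z, hz, -, -, h⟩ := T.exists_decomposition hy
  refine ⟨?_, ?_⟩
  · rw [h]
    exact T.add_mem_N (D.L.neg_mem (D.L.zsmul_mem hy k)) hz
  · rw [mul_smul_comm, ← mul_assoc, mul_comm T.ε, T.one_sub_inv_mul_ε]

lemma exists_form_o {l x : K} (hl : l ∈ D.L) (hx : x ∈ T.L') :
    ∃ n : ℤ, T.o * D.form x l = n := by
  obtain ⟨n, hn⟩ := D.form_int hx (T.smul_mem l hl)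
  refine ⟨n, ?_⟩
  rw [← hn, AddMonoidHom.coe_mulLeft, map_nsmul, T.form_ν_ν, nsmul_eq_mul]

/-- On `r = (1 - ν⁻¹) y / 2` one has `δ r = ε y / 2`, which cancels the factor two of the
polarization. What remains is `ω(l, y)` and `o ω(x, y)`, both integral. -/
lemma pol_R {r n : K} (hr : r ∈ T.R) (hn : n ∈ T.N₁) : T.pol r n = 1 := by
  have hr2 := (T.R_le hr).2
  obtain ⟨y, hy, rfl⟩ := T.mem_R.1 hr
  obtain ⟨k, z, hz, hk, -, h⟩ := T.exists_decomposition hy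
  obtain ⟨l, hl, x, hx, rfl⟩ := T.mem_N.1 hn.1
  have h1 : T.δ * ((2⁻¹ : ℚ) • ((1 - T.ν') * y)) = (2⁻¹ : ℚ) • (T.ε * y) := by
    rw [mul_smul_comm, ← mul_assoc, T.δ_mul]
  have h2 : D.form (l + x) (T.ε * y) = D.form l y + D.form x y := by
    rw [← D.form_idem T.ε_idem, hn.2, map_add, LinearMap.add_apply]
  rw [T.pol_comm, h, T.pol_eq hl hx (D.L.neg_mem (D.L.zsmul_mem hy k)) hz (by rw [← h, hr2]),
    ← h, h1, phase_eq_one_iff]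
  obtain ⟨a, ha⟩ := D.form_int hl hy
  obtain ⟨b, hb⟩ := T.exists_form_o hy hx
  refine ⟨-a - b, ?_⟩
  have hk' : (T.o : ℚ) = 2 * k + 1 := by exact_mod_cast hk
  rw [map_neg, map_zsmul, map_smul, h2, smul_eq_mul, zsmul_eq_mul, ha]
  rw [hk'] at hb
  push_cast
  linarith

/-- With `w = ω(y, ν⁻¹ y)` the value is the phase of `-o w / 4`. The theta condition at `o • y`
gives that `4` divides `o * (o w)`, hence `o w`, as `o` is odd. -/
lemma chi_R {r : K} (hr : r ∈ T.R) : T.chi r = 1 := by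
  obtain ⟨y, hy, rfl⟩ := T.mem_R.1 hr
  obtain ⟨k, z, hz, hk, hz2, h⟩ := T.exists_decomposition hy
  have hk' : (T.o : ℚ) = 2 * k + 1 := by exact_mod_cast hk
  set w := D.form y (T.ν' * y) with hw
  have h1 : D.form y (T.ε * (T.ν' * y)) = w := by
    have h3 : T.ε * (T.ν' * y) = T.ν' * y - (y - T.ε * y) := by
      linear_combination (-T.ν' * T.one_sub_mul + T.mul_inv * (T.ε - 1)) * y
    have h4 : D.form y (T.ε * y) = 0 := by
      have h5 := D.form_idem T.ε_idem y y
      rw [D.form_comm] at h5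
      linarith
    rw [h3, map_sub, map_sub, D.form_self, h4]
    simp
    rfl
  have h2 : T.quad ((2⁻¹ : ℚ) • ((1 - T.ν') * y)) = w / 4 := by
    have h3 : T.δ * ((2⁻¹ : ℚ) • ((1 - T.ν') * y)) = (2⁻¹ : ℚ) • (T.ε * y) := by
      rw [mul_smul_comm, ← mul_assoc, T.δ_mul]
    rw [quad, h3, mul_smul_comm, map_smul, map_smul, LinearMap.smul_apply, D.form_idem T.ε_idem,
      mul_left_comm T.ν', ← mul_assoc, T.ε_idem, h1]
    simp only [smul_eq_mul]
    ring
  have h5 : D.form y z = -(T.o : ℚ) / 2 * w + k * w := by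
    rw [hz2, map_add, map_smul, map_zsmul, mul_smul_comm, map_nsmul, sub_mul, one_mul, map_sub,
      D.form_self]
    simp only [smul_eq_mul, nsmul_eq_mul, zsmul_eq_mul]
    ring
  obtain ⟨a, ha⟩ : ∃ a : ℤ, T.o * w = a := by
    obtain ⟨a, ha⟩ := T.exists_form_o hy (T.inv_mul_mem hy)
    exact ⟨-a, by rw [hw, D.form_comm, mul_neg, ha]; push_cast; rfl⟩
  obtain ⟨b, hb⟩ : ∃ b : ℤ, (T.o : ℤ) * a = 4 * b := by
    obtain ⟨b, hb⟩ := T.theta (T.o • y) (D.L.nsmul_mem hy _) (by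
      rw [mul_smul_comm]
      exact T.smul_mem y hy)
    refine ⟨b, ?_⟩
    rw [T.form_ν, mul_smul_comm, map_nsmul, map_nsmul, LinearMap.smul_apply, nsmul_eq_mul,
      nsmul_eq_mul, ← hw, ha] at hb
    exact_mod_cast hb
  have h4 : (4 : ℤ) ∣ a := by
    have hc : IsCoprime (4 : ℤ) T.o := by
      have : Nat.Coprime 4 T.o := (Nat.Coprime.pow_left 2 (Nat.coprime_two_left.2 T.odd) :)
      exact_mod_cast Nat.isCoprime_iff_coprime.2 this
    exact hc.dvd_of_dvd_mul_left ⟨b, hb⟩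
  obtain ⟨c, hc⟩ := h4
  rw [chi, h2, h, T.phi_add (D.L.neg_mem (D.L.zsmul_mem hy k)) hz, ← phase_add, phase_eq_one_iff]
  refine ⟨-c, ?_⟩
  rw [map_neg, LinearMap.neg_apply, map_zsmul, LinearMap.smul_apply, h5, zsmul_eq_mul]
  have hc' : (a : ℚ) = 4 * c := by exact_mod_cast hc
  rw [hc', hk'] at ha
  rw [hk']
  push_cast
  linarith

end ThetaElement

end CMCritical

/-! ### Dual bases and the discriminant group -/

open scoped BigOperators ComplexConjugate

namespace CMCritical

lemma sum_subtype_of_eq_zero {Φ M : Type*} [Fintype Φ] [AddCommMonoid M] (p : Φ → Prop)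
    [Fintype {ρ // p ρ}] (a : Φ → M) (h : ∀ ρ, ¬p ρ → a ρ = 0) :
    ∑ ρ : {ρ // p ρ}, a ρ = ∑ ρ, a ρ := by
  classical
  rw [← Finset.sum_subset (Finset.subset_univ (Finset.univ.filter p))
    fun ρ _ hρ => h ρ fun hp => hρ (by simpa using hp)]
  rw [Finset.sum_subtype (Finset.univ.filter p) (p := p) (by simp)]

lemma form_intComb {K Φ : Type*} [CommRing K] [Algebra ℚ K] [Fintype Φ] {D : PolarizedLattice K Φ}
    {I : Type*} [Fintype I] [DecidableEq I] {e f : I → K}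
    (hef : ∀ i j, D.form (f j) (e i) = if i = j then 1 else 0) (j : I) (m : I → ℤ) :
    D.form (f j) (intComb e m) = m j := by
  rw [intComb, map_sum, Finset.sum_eq_single j]
  · rw [map_zsmul, hef, if_pos rfl]
    simp
  · intro i _ hi
    rw [map_zsmul, hef, if_neg hi, smul_zero]
  · simp

namespace ThetaElement

variable {K Φ : Type*} [CommRing K] [Algebra ℚ K] [Fintype Φ] {D : PolarizedLattice K Φ}
  (T : ThetaElement D)

/-- The embeddings where `ν ≠ 1`. -/
abbrev Φ₁ : Type _ := {ρ : Φ // D.emb ρ T.ν ≠ 1}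

/-- The embeddings where `ν ≠ 1`. -/
def emb₁ (ρ : T.Φ₁) : K →+* ℂ := D.emb ρ

/-- The weights of the embeddings where `ν ≠ 1`. -/
def wt₁ (ρ : T.Φ₁) : ℝ := D.wt ρ

noncomputable instance : Fintype T.Φ₁ := Fintype.ofFinite _

/-- Dual bases of the factor where `ν ≠ 1`. -/
structure DualBases where
  /-- the rank -/
  n : ℕ
  /-- a basis of the projection of the lattice -/
  e : Fin n → K
  /-- a basis of the intersection of the lattice with the factor -/
  f : Fin n → K
  form_eq : ∀ i j, D.form (f j) (e i) = if i = j then 1 else 0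
  mem_e : ∀ x, x ∈ D.mulImage T.ε ↔ ∃ m, x = intComb e m
  mem_f : ∀ x, (x ∈ D.L ∧ T.ε * x = x) ↔ ∃ m, x = intComb f m

lemma nonempty_dualBases : Nonempty T.DualBases := by
  obtain ⟨n, e, f, h1, h2, h3⟩ := D.exists_dual_bases T.ε_idem
  exact ⟨⟨n, e, f, h1, h2, h3⟩⟩

variable {T}

namespace DualBases

variable (b : T.DualBases)

lemma ε_mul_e (m : Fin b.n → ℤ) : T.ε * intComb b.e m = intComb b.e m := by
  obtain ⟨y, -, hy⟩ := (b.mem_e _).2 ⟨m, rfl⟩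
  rw [← hy, AddMonoidHom.coe_mulLeft, ← mul_assoc, T.ε_idem]

lemma mem_R {x : K} : x ∈ T.R ↔ ∃ m, x = (2⁻¹ : ℚ) • ((1 - T.ν') * intComb b.e m) := by
  rw [T.mem_R]
  constructor
  · rintro ⟨y, hy, rfl⟩
    obtain ⟨m, hm⟩ := (b.mem_e _).1 ⟨y, hy, rfl⟩
    refine ⟨m, ?_⟩
    rw [← hm, AddMonoidHom.coe_mulLeft, ← mul_assoc, T.one_sub_inv_mul_ε]
  · rintro ⟨m, rfl⟩
    obtain ⟨y, hy, hy2⟩ := (b.mem_e _).2 ⟨m, rfl⟩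
    refine ⟨y, hy, ?_⟩
    rw [← hy2, AddMonoidHom.coe_mulLeft, ← mul_assoc, T.one_sub_inv_mul_ε]

/-- A multiple of the difference lies in the span of `e`, where the pairings with `f` are the
coordinates, all zero here. -/
lemma eq_intComb {z : K} (hz : T.ε * z = z) {k : Fin b.n → ℤ}
    (h : ∀ j, D.form (b.f j) z = k j) : z = intComb b.e k := by
  obtain ⟨N, hN, hx⟩ := D.exists_nsmul_mem (z - intComb b.e k)
  obtain ⟨m, hm⟩ := (b.mem_e _).1 ⟨_, hx, rfl⟩
  rw [AddMonoidHom.coe_mulLeft, mul_smul_comm, mul_sub, hz, b.ε_mul_e] at hm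
  have h1 : m = 0 := by
    funext j
    have h2 := form_intComb b.form_eq j m
    rw [← hm, map_nsmul, map_sub, h, form_intComb b.form_eq, sub_self, smul_zero] at h2
    exact_mod_cast h2.symm
  rw [h1] at hm
  have h3 : intComb b.e 0 = 0 := by simp [intComb]
  rw [h3] at hm
  exact sub_eq_zero.1 (eq_zero_of_nsmul hN hm)

lemma intComb_injective {m m' : Fin b.n → ℤ} (h : intComb b.e m = intComb b.e m') : m = m' := by
  funext j
  have h1 := form_intComb b.form_eq j m
  rw [h, form_intComb b.form_eq] at h1
  exact_mod_cast h1.symm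

lemma intComb_f_injective {m m' : Fin b.n → ℤ} (h : intComb b.f m = intComb b.f m') :
    m = m' := by
  have h1 : ∀ i j, D.form (b.e j) (-b.f i) = if i = j then 1 else 0 := by
    intro i j
    rw [map_neg, D.form_comm, neg_neg, b.form_eq]
    simp only [eq_comm]
  have h3 : ∀ m, intComb (fun i => -b.f i) m = -intComb b.f m := fun m => by simp [intComb]
  funext j
  have h2 := form_intComb h1 j m
  rw [h3, h, ← h3, form_intComb h1] at h2
  exact_mod_cast h2.symm

end DualBases

lemma mul_δ {n : K} (hn : T.ε * n = n) : (1 - T.ν') * (T.δ * n) = n := by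
  rw [← mul_assoc, mul_comm _ T.δ, T.δ_mul, hn]

lemma δ_mul_cancel {x : K} (hx : T.ε * x = x) : T.δ * ((1 - T.ν') * x) = x := by
  rw [← mul_assoc, T.δ_mul, hx]

lemma ε_mul_δ (x : K) : T.ε * (T.δ * x) = T.δ * x := by
  rw [← mul_assoc, mul_comm T.ε, T.δ_mul_ε]

lemma R_of_double {n m : K} (hn : T.ε * n = n) (h : 2 * (T.δ * n) = m) :
    n = (2⁻¹ : ℚ) • ((1 - T.ν') * m) := by
  rw [← h, mul_left_comm, T.mul_δ hn, two_mul, ← two_smul ℚ n, inv_smul_smul₀ two_ne_zero]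

lemma smul_N_mem {n : K} (hn : n ∈ T.N) : T.o • n ∈ D.L := by
  obtain ⟨l, hl, x, hx, rfl⟩ := T.mem_N.1 hn
  rw [smul_add]
  refine D.L.add_mem (D.L.nsmul_mem hl _) ?_
  rw [← T.inv_mul_cancel x]
  exact T.smul_mem' _ hx

/-- Testing against `-(ν⁻¹ f j)` shows that `2 δ n` pairs integrally with every `f j`, so it is an
integral combination of `e`. Then `n = (1 - ν⁻¹) (2 δ n) / 2` is in `R`. -/
lemma nondeg {n : K} (hn : n ∈ T.N₁) (h : ∀ m ∈ T.N₁, T.pol n m = 1) : n ∈ T.R := by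
  obtain ⟨b⟩ := T.nonempty_dualBases
  have h1 : ∀ j, ∃ k : ℤ, D.form (b.f j) (2 * (T.δ * n)) = k := by
    intro j
    have h2 : b.f j ∈ D.L ∧ T.ε * b.f j = b.f j := (b.mem_f _).2 ⟨Pi.single j 1, by
      rw [intComb, Finset.sum_eq_single j] <;> simp +contextual⟩
    have h3 := h (-(T.ν' * b.f j)) ⟨T.N.neg_mem (by
      rw [← zero_add (T.ν' * _)]
      exact T.add_mem_N D.L.zero_mem (T.inv_mul_mem h2.1)), by
        rw [mul_neg, mul_left_comm, h2.2]⟩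
    rw [T.pol_comm, T.pol_inv_mul h2.1 hn, phase_eq_one_iff] at h3
    obtain ⟨k, hk⟩ := h3
    exact ⟨k, by rw [two_mul, map_add, ← hk]; ring⟩
  choose k hk using h1
  have h4 := b.eq_intComb (by rw [mul_left_comm, T.ε_mul_δ]) hk
  rw [b.mem_R]
  exact ⟨k, R_of_double hn.2 h4⟩

variable (T)

/-- The discriminant group `N₁ / R`. -/
abbrev Disc : Type _ := T.N₁ ⧸ T.R.addSubgroupOf T.N₁

lemma disc_eq {m n : T.N₁} : (m : T.Disc) = n ↔ (m : K) - n ∈ T.R := by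
  rw [QuotientAddGroup.eq_iff_sub_mem, AddSubgroup.mem_addSubgroupOf, AddSubgroup.coe_sub]

/-- The factor `o` brings `N` into `L` and `k` brings `δ L` into `L`, so `k * o` maps `N₁` into `R`.
The coordinates of the result modulo `k * o` separate the classes. -/
lemma finite_disc : Finite T.Disc := by
  obtain ⟨b⟩ := T.nonempty_dualBases
  obtain ⟨k, hk, hkL⟩ := D.exists_nsmul_mul_mem T.δ
  set N := k * T.o
  have hN : N ≠ 0 := mul_ne_zero hk T.odd.pos.ne'
  have h1 : ∀ n ∈ T.N₁, N • n ∈ T.R := by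
    intro n hn
    have h2 := hkL _ (smul_N_mem hn.1)
    rw [T.mem_R]
    refine ⟨_, D.L.add_mem h2 h2, ?_⟩
    rw [mul_add, ← two_smul ℚ, inv_smul_smul₀ two_ne_zero, mul_smul_comm, mul_smul_comm,
      mul_smul_comm, T.mul_δ hn.2, ← mul_smul]
  choose co hco using fun n : T.N₁ => b.mem_R.1 (h1 n n.2)
  have : NeZero N := ⟨hN⟩
  refine Finite.of_injective
    (fun q : T.Disc => fun i => ((co q.out i : ℤ) : ZMod N)) fun q q' h => ?_
  rw [← q.out_eq, ← q'.out_eq]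
  refine T.disc_eq.2 ?_
  have h3 : ∀ i, ∃ a : ℤ, co q.out i - co q'.out i = N * a := by
    intro i
    have := congrFun h i
    simp only at this
    rw [ZMod.intCast_eq_intCast_iff_dvd_sub] at this
    obtain ⟨a, ha⟩ := this
    exact ⟨-a, by rw [mul_neg, ← ha]; ring⟩
  choose a ha using h3
  have h4 : co q.out - co q'.out = (N : ℤ) • a := by
    funext i
    simpa using ha i
  rw [b.mem_R]
  refine ⟨a, sub_eq_zero.1 (eq_zero_of_nsmul hN ?_)⟩
  rw [smul_sub, smul_sub, hco, hco, ← smul_sub, ← mul_sub, ← intComb_sub, h4, intComb_zsmul,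
    mul_smul_comm, natCast_zsmul, smul_comm N, sub_self]

end ThetaElement

end CMCritical

open scoped BigOperators ComplexConjugate

namespace CMCritical

namespace ThetaElement

variable {K Φ : Type*} [CommRing K] [Algebra ℚ K] [Fintype Φ] {D : PolarizedLattice K Φ}
  (T : ThetaElement D)

lemma emb₁_injective : Function.Injective T.emb₁ := fun _ _ h =>
  Subtype.ext (D.emb_injective h)

lemma emb_ε_of_ne (ρ : T.Φ₁) : D.emb ρ T.ε = 1 := by rw [T.emb_ε, if_neg ρ.2]

lemma imForm₁ {x : K} (hx : T.ε * x = x) (y : K) :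
    imForm T.emb₁ T.wt₁ x y = D.form x y := by
  rw [D.form_eq, imForm, imForm]
  refine sum_subtype_of_eq_zero _ (fun ρ => D.wt ρ * (D.emb ρ x * conj (D.emb ρ y)).im) ?_
  intro ρ hρ
  rw [← hx, map_mul, T.emb_ε, if_pos (not_not.1 hρ)]
  simp

lemma exists_span₁ (b : T.DualBases) (x : K) :
    ∃ (n : ℕ) (m : Fin b.n → ℤ), n ≠ 0 ∧ ∀ ρ, T.emb₁ ρ (n • x) = T.emb₁ ρ (intComb b.e m) := by
  obtain ⟨n, hn, hx⟩ := D.exists_nsmul_mem x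
  obtain ⟨m, hm⟩ := (b.mem_e _).1 ⟨_, hx, rfl⟩
  refine ⟨n, m, hn, fun ρ => ?_⟩
  rw [← hm, AddMonoidHom.coe_mulLeft]
  change D.emb ρ _ = D.emb ρ _
  rw [map_mul, T.emb_ε_of_ne, one_mul]

/-- Tensoring with `ℝ`, the basis `e` becomes a basis of the real coordinate space, with two
coordinates per embedding. The evenness of the rank is what is used. -/
lemma n_eq (b : T.DualBases) : b.n = 2 * Fintype.card T.Φ₁ := by
  have hef : ∀ i j, imForm T.emb₁ T.wt₁ (b.f j) (b.e i) = if i = j then 1 else 0 := by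
    intro i j
    rw [T.imForm₁, b.form_eq]
    · split_ifs <;> simp
    · exact ((b.mem_f _).2 ⟨Pi.single j 1, by
        rw [intComb, Finset.sum_eq_single j] <;> simp +contextual⟩).2
  have h := (LinearEquiv.ofBijective (Fintype.linearCombination ℝ
    (fun i => realCoord T.emb₁ (b.e i))) ⟨linearCombination_realCoord_injective hef,
      linearCombination_realCoord_surjective T.emb₁_injective
        (fun ρ ρ' => D.emb_ne_conj ρ ρ') (T.exists_span₁ b)⟩).finrank_eq
  rw [Module.finrank_fintype_fun_eq_card, Module.finrank_fintype_fun_eq_card, Fintype.card_fin,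
    Fintype.card_prod, Fintype.card_bool] at h
  rw [h, mul_comm]

/-! #### The two-torsion of the discriminant group -/

/-- The sign `±1` of a class modulo two. -/
noncomputable def sgn (a : ZMod 2) : ℂ := if a = 0 then 1 else -1

lemma sgn_add : ∀ a b : ZMod 2, sgn (a + b) = sgn a * sgn b := by
  intro a b
  have h0 : ∀ a : ZMod 2, a = 0 ∨ a = 1 := by decide
  rcases h0 a with rfl | rfl <;> rcases h0 b with rfl | rfl <;> simp [sgn, CharTwo.add_self_eq_zero]

lemma sgn_eq_one_iff {a : ZMod 2} : sgn a = 1 ↔ a = 0 := by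
  unfold sgn
  split_ifs with h
  · simp [h]
  · simp only [h, iff_false]
    norm_num

lemma exists_half_form {l l' : K} (hl : l ∈ D.L) (hl' : l' ∈ D.L) :
    ∃ n : ℤ, D.form ((T.ν - 1) * (T.o • l)) (T.o • l') = 2 * n := by
  obtain ⟨w, hw, hw2⟩ := T.half (T.o • l) (D.L.nsmul_mem hl _) (by
    rw [mul_smul_comm]
    exact T.smul_mem l hl)
  obtain ⟨n, hn⟩ := D.form_int hw (D.L.nsmul_mem hl' T.o)
  refine ⟨n, ?_⟩
  rw [sub_mul, one_mul, hw2, map_add, LinearMap.add_apply, hn]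
  ring

/-- Twice this vector lies in `R`, so these are the candidates for 2-torsion. Membership amounts to
`z ∈ L`; since `4 • z ∈ L` and `o` is odd this is `o • z ∈ L`, which autoduality tests against `L`.
-/
lemma quarter_mem_iff {l : K} (hl : l ∈ D.L) :
    (4⁻¹ : ℚ) • ((1 - T.ν') * l) ∈ T.N₁ ↔
      ∀ l' ∈ D.L, ∃ n : ℤ, D.form ((T.ν - 1) * (T.o • l)) (T.o • l') = 4 * n := by
  set z := (4⁻¹ : ℚ) • ((T.ν - 1) * (T.o • l)) with hz
  have hν : T.ν * ((4⁻¹ : ℚ) • ((1 - T.ν') * l)) = (4⁻¹ : ℚ) • ((T.ν - 1) * l) := by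
    rw [mul_smul_comm]
    congr 1
    linear_combination -l * T.mul_inv
  have hzo : z = T.o • ((4⁻¹ : ℚ) • ((T.ν - 1) * l)) := by
    rw [hz, mul_smul_comm, smul_comm]
  have hform : ∀ l', D.form ((T.ν - 1) * (T.o • l)) (T.o • l') = 4 * D.form (T.o • z) l' := by
    intro l'
    rw [hz, map_nsmul, map_nsmul, map_smul, LinearMap.smul_apply, LinearMap.smul_apply]
    simp only [smul_eq_mul, nsmul_eq_mul]
    ring
  have h4z : 4 • z ∈ D.L := by
    obtain ⟨w, hw, hw2⟩ := T.half (T.o • l) (D.L.nsmul_mem hl _) (by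
      rw [mul_smul_comm]
      exact T.smul_mem l hl)
    have : 4 • z = w + w := by
      rw [← hw2, hz, ← Nat.cast_smul_eq_nsmul ℚ, smul_smul]
      norm_num
      ring
    rw [this]
    exact D.L.add_mem hw hw
  obtain ⟨a, c, hac⟩ : ∃ a c : ℤ, a * T.o + c * 4 = 1 := by
    have hc : IsCoprime (T.o : ℤ) 4 := by
      have : Nat.Coprime T.o 4 := (Nat.Coprime.pow_right 2 (Nat.coprime_two_right.2 T.odd) :)
      exact_mod_cast Nat.isCoprime_iff_coprime.2 this
    exact hc
  have hoz : T.o • z ∈ D.L ↔ ∀ l' ∈ D.L, ∃ n : ℤ,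
      D.form ((T.ν - 1) * (T.o • l)) (T.o • l') = 4 * n := by
    rw [D.mem_iff]
    refine forall₂_congr fun l' _ => exists_congr fun n => ?_
    rw [hform]
    constructor
    · intro h
      rw [h]
    · intro h
      linarith
  rw [← hoz]
  constructor
  · rintro ⟨h, -⟩
    obtain ⟨l1, hl1, x1, hx1, h1⟩ := T.mem_N.1 h
    have h2 : z = T.o • (T.ν * l1) + T.o • (T.ν * x1) := by
      rw [hzo, ← hν, ← h1, mul_add, smul_add]
    rw [h2]
    exact D.L.nsmul_mem (D.L.add_mem (T.smul_mem _ hl1) (D.L.nsmul_mem hx1 _)) _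
  · intro h
    have hzL : z ∈ D.L := by
      have : z = a • (T.o • z) + c • (4 • z) := by
        rw [← natCast_zsmul, ← mul_smul, ← natCast_zsmul z 4, ← mul_smul, ← add_smul]
        push_cast
        rw [hac, one_smul]
      rw [this]
      exact D.L.add_mem (D.L.zsmul_mem h _) (D.L.zsmul_mem h4z _)
    refine ⟨?_, by rw [mul_smul_comm, ← mul_assoc, mul_comm T.ε, T.one_sub_inv_mul_ε]⟩
    set q := (4⁻¹ : ℚ) • ((1 - T.ν') * l) with hq
    -- From `4 q = l - ν⁻¹ l` and the Bézout relation between `o` and `4`: the first term is in `L`,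
    -- the others in `ν⁻¹ L`.
    have h5 : q = c • l + (a • (T.o • q) + -(c • (T.ν' * l))) := by
      have h6 : 4 • q = l - T.ν' * l := by
        rw [hq, ← Nat.cast_smul_eq_nsmul ℚ, smul_smul]
        norm_num
        ring
      have h7 : q = a • (T.o • q) + c • (4 • q) := by
        rw [← natCast_zsmul, ← mul_smul, ← natCast_zsmul q 4, ← mul_smul, ← add_smul]
        push_cast
        rw [hac, one_smul]
      rw [h6, smul_sub] at h7
      nth_rewrite 1 [h7]
      abel
    rw [h5]
    refine T.add_mem_N (D.L.zsmul_mem hl _) (T.L'.add_mem (T.L'.zsmul_mem ?_ _)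
      (T.L'.neg_mem (T.L'.zsmul_mem (T.inv_mul_mem hl) _)))
    rw [mem_L', mul_smul_comm, hν, ← hzo]
    exact hzL

end ThetaElement

end CMCritical

open scoped BigOperators ComplexConjugate

namespace CMCritical

namespace ThetaElement

variable {K Φ : Type*} [CommRing K] [Algebra ℚ K] [Fintype Φ] {D : PolarizedLattice K Φ}
  (T : ThetaElement D)

lemma form_sub_one_mul_ε (x y : K) :
    D.form ((T.ν - 1) * x) (T.ε * y) = D.form ((T.ν - 1) * x) y := by
  rw [← D.form_idem T.ε_idem, ← mul_assoc]
  congr 2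
  linear_combination -x * T.one_sub_mul_ε

/-- Half of `ω((ν - 1) o l, o l')` modulo two is an alternating form on `(ℤ/2) ^ n`, and `l ↦ (1 -
ν⁻¹) l / 4` identifies its radical with the 2-torsion. The radical has index a power of four and `n`
is even, so `r` is even. -/
lemma even_of_card_twoTorsion {r : ℕ}
    (hr : Nat.card (IsQuadraticCharacter.twoTorsion T.Disc) = 2 ^ r) : Even r := by
  classical
  obtain ⟨b⟩ := T.nonempty_dualBases
  have hl : ∀ i, ∃ l ∈ D.L, T.ε * l = b.e i := fun i => (b.mem_e _).2 ⟨Pi.single i 1, by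
    rw [intComb, Finset.sum_eq_single i] <;> simp +contextual⟩
  choose l hlL hlε using hl
  have hlat : ∀ m, intComb l m ∈ D.L := intComb_mem hlL
  have hε : ∀ m, T.ε * intComb l m = intComb b.e m := by
    intro m
    rw [← intComb_mul]
    simp only [hlε]
  have hD : ∀ m, (1 - T.ν') * intComb l m = (1 - T.ν') * intComb b.e m := by
    intro m
    rw [← hε, ← mul_assoc, T.one_sub_inv_mul_ε]
  choose c hc using fun i j => T.exists_half_form (hlL i) (hlL j)
  have hform : ∀ m m', D.form ((T.ν - 1) * (T.o • intComb l m)) (T.o • intComb l m') =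
      2 * ((∑ i, ∑ j, m i * m' j * c i j : ℤ) : ℚ) := by
    intro m m'
    have h1 : (T.ν - 1) * (T.o • intComb l m) = ∑ i, m i • ((T.ν - 1) * (T.o • l i)) := by
      simp only [intComb, Finset.smul_sum, Finset.mul_sum]
      refine Finset.sum_congr rfl fun i _ => ?_
      rw [smul_comm, mul_smul_comm]
    have h2 : T.o • intComb l m' = ∑ j, m' j • (T.o • l j) := by
      simp only [intComb, Finset.smul_sum]
      exact Finset.sum_congr rfl fun i _ => smul_comm _ _ _
    rw [h1, h2, map_sum D.form, LinearMap.sum_apply]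
    push_cast
    rw [Finset.mul_sum]
    refine Finset.sum_congr rfl fun i _ => ?_
    rw [map_sum, Finset.mul_sum]
    refine Finset.sum_congr rfl fun j _ => ?_
    rw [map_zsmul, map_zsmul, LinearMap.smul_apply, hc]
    simp only [zsmul_eq_mul]
    ring
  let V := Fin b.n → ZMod 2
  let β : V → V → ℂ := fun x y => sgn (∑ i, ∑ j, x i * y j * (c i j : ZMod 2))
  have hβ : IsPairing β := by
    refine ⟨fun x y z => ?_, fun x y z => ?_, fun x y => ?_⟩
    · simp only [β, ← sgn_add, ← Finset.sum_add_distrib, ← add_mul]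
      rfl
    · simp only [β, ← sgn_add, ← Finset.sum_add_distrib, ← add_mul, ← mul_add]
      rfl
    · simp only [β, sgn]
      split_ifs <;> norm_num
  have hβ1 : ∀ x y, β x y = 1 ∨ β x y = -1 := by
    intro x y
    simp only [β, sgn]
    split_ifs <;> simp
  have hβm : ∀ m m' : Fin b.n → ℤ, β (fun i => (m i : ZMod 2)) (fun i => (m' i : ZMod 2)) = 1 ↔
      ∃ n : ℤ, D.form ((T.ν - 1) * (T.o • intComb l m)) (T.o • intComb l m') = 4 * n := by
    intro m m'
    have h1 : (∑ i, ∑ j, (m i : ZMod 2) * (m' j : ZMod 2) * (c i j : ZMod 2)) =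
        ((∑ i, ∑ j, m i * m' j * c i j : ℤ) : ZMod 2) := by push_cast; rfl
    simp only [β]
    rw [sgn_eq_one_iff, h1, ZMod.intCast_zmod_eq_zero_iff_dvd, hform]
    refine exists_congr fun n => ?_
    constructor
    · intro h
      rw [h]
      push_cast
      ring
    · intro h
      have h2 : ((∑ i, ∑ j, m i * m' j * c i j : ℤ) : ℚ) = ((2 : ℕ) * n : ℤ) := by
        push_cast at h ⊢
        linarith
      exact_mod_cast h2
  let lift : V → Fin b.n → ℤ := fun x i => ((x i).val : ℤ)
  have hlift : ∀ x, (fun i => (lift x i : ZMod 2)) = x := by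
    intro x
    funext i
    simp [lift]
  -- This is the theta condition, since `ω(x, x) = 0`.
  have halt : ∀ x, β x x = 1 := by
    intro x
    rw [← hlift x, hβm]
    have h1 : T.ν * (T.o • intComb l (lift x)) ∈ D.L := by
      rw [mul_smul_comm]
      exact T.smul_mem _ (hlat _)
    obtain ⟨n, hn⟩ := T.theta _ (D.L.nsmul_mem (hlat _) T.o) h1
    exact ⟨n, by rw [sub_mul, one_mul, map_sub, LinearMap.sub_apply, D.form_self, sub_zero, hn]⟩
  have hrad : ∀ m : Fin b.n → ℤ, (fun i => (m i : ZMod 2)) ∈ hβ.radical ⊤ ↔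
      (4⁻¹ : ℚ) • ((1 - T.ν') * intComb l m) ∈ T.N₁ := by
    intro m
    rw [T.quarter_mem_iff (hlat m)]
    constructor
    · rintro ⟨-, h⟩ l' hl'
      obtain ⟨m', hm'⟩ := (b.mem_e _).1 ⟨l', hl', rfl⟩
      have h1 := h (fun i => (m' i : ZMod 2)) trivial
      rw [hβm] at h1
      obtain ⟨n, hn⟩ := h1
      refine ⟨n, ?_⟩
      rw [← hn, ← T.form_sub_one_mul_ε, ← T.form_sub_one_mul_ε _ (T.o • intComb l m'),
        mul_smul_comm T.o T.ε, mul_smul_comm T.o T.ε, hε, ← hm', AddMonoidHom.coe_mulLeft]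
    · intro h
      refine ⟨trivial, fun w _ => ?_⟩
      rw [← hlift w, hβm]
      exact h _ (hlat _)
  obtain ⟨k, hk⟩ := hβ.exists_card_eq_radical_mul hβ1 halt ⊤
  have hinj : ∀ m m' : Fin b.n → ℤ, (4⁻¹ : ℚ) • ((1 - T.ν') * intComb b.e m) -
      (4⁻¹ : ℚ) • ((1 - T.ν') * intComb b.e m') ∈ T.R ↔ ∃ a, m - m' = (2 : ℤ) • a := by
    intro m m'
    rw [b.mem_R, ← smul_sub, ← mul_sub, ← intComb_sub]
    refine exists_congr fun a => ?_
    constructor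
    · intro h
      have h1 := congrArg (fun x => (4 : ℚ) • (T.δ * x)) h
      simp only [mul_smul_comm] at h1
      rw [T.δ_mul_cancel (b.ε_mul_e _), T.δ_mul_cancel (b.ε_mul_e _), smul_smul, smul_smul] at h1
      norm_num at h1
      apply b.intComb_injective
      rw [intComb_zsmul, ← Int.cast_smul_eq_zsmul ℚ, h1]
      norm_num
    · intro h
      rw [h, intComb_zsmul, ← Int.cast_smul_eq_zsmul ℚ, mul_smul_comm, smul_smul]
      norm_num
  let ψ : hβ.radical ⊤ → IsQuadraticCharacter.twoTorsion T.Disc := fun x =>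
    ⟨((⟨(4⁻¹ : ℚ) • ((1 - T.ν') * intComb l (lift x)), (hrad _).1 (by
      rw [hlift]; exact x.2)⟩ : T.N₁) : T.Disc), by
      rw [IsQuadraticCharacter.mem_twoTorsion, ← QuotientAddGroup.mk_add,
        QuotientAddGroup.eq_zero_iff, AddSubgroup.mem_addSubgroupOf, T.mem_R]
      refine ⟨_, hlat (lift x), ?_⟩
      change _ = (4⁻¹ : ℚ) • ((1 - T.ν') * intComb l (lift x)) + (4⁻¹ : ℚ) • _
      rw [← add_smul]
      norm_num⟩
  have hψ : Function.Bijective ψ := by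
    constructor
    · intro x y hxy
      have h1 := T.disc_eq.1 (congrArg Subtype.val hxy)
      simp only [hD] at h1
      obtain ⟨a, ha⟩ := (hinj _ _).1 h1
      apply Subtype.ext
      rw [← hlift x, ← hlift y]
      funext i
      rw [← sub_eq_zero, ← Int.cast_sub, ← Pi.sub_apply, ha]
      simp only [Pi.smul_apply, smul_eq_mul]
      push_cast
      rw [show (2 : ZMod 2) = 0 from rfl, zero_mul]
    · rintro ⟨⟨n⟩, hn⟩
      have h1 : ((n + n : T.N₁) : T.Disc) = 0 := hn
      rw [QuotientAddGroup.eq_zero_iff, AddSubgroup.mem_addSubgroupOf, b.mem_R] at h1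
      obtain ⟨m, hm⟩ := h1
      have h2 : (n : K) = (4⁻¹ : ℚ) • ((1 - T.ν') * intComb b.e m) := by
        have h3 : (n : K) = (2⁻¹ : ℚ) • ((n + n : T.N₁) : K) := by
          rw [AddSubgroup.coe_add, ← two_smul ℚ, inv_smul_smul₀ two_ne_zero]
        rw [h3, hm, smul_smul]
        norm_num
      have h3 : (fun i => (m i : ZMod 2)) ∈ hβ.radical ⊤ := by
        rw [hrad, hD, ← h2]
        exact n.2
      refine ⟨⟨_, h3⟩, Subtype.ext ?_⟩
      change _ = (n : T.Disc)
      refine T.disc_eq.2 ?_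
      simp only [hD]
      rw [h2, hinj]
      have h4 : ∀ i, ∃ a : ℤ, lift (fun i => (m i : ZMod 2)) i - m i = 2 * a := by
        intro i
        have h5 := congrFun (hlift (fun i => (m i : ZMod 2))) i
        obtain ⟨a, ha⟩ := (ZMod.intCast_eq_intCast_iff_dvd_sub _ _ _).1 h5.symm
        exact ⟨a, ha⟩
      choose a ha using h4
      exact ⟨a, funext fun i => ha i⟩
  rw [← Nat.card_eq_of_bijective ψ hψ] at hr
  have h5 : Nat.card (⊤ : AddSubgroup V) = 2 ^ b.n := by
    rw [Nat.card_congr AddSubgroup.topEquiv.toEquiv, Nat.card_eq_fintype_card, Fintype.card_fun,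
      ZMod.card, Fintype.card_fin]
  rw [h5, hr, T.n_eq b, show (4 : ℕ) = 2 ^ 2 from rfl, ← pow_mul, ← pow_add] at hk
  have h6 := Nat.pow_right_injective le_rfl hk
  have h7 : r = 2 * (Fintype.card T.Φ₁ - k) := by omega
  rw [h7]
  exact even_two_mul _

/-- The discriminant group carries a nondegenerate quadratic character whose Gauss sum has a
nonnegative fourth power. -/
lemma exists_gauss [Fintype T.Disc] : ∃ χ : T.Disc → ℂ, (∀ n : T.N₁, χ n = T.chi n) ∧
    ∃ t : ℝ, 0 ≤ t ∧ (∑ x, χ x) ^ 4 = t := by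
  obtain ⟨χ, B, h, hχ, hB⟩ := T.isQuadraticCharacter_chi.exists_quotient
    (R := T.R.addSubgroupOf T.N₁) (fun r hr => T.chi_R hr) (fun r hr v => T.pol_R hr v.2)
  refine ⟨χ, hχ, ?_⟩
  obtain ⟨r, t, hr, ht, h4⟩ := h.exists_gauss_pow_four (by
    rintro ⟨x⟩ hx
    refine (QuotientAddGroup.eq_zero_iff x).2 (nondeg x.2 fun m hm => ?_)
    exact (hB x ⟨m, hm⟩).symm.trans (hx _))
  refine ⟨t, ht, ?_⟩
  rw [h4, (T.even_of_card_twoTorsion hr).neg_one_pow, one_mul]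

end ThetaElement

end CMCritical

/-! ### The complex Gaussian of a unitary element and its Fourier dual -/

open scoped BigOperators ComplexConjugate

namespace CMCritical

namespace ThetaElement

variable {K Φ : Type*} [CommRing K] [Algebra ℚ K] [Fintype Φ] {D : PolarizedLattice K Φ}
  (T : ThetaElement D)

lemma phase_form_eq (x y : K) : phase (D.form x y) =
    Complex.exp (∑ ρ, 2 * Real.pi * Complex.I * (D.wt ρ * (D.emb ρ x * conj (D.emb ρ y)).im)) := by
  rw [phase, D.form_eq, imForm]
  push_cast
  rw [Finset.mul_sum]

lemma gauss_eq (x : K) : (D.gauss x : ℂ) =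
    Complex.exp (∑ ρ, -(Real.pi * (D.wt ρ * (‖D.emb ρ x‖ ^ 2 : ℝ)))) := by
  rw [PolarizedLattice.gauss, PolarizedLattice.norm2]
  push_cast
  rw [Finset.mul_sum, Finset.sum_neg_distrib]

/-- At an embedding with `u = ρ ν`, the Gaussian gives `-π |1 - u| ^ 2 = -2π (1 - Re u)` and the
phase gives `2πi Im u`; together they form `-2π (1 - u)`. -/
lemma phase_mul_gauss (ξ : K) :
    phase (D.form ξ (T.ν' * ξ)) * D.gauss ((1 - T.ν') * ξ) =
      Complex.exp (-∑ ρ, 2 * Real.pi * T.wt₁ ρ * (1 - D.emb ρ T.ν) *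
        ((‖T.emb₁ ρ ξ‖ ^ 2 : ℝ) : ℂ)) := by
  rw [phase_form_eq, gauss_eq, ← Complex.exp_add, ← Finset.sum_add_distrib,
    ← Finset.sum_neg_distrib]
  congr 1
  symm
  refine (sum_subtype_of_eq_zero _ (fun ρ => -(2 * Real.pi * D.wt ρ * (1 - D.emb ρ T.ν) *
    ((‖D.emb ρ ξ‖ ^ 2 : ℝ) : ℂ))) ?_).trans (Finset.sum_congr rfl fun ρ _ => ?_)
  · intro ρ hρ
    rw [not_not.1 hρ]
    simp
  · have hu : (D.emb ρ T.ν).re * (D.emb ρ T.ν).re + (D.emb ρ T.ν).im * (D.emb ρ T.ν).im = 1 := by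
      rw [← Complex.normSq_apply, Complex.normSq_eq_norm_sq, T.norm_emb, one_pow]
    simp only [map_mul, map_sub, map_one, T.emb_inv, ← Complex.normSq_eq_norm_sq]
    generalize D.emb ρ T.ν = u at *
    generalize D.emb ρ ξ = z
    apply Complex.ext
    · simp [Complex.normSq_apply]
      linear_combination -Real.pi * D.wt ρ * (z.re * z.re + z.im * z.im) * hu
    · simp [Complex.normSq_apply]
      ring

/-- On the unit circle `(1 - u)⁻¹ = 1 / 2 + i s`. The real part `1 / 2` rebuilds the original
Gaussian, and the imaginary part is the phase of `quad`. -/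
lemma gauss_mul_phase {w : K} (hw : T.ε * w = w) :
    Complex.exp (-∑ ρ, (Real.pi * T.wt₁ ρ / 2) * (1 - D.emb ρ T.ν)⁻¹ *
        ((‖T.emb₁ ρ (2 * w)‖ ^ 2 : ℝ) : ℂ)) = D.gauss w * phase (-T.quad w) := by
  rw [quad, ← map_neg, phase_form_eq, gauss_eq, ← Complex.exp_add, ← Finset.sum_add_distrib,
    ← Finset.sum_neg_distrib]
  congr 1
  have h0 : ∀ ρ, D.emb ρ T.ν = 1 → D.emb ρ w = 0 := by
    intro ρ hρ
    rw [← hw, map_mul, T.emb_ε, if_pos hρ, zero_mul]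
  refine (sum_subtype_of_eq_zero _ (fun ρ => -((Real.pi * D.wt ρ / 2) * (1 - D.emb ρ T.ν)⁻¹ *
    ((‖D.emb ρ (2 * w)‖ ^ 2 : ℝ) : ℂ))) ?_).trans (Finset.sum_congr rfl fun ρ _ => ?_)
  · intro ρ hρ
    rw [map_mul, h0 ρ (not_not.1 hρ)]
    simp
  · by_cases hρ : D.emb ρ T.ν = 1
    · simp [h0 ρ hρ]
    have hu : (D.emb ρ T.ν).re * (D.emb ρ T.ν).re + (D.emb ρ T.ν).im * (D.emb ρ T.ν).im = 1 := by
      rw [← Complex.normSq_apply, Complex.normSq_eq_norm_sq, T.norm_emb, one_pow]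
    have hre : 1 - (D.emb ρ T.ν).re ≠ 0 := by
      have := one_sub_re_pos (T.norm_emb ρ) hρ
      simpa using this.ne'
    have hδ := T.emb_δ ρ
    rw [if_neg hρ] at hδ
    rw [map_neg, map_mul, map_mul, map_mul, map_mul, hδ, T.emb_inv, ← Complex.normSq_eq_norm_sq,
      ← Complex.normSq_eq_norm_sq, map_ofNat]
    generalize D.emb ρ T.ν = u at *
    generalize D.emb ρ w = z
    have h1 : Complex.normSq (1 - u) = 2 * (1 - u.re) := by
      rw [Complex.normSq_apply]
      simp
      linear_combination hu
    have h2 : (1 - u)⁻¹ = ⟨1 / 2, u.im / (2 * (1 - u.re))⟩ := by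
      apply Complex.ext
      · rw [Complex.inv_re, h1]
        simp
        field_simp
      · rw [Complex.inv_im, h1]
        simp
    have h3 : (1 - conj u)⁻¹ = ⟨1 / 2, -(u.im / (2 * (1 - u.re)))⟩ := by
      have : (1 - conj u)⁻¹ = conj ((1 - u)⁻¹) := by simp
      rw [this, h2]
      apply Complex.ext <;> simp
    rw [h2, h3]
    set s := u.im / (2 * (1 - u.re)) with hs
    have hsu : s * (2 * (1 - u.re)) = u.im := by
      rw [hs]
      field_simp
    -- The bracket is `|1 - u|⁻²`, the modulus squared of the value of `δ`.
    have hs2 : (1 / 4 + s * s) * u.im = s := by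
      rw [← hsu]
      have h5 : (s * (2 * (1 - u.re))) * (s * (2 * (1 - u.re))) = 1 - u.re * u.re := by
        rw [hsu]
        linarith
      have h6 : s * s * (4 * (1 - u.re)) = 1 + u.re := by
        apply mul_right_cancel₀ hre
        linear_combination h5
      linear_combination s / 2 * h6
    apply Complex.ext
    · simp [Complex.normSq_apply]
      ring
    · simp [Complex.normSq_apply]
      linear_combination 2 * Real.pi * D.wt ρ * (z.re * z.re + z.im * z.im) * hs2

end ThetaElement

end CMCritical

/-! ### The theta transformation on the factors where `ν ≠ 1` -/

open scoped BigOperators ComplexConjugate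

namespace CMCritical

namespace ThetaElement

variable {K Φ : Type*} [CommRing K] [Algebra ℚ K] [Fintype Φ] {D : PolarizedLattice K Φ}
  (T : ThetaElement D)

/-- The intersection of the lattice with the factor where `ν ≠ 1`. -/
def L₁ : AddSubgroup K where
  carrier := {n | n ∈ D.L ∧ T.ε * n = n}
  add_mem' {a b} ha hb := ⟨D.L.add_mem ha.1 hb.1, by rw [mul_add, ha.2, hb.2]⟩
  zero_mem' := ⟨D.L.zero_mem, mul_zero _⟩
  neg_mem' {a} ha := ⟨D.L.neg_mem ha.1, by rw [mul_neg, ha.2]⟩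

/-- The general term of the theta sum twisted by `phi`. -/
noncomputable def term (c n : K) : ℂ := T.phi n * phase (-D.form c n) * D.gauss (c + n)

/-- The general term of the theta sum. -/
noncomputable def term₀ (D : PolarizedLattice K Φ) (c n : K) : ℂ :=
  phase (-D.form c n) * D.gauss (c + n)

lemma norm_term₀ (c n : K) : ‖term₀ D c n‖ = D.gauss (c + n) := by
  rw [term₀, norm_mul, norm_phase, one_mul, Complex.norm_real,
    Real.norm_of_nonneg (D.gauss_pos _).le]

lemma norm_term (c : K) {n : K} (hn : n ∈ T.N) : ‖T.term c n‖ = D.gauss (c + n) := by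
  rw [term, mul_assoc, norm_mul, T.norm_phi hn, one_mul]
  exact norm_term₀ c n

lemma summable_term₀ {H : AddSubgroup K} (hH : H ≤ D.L) (c : K) :
    Summable fun n : H => term₀ D c n := by
  refine Summable.of_norm ?_
  simp only [norm_term₀]
  exact D.summable_gauss one_ne_zero (fun h hh => by rw [one_smul]; exact hH hh) c

lemma summable_term {H : AddSubgroup K} (hH : H ≤ T.N) (c : K) :
    Summable fun n : H => T.term c n := by
  refine Summable.of_norm ?_
  have : (fun n : H => ‖T.term c n‖) = fun n : H => D.gauss (c + n) := by
    funext n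
    exact T.norm_term c (hH n.2)
  rw [this]
  exact D.summable_gauss T.odd.pos.ne' (fun h hh => T.smul_N_mem (hH hh)) c

/-- In the variable `ξ = δ (c + n)` the term is a complex Gaussian with a linear phase. The
character `chi` collects the rest of the dependence on `n`, and is constant on cosets of `R`. -/
lemma term_eq {c n : K} (hc : T.ε * c = c) (hn : T.ε * n = n) :
    T.term c n = T.chi n * phase (T.quad c) *
      (phase (-(2 * D.form c (T.δ * (c + n)))) *
        (phase (D.form (T.δ * (c + n)) (T.ν' * (T.δ * (c + n)))) *
          D.gauss ((1 - T.ν') * (T.δ * (c + n))))) := by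
  have hcn : T.ε * (c + n) = c + n := by rw [mul_add, hc, hn]
  rw [T.mul_δ hcn, term, chi]
  have h1 : phase (-D.form c n) = phase (-T.quad n) * phase (T.quad c) *
      phase (-(2 * D.form c (T.δ * (c + n)))) *
      phase (D.form (T.δ * (c + n)) (T.ν' * (T.δ * (c + n)))) := by
    simp only [← phase_add]
    congr 1
    have h2 := T.quad_add c n
    have h3 := T.quad_add c c
    have h4 : T.quad (c + c) = 4 * T.quad c := by
      simp only [quad, mul_add, map_add, LinearMap.add_apply]
      ring
    have h5 := D.form_self c
    change _ = _ + T.quad (c + n)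
    rw [hn] at h2
    rw [h4, hc] at h3
    rw [h2, mul_add, map_add]
    simp only [map_sub, two_mul, map_add] at *
    linarith
  rw [h1]
  ring

lemma N₁_le : T.N₁ ≤ T.N := fun _ hn => hn.1

lemma L₁_le : T.L₁ ≤ D.L := fun _ hn => hn.1

lemma neg_inv_mul_mem {v : K} (hv : v ∈ T.L₁) : -(T.ν' * v) ∈ T.N₁ := by
  refine ⟨T.N.neg_mem ?_, by rw [mul_neg, mul_left_comm, hv.2]⟩
  rw [← zero_add (T.ν' * v)]
  exact T.add_mem_N D.L.zero_mem (T.inv_mul_mem hv.1)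

variable {T}

lemma DualBases.f_mem (b : T.DualBases) (m : Fin b.n → ℤ) : intComb b.f m ∈ T.L₁ :=
  (b.mem_f _).2 ⟨m, rfl⟩

lemma DualBases.ε_mul_f (b : T.DualBases) (j : Fin b.n) : T.ε * b.f j = b.f j := by
  have := (b.f_mem (Pi.single j 1)).2
  have h : intComb b.f (Pi.single j 1) = b.f j := by
    rw [intComb, Finset.sum_eq_single j] <;> simp +contextual
  rwa [h] at this

/-- Poisson summation on the factor where `ν ≠ 1`. -/
lemma DualBases.exists_tsum_phase (b : T.DualBases) : ∃ κ : ℝ, 0 < κ ∧ ∀ z c, T.ε * c = c →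
    ∑' m, phase (-(2 * D.form c (z + (2⁻¹ : ℚ) • intComb b.e m))) *
      (phase (D.form (z + (2⁻¹ : ℚ) • intComb b.e m)
        (T.ν' * (z + (2⁻¹ : ℚ) • intComb b.e m))) *
        D.gauss ((1 - T.ν') * (z + (2⁻¹ : ℚ) • intComb b.e m))) =
    κ * (∏ ρ : T.Φ₁, (1 - D.emb ρ T.ν)⁻¹) * ∑' m, phase (2 * D.form (intComb b.f m) z) *
      (D.gauss (c + intComb b.f m) * phase (-T.quad (c + intComb b.f m))) := by
  -- In the variable `ξ`, a coset of `R` becomes a coset of the lattice of `e / 2`, so the dual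
  -- basis is `2 f`.
  have hef : ∀ i j, imForm T.emb₁ T.wt₁ (2 * b.f j) ((2⁻¹ : ℚ) • b.e i) =
      if i = j then 1 else 0 := by
    intro i j
    rw [T.imForm₁ (by rw [mul_left_comm, b.ε_mul_f]), map_smul, two_mul, map_add,
      LinearMap.add_apply, b.form_eq]
    split_ifs <;> norm_num
  have hspan : ∀ x : K, ∃ (n : ℕ) (m : Fin b.n → ℤ), n ≠ 0 ∧
      ∀ ρ, T.emb₁ ρ (n • x) = T.emb₁ ρ (intComb (fun i => (2⁻¹ : ℚ) • b.e i) m) := by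
    intro x
    obtain ⟨n, m, hn, hm⟩ := T.exists_span₁ b x
    refine ⟨n, (2 : ℤ) • m, hn, fun ρ => ?_⟩
    rw [hm, intComb_smul, intComb_zsmul, ← Int.cast_smul_eq_zsmul ℚ, smul_smul]
    norm_num
  obtain ⟨κ, hκ, hP⟩ := exists_tsum_unitary_gaussian (emb := T.emb₁) (wt := T.wt₁)
    (fun ρ => D.wt_pos ρ) hef T.emb₁_injective (fun ρ ρ' => D.emb_ne_conj ρ ρ') hspan
    (u := fun ρ => D.emb ρ T.ν) (fun ρ => T.norm_emb ρ) (fun ρ => ρ.2)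
  refine ⟨κ, hκ, fun z c hc => ?_⟩
  have h1 := hP z (2 * c)
  simp only [intComb_smul, intComb_mul] at h1
  convert h1 using 1
  · refine tsum_congr fun m => ?_
    rw [T.phase_mul_gauss, mul_comm, Complex.exp_add, T.imForm₁ (by rw [mul_left_comm, hc]), phase,
      two_mul c, map_add D.form, LinearMap.add_apply, ← two_mul]
    push_cast
    rfl
  · congr 1
    refine tsum_congr fun m => ?_
    rw [← mul_add 2 c, T.gauss_mul_phase (by rw [mul_add, hc, (b.f_mem m).2]),
      T.imForm₁ (by rw [mul_left_comm, (b.f_mem m).2]), phase, two_mul (intComb b.f m),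
      map_add D.form, LinearMap.add_apply, ← two_mul]

/-- The coordinates on `N₁`. -/
noncomputable def DualBases.equivN (b : T.DualBases) : T.Disc × (Fin b.n → ℤ) ≃ T.N₁ :=
  Equiv.ofBijective (fun p => p.1.out + ⟨_, T.R_le (b.mem_R.2 ⟨p.2, rfl⟩)⟩) (by
    have hmk : ∀ p : T.Disc × (Fin b.n → ℤ),
        ((p.1.out + ⟨_, T.R_le (b.mem_R.2 ⟨p.2, rfl⟩)⟩ : T.N₁) : T.Disc) = p.1 := by
      intro p
      conv_rhs => rw [← p.1.out_eq]
      refine T.disc_eq.2 ?_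
      rw [AddSubgroup.coe_add, add_sub_cancel_left]
      exact b.mem_R.2 ⟨p.2, rfl⟩
    constructor
    · intro p p' hpp
      have h1 : p.1 = p'.1 := by
        rw [← hmk p, ← hmk p']
        exact congrArg _ hpp
      have h2 := congrArg Subtype.val hpp
      simp only [AddSubgroup.coe_add, h1, add_right_inj] at h2
      have h3 := congrArg (fun x => (2 : ℚ) • (T.δ * x)) h2
      simp only [mul_smul_comm] at h3
      rw [T.δ_mul_cancel (b.ε_mul_e _), T.δ_mul_cancel (b.ε_mul_e _),
        smul_inv_smul₀ two_ne_zero, smul_inv_smul₀ two_ne_zero] at h3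
      exact Prod.ext h1 (b.intComb_injective h3)
    · intro n
      obtain ⟨m, hm⟩ := b.mem_R.1 (T.disc_eq.1 (Quotient.out_eq (n : T.Disc)).symm)
      refine ⟨((n : T.Disc), m), Subtype.ext ?_⟩
      rw [AddSubgroup.coe_add]
      change _ + (2⁻¹ : ℚ) • ((1 - T.ν') * intComb b.e m) = _
      rw [← hm]
      exact add_sub_cancel _ _)

lemma DualBases.coe_equivN (b : T.DualBases) (g : T.Disc) (m : Fin b.n → ℤ) :
    (b.equivN (g, m) : K) = g.out + (2⁻¹ : ℚ) • ((1 - T.ν') * intComb b.e m) := rfl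

lemma DualBases.mk_equivN (b : T.DualBases) (g : T.Disc) (m : Fin b.n → ℤ) :
    (b.equivN (g, m) : T.Disc) = g := by
  conv_rhs => rw [← g.out_eq]
  refine T.disc_eq.2 ?_
  rw [b.coe_equivN]
  rw [add_sub_cancel_left]
  exact b.mem_R.2 ⟨m, rfl⟩

/-- The coordinates on `L₁`. -/
noncomputable def DualBases.equivL (b : T.DualBases) : (Fin b.n → ℤ) ≃ T.L₁ :=
  Equiv.ofBijective (fun m => ⟨intComb b.f m, b.f_mem m⟩)
    ⟨fun _ _ h => b.intComb_f_injective (congrArg Subtype.val h), fun v => by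
      obtain ⟨m, hm⟩ := (b.mem_f _).1 v.2
      exact ⟨m, Subtype.ext hm.symm⟩⟩

lemma DualBases.coe_equivL (b : T.DualBases) (m : Fin b.n → ℤ) :
    (b.equivL m : K) = intComb b.f m := rfl

/-- The phases after Poisson summation. -/
lemma phase_dual {c v : K} (hc : T.ε * c = c) (hv : v ∈ T.L₁) {n : K} (hn : n ∈ T.N₁) :
    T.chi n * phase (T.quad c) * (phase (2 * D.form v (T.δ * (c + n))) *
      (D.gauss (c + v) * phase (-T.quad (c + v)))) =
    T.chi (n + -(T.ν' * v)) * term₀ D c v := by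
  have h1 := T.pol_inv_mul hv.1 hn
  have h2 := T.chi_ne_zero hn.1
  have h3 := T.chi_ne_zero (T.neg_inv_mul_mem hv).1
  rw [pol, mul_assoc, ← _root_.mul_inv, ← div_eq_mul_inv, div_eq_iff (mul_ne_zero h3 h2),
    T.chi_inv_mul hv.1] at h1
  rw [add_comm n, h1, term₀]
  have h4 : phase (T.quad c) * (phase (2 * D.form v (T.δ * (c + n))) *
      phase (-T.quad (c + v))) =
      phase (2 * D.form v (T.δ * n)) * phase (-T.quad v) * phase (-D.form c v) := by
    simp only [← phase_add]
    congr 1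
    have h5 := T.quad_add v c
    rw [hc, add_comm v c] at h5
    have h6 := D.form_comm v c
    rw [h5, mul_add, map_add]
    simp only [map_sub, two_mul, map_add] at *
    linarith
  linear_combination T.chi n * D.gauss (c + v) * h4

/-- The class of `-ν⁻¹ v` for the `m`-th vector `v` of `L₁`. -/
noncomputable def DualBases.shift (b : T.DualBases) (m : Fin b.n → ℤ) : T.Disc :=
  (⟨_, T.neg_inv_mul_mem (b.f_mem m)⟩ : T.N₁)

lemma DualBases.chi_add_shift (b : T.DualBases) {χ : T.Disc → ℂ} (hχ : ∀ n : T.N₁, χ n = T.chi n)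
    (g : T.Disc) (m : Fin b.n → ℤ) :
    χ (g + b.shift m) = T.chi (g.out + -(T.ν' * intComb b.f m)) := by
  have h := hχ (g.out + ⟨_, T.neg_inv_mul_mem (b.f_mem m)⟩)
  refine Eq.trans (congrArg χ ?_) h
  rw [QuotientAddGroup.mk_add]
  exact congrArg (· + b.shift m) g.out_eq.symm

lemma DualBases.term_equivN (b : T.DualBases) {χ : T.Disc → ℂ} (hχ : ∀ n : T.N₁, χ n = T.chi n)
    {c : K} (hc : T.ε * c = c) (g : T.Disc) (m : Fin b.n → ℤ) :
    T.term c (b.equivN (g, m)) = χ g * phase (T.quad c) *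
      (phase (-(2 * D.form c (T.δ * (c + g.out) + (2⁻¹ : ℚ) • intComb b.e m))) *
      (phase (D.form (T.δ * (c + g.out) + (2⁻¹ : ℚ) • intComb b.e m)
        (T.ν' * (T.δ * (c + g.out) + (2⁻¹ : ℚ) • intComb b.e m))) *
        D.gauss ((1 - T.ν') * (T.δ * (c + g.out) + (2⁻¹ : ℚ) • intComb b.e m)))) := by
  have h1 : T.δ * (c + (b.equivN (g, m) : K)) =
      T.δ * (c + g.out) + (2⁻¹ : ℚ) • intComb b.e m := by
    rw [b.coe_equivN, ← add_assoc, mul_add T.δ, mul_smul_comm, T.δ_mul_cancel (b.ε_mul_e _)]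
  rw [T.term_eq hc (b.equivN (g, m)).2.2, h1, ← hχ, b.mk_equivN]

lemma norm_of_chi {χ : T.Disc → ℂ} (hχ : ∀ n : T.N₁, χ n = T.chi n) (g : T.Disc) : ‖χ g‖ = 1 := by
  obtain ⟨n, rfl⟩ := QuotientAddGroup.mk_surjective g
  rw [hχ, T.norm_chi n.2.1]

/-- Poisson summation on one coset of `R`. The dual phases combine with `χ g` into the value of `χ`
at a translate of `g`. -/
lemma DualBases.tsum_class (b : T.DualBases) {χ : T.Disc → ℂ} (hχ : ∀ n : T.N₁, χ n = T.chi n)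
    {κ : ℂ} (hP : ∀ z c, T.ε * c = c →
      ∑' m, phase (-(2 * D.form c (z + (2⁻¹ : ℚ) • intComb b.e m))) *
        (phase (D.form (z + (2⁻¹ : ℚ) • intComb b.e m)
          (T.ν' * (z + (2⁻¹ : ℚ) • intComb b.e m))) *
          D.gauss ((1 - T.ν') * (z + (2⁻¹ : ℚ) • intComb b.e m))) =
      κ * ∑' m, phase (2 * D.form (intComb b.f m) z) *
        (D.gauss (c + intComb b.f m) * phase (-T.quad (c + intComb b.f m))))
    {c : K} (hc : T.ε * c = c) (g : T.Disc) :
    ∑' m, T.term c (b.equivN (g, m)) = κ * ∑' m, χ (g + b.shift m) * term₀ D c (b.equivL m) := by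
  rw [tsum_congr (b.term_equivN hχ hc g), tsum_mul_left, hP _ c hc, mul_left_comm, ← tsum_mul_left]
  refine congrArg (κ * ·) (tsum_congr fun m => ?_)
  have h4 : χ g = T.chi g.out := by
    rw [← hχ]
    exact congrArg χ g.out_eq.symm
  rw [h4, b.chi_add_shift hχ, phase_dual hc (b.f_mem m) g.out.2, b.coe_equivL]

/-- The theta transformation formula on the factor where `ν ≠ 1`. -/
theorem exists_tsum_term₁ (T : ThetaElement D) : ∃ lam : ℂ,
    (∃ t : ℝ, 0 ≤ t ∧ lam ^ 4 = t * (∏ ρ : T.Φ₁, (1 - D.emb ρ T.ν)⁻¹) ^ 4) ∧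
    ∀ c, T.ε * c = c → ∑' n : T.N₁, T.term c n = lam * ∑' v : T.L₁, term₀ D c v := by
  obtain ⟨b⟩ := T.nonempty_dualBases
  have := T.finite_disc
  have : Fintype T.Disc := Fintype.ofFinite _
  obtain ⟨χ, hχ, t, ht, h4⟩ := T.exists_gauss
  obtain ⟨κ, hκ, hP⟩ := b.exists_tsum_phase
  refine ⟨κ * (∏ ρ : T.Φ₁, (1 - D.emb ρ T.ν)⁻¹) * ∑ x, χ x,
    ⟨κ ^ 4 * t, mul_nonneg (pow_nonneg hκ.le 4) ht, ?_⟩, fun c hc => ?_⟩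
  · rw [mul_pow, mul_pow, h4]
    push_cast
    ring
  have hsum : Summable fun p => T.term c (b.equivN p) :=
    (b.equivN.summable_iff (f := fun n : T.N₁ => T.term c n)).2 (T.summable_term T.N₁_le c)
  have hsum₀ : Summable fun m => term₀ D c (b.equivL m) :=
    (b.equivL.summable_iff (f := fun v : T.L₁ => term₀ D c v)).2 (summable_term₀ T.L₁_le c)
  have hsg : ∀ g ∈ (Finset.univ : Finset T.Disc),
      Summable fun m => χ (g + b.shift m) * term₀ D c (b.equivL m) := by
    intro g _
    refine Summable.of_norm_bounded hsum₀.norm fun m => ?_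
    rw [norm_mul, norm_of_chi hχ, one_mul]
  rw [← b.equivN.tsum_eq (fun n : T.N₁ => T.term c n), hsum.tsum_prod, tsum_fintype,
    ← b.equivL.tsum_eq (fun v : T.L₁ => term₀ D c v),
    Finset.sum_congr rfl fun g _ => b.tsum_class hχ hP hc g, ← Finset.mul_sum, mul_assoc,
    ← Summable.tsum_finsetSum hsg]
  -- Summing over all classes undoes the translation, so every dual vector receives the same full
  -- Gauss sum.
  have h5 : ∀ m, ∑ g, χ (g + b.shift m) * term₀ D c (b.equivL m) =
      (∑ x, χ x) * term₀ D c (b.equivL m) := by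
    intro m
    rw [← Finset.sum_mul]
    exact congrArg (· * _) (Fintype.sum_equiv (Equiv.addRight (b.shift m)) _ _ fun g => rfl)
  rw [tsum_congr h5, tsum_mul_left]
  ring

end ThetaElement

end CMCritical

/-! ### Reinstating the factors where `ν = 1` -/

open scoped BigOperators ComplexConjugate

namespace CMCritical

namespace ThetaElement

variable {K Φ : Type*} [CommRing K] [Algebra ℚ K] [Fintype Φ] {D : PolarizedLattice K Φ}
  (T : ThetaElement D)

lemma gauss_split (x : K) : D.gauss x = D.gauss ((1 - T.ε) * x) * D.gauss (T.ε * x) := by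
  rw [PolarizedLattice.gauss, PolarizedLattice.gauss, PolarizedLattice.gauss, ← Real.exp_add]
  congr 1
  rw [← neg_add, ← mul_add]
  congr 2
  simp only [PolarizedLattice.norm2, ← Finset.sum_add_distrib]
  refine Finset.sum_congr rfl fun ρ _ => ?_
  rw [map_mul, map_mul, map_sub, map_one, T.emb_ε]
  split_ifs <;> simp

lemma phi_add_left {s n : K} (hs : s ∈ D.L) (hn : n ∈ T.N) :
    T.phi (s + n) = T.phi n * phase (-D.form s n) := by
  obtain ⟨l, hl, x, hx, rfl⟩ := T.mem_N.1 hn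
  obtain ⟨a, ha⟩ := D.form_int hs hl
  rw [← add_assoc, T.phi_add (D.L.add_mem hs hl) hx, T.phi_add hl hx, ← phase_add]
  apply phase_eq_of_sub a
  rw [map_add, map_add, LinearMap.add_apply]
  linarith

/-- The common factor of the terms of a fibre of the projection to the factors where `ν = 1`. -/
noncomputable def fibreFactor (c s : K) : ℂ :=
  phase (-D.form c s) * D.gauss ((1 - T.ε) * (c + s))

lemma gauss_fibre (c s : K) {n : K} (hn : T.ε * n = n) :
    D.gauss (c + (s + n)) = D.gauss ((1 - T.ε) * (c + s)) * D.gauss (T.ε * (c + s) + n) := by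
  rw [T.gauss_split (c + (s + n))]
  congr 2
  · linear_combination -hn
  · linear_combination hn

lemma form_fibre (c : K) {n : K} (hn : T.ε * n = n) : D.form c n = D.form (T.ε * c) n := by
  rw [D.form_idem T.ε_idem, hn]

/-- The vector `s` is absorbed into the characteristic `ε * (c + s)`; the same prefactor occurs in
`term₀_fibre`, so the two sums can be compared fibre by fibre. -/
lemma term_fibre (c : K) {s n : K} (hs : s ∈ D.L) (hn : n ∈ T.N₁) :
    T.term c (s + n) = T.fibreFactor c s * T.term (T.ε * (c + s)) n := by
  have h : phase (-D.form s n) * phase (-D.form c (s + n)) =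
      phase (-D.form c s) * phase (-D.form (T.ε * (c + s)) n) := by
    rw [← phase_add, ← phase_add, ← T.form_fibre _ hn.2, map_add, map_add, LinearMap.add_apply]
    congr 1
    ring
  rw [term, term, fibreFactor, T.phi_add_left hs hn.1, T.gauss_fibre c s hn.2]
  push_cast
  linear_combination T.phi n * D.gauss ((1 - T.ε) * (c + s)) * D.gauss (T.ε * (c + s) + n) * h

lemma term₀_fibre (c : K) {s v : K} (hs : s ∈ D.L) (hv : v ∈ T.L₁) :
    term₀ D c (s + v) = T.fibreFactor c s * term₀ D (T.ε * (c + s)) v := by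
  obtain ⟨a, ha⟩ := D.form_int hs hv.1
  have h : phase (-D.form c (s + v)) =
      phase (-D.form c s) * phase (-D.form (T.ε * (c + s)) v) := by
    rw [← phase_add, ← T.form_fibre _ hv.2, map_add, map_add, LinearMap.add_apply]
    apply phase_eq_of_sub a
    linarith
  rw [term₀, term₀, fibreFactor, T.gauss_fibre c s hv.2, h]
  push_cast
  ring

/-- As `(1 - ε) ν = 1 - ε`, the lattices `L` and `N` have the same projection to the factors where
`ν = 1`. One section with values in `L` therefore serves for both. -/
lemma exists_tsum_fibre : ∃ s : D.mulImage (1 - T.ε) → K, (∀ a, s a ∈ D.L) ∧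
    ∀ H H₁ : AddSubgroup K, (∀ x, x ∈ H₁ ↔ x ∈ H ∧ T.ε * x = x) → D.L ≤ H → H ≤ T.N →
      ∀ F : K → ℂ, (Summable fun h : H => F h) →
        ∑' h : H, F h = ∑' a, ∑' n : H₁, F (s a + n) := by
  choose s hs hs1 using fun a : D.mulImage (1 - T.ε) => D.mem_mulImage.1 a.2
  refine ⟨s, hs, fun H H₁ hH₁ hLH hHN F hF => ?_⟩
  have hproj : ∀ h ∈ H, (1 - T.ε) * h ∈ D.mulImage (1 - T.ε) := by
    intro h hh
    obtain ⟨l, hl, x, hx, rfl⟩ := T.mem_N.1 (hHN hh)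
    refine ⟨l + T.ν * x, D.L.add_mem hl hx, ?_⟩
    rw [AddMonoidHom.coe_mulLeft]
    linear_combination -x * T.one_sub_mul
  let E : D.mulImage (1 - T.ε) × H₁ ≃ H :=
    { toFun := fun p => ⟨s p.1 + p.2, H.add_mem (hLH (hs _)) ((hH₁ _).1 p.2.2).1⟩
      invFun := fun h => (⟨_, hproj h h.2⟩, ⟨h - s ⟨_, hproj h h.2⟩, (hH₁ _).2
        ⟨H.sub_mem h.2 (hLH (hs _)), by
          have := hs1 ⟨_, hproj h h.2⟩
          simp only at this
          linear_combination this⟩⟩)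
      left_inv := by
        rintro ⟨a, n⟩
        have h1 : (1 - T.ε) * (s a + n) = a := by
          have := hs1 a
          linear_combination this - ((hH₁ _).1 n.2).2
        have h2 : (⟨_, hproj (s a + n) (H.add_mem (hLH (hs _)) ((hH₁ _).1 n.2).1)⟩ :
            D.mulImage (1 - T.ε)) = a := Subtype.ext h1
        refine Prod.ext h2 (Subtype.ext ?_)
        simp only [h2]
        ring
      right_inv := fun h => Subtype.ext (by simp) }
  have hs2 : Summable fun p => F (E p) := (E.summable_iff (f := fun h : H => F h)).2 hF
  rw [← E.tsum_eq (fun h : H => F h), hs2.tsum_prod]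
  rfl

lemma L_le_N : D.L ≤ T.N := le_sup_left

/-- The theta transformation formula of a unitary element of the theta group. -/
theorem exists_tsum_term : ∃ lam : ℂ,
    (∃ t : ℝ, 0 ≤ t ∧ lam ^ 4 = t * (∏ ρ : T.Φ₁, (1 - D.emb ρ T.ν)⁻¹) ^ 4) ∧
    ∀ c, ∑' n : T.N, T.term c n = lam * ∑' v : D.L, term₀ D c v := by
  obtain ⟨lam, h4, h⟩ := T.exists_tsum_term₁
  obtain ⟨s, hs, hfib⟩ := T.exists_tsum_fibre
  refine ⟨lam, h4, fun c => ?_⟩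
  rw [hfib T.N T.N₁ (fun x => Iff.rfl) T.L_le_N le_rfl _ (T.summable_term le_rfl c),
    hfib D.L T.L₁ (fun x => Iff.rfl) le_rfl T.L_le_N _ (summable_term₀ le_rfl c),
    ← tsum_mul_left]
  refine tsum_congr fun a => ?_
  have h1 : ∀ n : T.N₁, T.term c (s a + n) =
      T.fibreFactor c (s a) * T.term (T.ε * (c + s a)) n := fun n => T.term_fibre c (hs a) n.2
  have h2 : ∀ v : T.L₁, term₀ D c (s a + v) =
      T.fibreFactor c (s a) * term₀ D (T.ε * (c + s a)) v := fun v => T.term₀_fibre c (hs a) v.2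
  rw [tsum_congr h1, tsum_congr h2, tsum_mul_left, tsum_mul_left,
    h _ (by rw [← mul_assoc, T.ε_idem])]
  ring

end ThetaElement

end CMCritical

/-! ### The group `L / (L ∩ ν L)` and the modulus of the multiplier -/

open scoped BigOperators ComplexConjugate

namespace CMCritical

namespace ThetaElement

variable {K Φ : Type*} [CommRing K] [Algebra ℚ K] [Fintype Φ] {D : PolarizedLattice K Φ}
  (T : ThetaElement D)

/-- The group `L / (L ∩ ν L)`. -/
abbrev G : Type _ := D.L ⧸ (D.mulImage T.ν).addSubgroupOf D.L

lemma mk_eq_iff {a b : D.L} : (a : T.G) = b ↔ T.ν' * ((a : K) - b) ∈ D.L := by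
  rw [QuotientAddGroup.eq_iff_sub_mem, AddSubgroup.mem_addSubgroupOf, D.mem_mulImage,
    AddSubgroup.coe_sub]
  constructor
  · rintro ⟨y, hy, hy2⟩
    rw [← hy2, T.inv_mul_cancel]
    exact hy
  · intro h
    exact ⟨_, h, T.mul_inv_cancel _⟩

lemma o_smul_G (x : T.G) : T.o • x = 0 := by
  obtain ⟨a, rfl⟩ := QuotientAddGroup.mk_surjective x
  rw [← QuotientAddGroup.mk_nsmul, ← QuotientAddGroup.mk_zero, T.mk_eq_iff]
  simp only [AddSubgroup.coe_nsmul, AddSubgroup.coe_zero, sub_zero]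
  rw [mul_smul_comm]
  exact T.smul_mem' _ a.2

instance finite_G : Finite T.G := by
  obtain ⟨n, e, f, -, he, -⟩ := D.exists_dual_bases (ε := 1) (one_mul 1)
  have heL : ∀ m, intComb e m ∈ D.L := by
    intro m
    obtain ⟨y, hy, hy2⟩ := (he _).2 ⟨m, rfl⟩
    rw [← hy2, AddMonoidHom.coe_mulLeft, one_mul]
    exact hy
  choose co hco using fun x : D.L => (he x).1 ⟨x, x.2, one_mul _⟩
  have : NeZero T.o := ⟨T.odd.pos.ne'⟩
  refine Finite.of_injective
    (fun q : T.G => fun i => ((co q.out i : ℤ) : ZMod T.o)) fun q q' h => ?_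
  rw [← q.out_eq, ← q'.out_eq]
  refine T.mk_eq_iff.2 ?_
  have h3 : ∀ i, ∃ a : ℤ, co q.out i - co q'.out i = T.o * a := by
    intro i
    obtain ⟨a, ha⟩ := (ZMod.intCast_eq_intCast_iff_dvd_sub _ _ _).1 (congrFun h i)
    exact ⟨-a, by rw [mul_neg, ← ha]; ring⟩
  choose a ha using h3
  have h4 : co q.out - co q'.out = (T.o : ℤ) • a := by
    funext i
    simpa using ha i
  rw [hco, hco q'.out, ← intComb_sub, h4, intComb_zsmul, mul_smul_comm, natCast_zsmul]
  exact T.smul_mem' _ (heL a)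

lemma odd_card_G : Odd (Nat.card T.G) := by
  by_contra h
  rw [Nat.not_odd_iff_even, even_iff_two_dvd] at h
  obtain ⟨x, hx⟩ := exists_prime_addOrderOf_dvd_card' (G := T.G) 2 h
  have h1 : 2 • x = 0 := by rw [← hx, addOrderOf_nsmul_eq_zero]
  obtain ⟨k, hk⟩ := T.odd
  have h2 := T.o_smul_G x
  rw [hk, add_smul, mul_comm, mul_smul, h1, smul_zero, zero_add, one_smul] at h2
  rw [h2] at hx
  simp at hx

/-- Representatives in `ν⁻¹ L`. -/
noncomputable def rep (g : T.G) : K := T.ν' * (g.out : D.L)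

lemma rep_mem (g : T.G) : T.rep g ∈ T.L' := T.inv_mul_mem g.out.2

/-- The coordinates on `N`. -/
noncomputable def equivN : T.G × D.L ≃ T.N :=
  Equiv.ofBijective (fun p => ⟨p.2 + T.rep p.1, T.add_mem_N p.2.2 (T.rep_mem _)⟩) (by
    constructor
    · rintro ⟨g, l⟩ ⟨g', l'⟩ h
      have h1 : (l : K) + T.rep g = l' + T.rep g' := congrArg Subtype.val h
      have h2 : g = g' := by
        rw [← g.out_eq, ← g'.out_eq]
        refine T.mk_eq_iff.2 ?_
        have : T.ν' * ((g.out : D.L) - (g'.out : D.L) : K) = l' - l := by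
          rw [mul_sub]
          change T.rep g - T.rep g' = _
          linear_combination h1
        rw [this]
        exact D.L.sub_mem l'.2 l.2
      subst h2
      exact Prod.ext rfl (Subtype.ext (add_right_cancel h1))
    · rintro ⟨n, hn⟩
      obtain ⟨l, hl, x, hx, rfl⟩ := T.mem_N.1 hn
      let g : T.G := (⟨T.ν * x, hx⟩ : D.L)
      have h1 : T.ν' * (T.ν * x - (g.out : D.L)) ∈ D.L := T.mk_eq_iff.1 g.out_eq.symm
      rw [mul_sub, T.inv_mul_cancel] at h1
      refine ⟨(g, ⟨_, D.L.add_mem hl h1⟩), Subtype.ext ?_⟩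
      simp only [rep]
      ring)

lemma tsum_N [Fintype T.G] {F : K → ℂ} (hF : Summable fun n : T.N => F n) :
    ∑' n : T.N, F n = ∑ g : T.G, ∑' l : D.L, F (l + T.rep g) := by
  have hs : Summable fun p => F (T.equivN p) :=
    (T.equivN.summable_iff (f := fun n : T.N => F n)).2 hF
  rw [← T.equivN.tsum_eq (fun n : T.N => F n), hs.tsum_prod, tsum_fintype]
  rfl

-- Orthogonality of characters. The factor two is harmless: if all phases are trivial then `2 ν l ∈
-- L`, and `o ν l ∈ L` with `o` odd.
open Classical in
lemma sum_phase_rep [Fintype T.G] {l : K} (hl : l ∈ D.L) :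
    ∑ g, phase (2 * D.form l (T.rep g)) = if l ∈ T.L' then (Nat.card T.G : ℂ) else 0 := by
  split_ifs with h
  · have h1 : ∀ g, phase (2 * D.form l (T.rep g)) = 1 := by
      intro g
      obtain ⟨n, hn⟩ := T.form_int' h (T.rep_mem g)
      rw [hn, phase_eq_one_iff]
      exact ⟨2 * n, by push_cast; ring⟩
    simp [h1, Nat.card_eq_fintype_card]
  · obtain ⟨a, ha⟩ : ∃ a : D.L, phase (2 * D.form l (T.ν' * a)) ≠ 1 := by
      by_contra hall
      push Not at hall
      refine h ?_
      have h2 : T.ν * l + T.ν * l ∈ D.L := by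
        rw [D.mem_iff]
        intro y hy
        obtain ⟨n, hn⟩ := phase_eq_one_iff.1 (hall ⟨y, hy⟩)
        refine ⟨n, ?_⟩
        rw [map_add, LinearMap.add_apply, T.form_ν, ← hn]
        ring
      obtain ⟨k, hk⟩ := T.odd
      have h3 := T.smul_mem l hl
      rw [hk, add_smul, mul_comm, mul_smul, two_smul, one_smul] at h3
      rw [mem_L']
      exact (D.L.add_mem_cancel_left (D.L.nsmul_mem h2 k)).1 h3
    have h1 : ∀ g : T.G, phase (2 * D.form l (T.rep (g + a))) =
        phase (2 * D.form l (T.ν' * a)) * phase (2 * D.form l (T.rep g)) := by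
      intro g
      have h2 : ((g + a).out : T.G) = ((a + g.out : D.L) : T.G) := by
        have h6 : (g.out : T.G) = g := g.out_eq
        have h7 : ((g + a).out : T.G) = g + a := (g + a).out_eq
        rw [QuotientAddGroup.mk_add, h6, h7, add_comm]
      have h3 := T.mk_eq_iff.1 h2
      obtain ⟨n, hn⟩ := D.form_int hl h3
      rw [← phase_add]
      apply phase_eq_of_sub (2 * n)
      push_cast
      rw [← hn, AddSubgroup.coe_add, mul_sub, mul_add, map_sub, map_add, rep, rep]
      ring
    have h4 : ∑ g : T.G, phase (2 * D.form l (T.rep (g + a))) =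
        ∑ g : T.G, phase (2 * D.form l (T.rep g)) :=
      Fintype.sum_equiv (Equiv.addRight (a : T.G)) _ _ fun g => rfl
    simp only [h1] at h4
    rw [← Finset.mul_sum] at h4
    have h5 : (phase (2 * D.form l (T.ν' * a)) - 1) *
        ∑ g : T.G, phase (2 * D.form l (T.rep g)) = 0 := by
      rw [sub_mul, h4, one_mul, sub_self]
    exact (mul_eq_zero.1 h5).resolve_left (sub_ne_zero.2 ha)

lemma term_translate {r l x : K} (hr : r ∈ T.L') (hl : l ∈ D.L) (hx : x ∈ T.L') :
    T.term r (l + x - r) = phase (2 * D.form l r) * (T.phi (l + x) * D.gauss (l + x)) := by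
  have h1 : l + x - r = l + (x - r) := by ring
  have h2 : r + (l + (x - r)) = l + x := by ring
  obtain ⟨n, hn⟩ := T.form_int' hr (T.L'.sub_mem hx hr)
  rw [term, h1, T.phi_add hl (T.L'.sub_mem hx hr), h2, T.phi_add hl hx, ← phase_add, ← mul_assoc,
    ← phase_add]
  congr 1
  apply phase_eq_of_sub (-n)
  have h3 := D.form_comm r l
  push_cast
  rw [← hn]
  simp only [map_sub, map_add] at *
  linarith

lemma summable_gauss_N : Summable fun n : T.N => D.gauss n := by
  have := D.summable_gauss T.odd.pos.ne' (fun h hh => T.smul_N_mem hh) 0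
  simpa only [zero_add] using this

lemma L'_le_N : T.L' ≤ T.N := le_sup_right

/-- After translating each sum by `T.rep g`, orthogonality leaves only `n ∈ ν⁻¹ L`, where `phi = 1`.
Multiplication by `ν` is an isometry from `ν⁻¹ L` to `L`. -/
lemma sum_tsum_term_rep [Fintype T.G] :
    ∑ g, ∑' n : T.N, T.term (T.rep g) n = Nat.card T.G * ∑' l : D.L, (D.gauss l : ℂ) := by
  classical
  choose l hl x hx hlx using fun n : T.N => T.mem_N.1 n.2
  have h1 : ∀ g, ∑' n : T.N, T.term (T.rep g) n =
      ∑' n : T.N, phase (2 * D.form (l n) (T.rep g)) * (T.phi n * D.gauss n) := by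
    intro g
    have hr := T.L'_le_N (T.rep_mem g)
    rw [← (Equiv.subRight (⟨_, hr⟩ : T.N)).tsum_eq (fun n : T.N => T.term (T.rep g) n)]
    refine tsum_congr fun n => ?_
    rw [Equiv.subRight_apply, AddSubgroup.coe_sub, ← hlx n]
    exact T.term_translate (T.rep_mem g) (hl n) (hx n)
  have hsum : ∀ g ∈ (Finset.univ : Finset T.G),
      Summable fun n : T.N => phase (2 * D.form (l n) (T.rep g)) * (T.phi n * D.gauss n) := by
    intro g _
    refine Summable.of_norm ?_
    refine T.summable_gauss_N.congr fun n => ?_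
    rw [norm_mul, norm_phase, norm_mul, T.norm_phi n.2, Complex.norm_real, one_mul, one_mul,
      Real.norm_of_nonneg (D.gauss_pos _).le]
  have h2 : ∀ n : T.N, ∑ g, phase (2 * D.form (l n) (T.rep g)) * (T.phi n * D.gauss n) =
      Nat.card T.G * (T.L' : Set K).indicator (fun y => (D.gauss y : ℂ)) n := by
    intro n
    rw [← Finset.sum_mul, T.sum_phase_rep (hl n)]
    by_cases h : (n : K) ∈ T.L'
    · have h3 : l n ∈ T.L' := by
        have : l n = n - x n := by rw [← hlx]; ring
        rw [this]
        exact T.L'.sub_mem h (hx n)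
      have h4 : T.phi n = 1 := by
        have := T.phi_add D.L.zero_mem h
        simpa [phase_zero] using this
      rw [if_pos h3, Set.indicator_of_mem h, h4, one_mul]
    · have h3 : l n ∉ T.L' := by
        intro h3
        refine h ?_
        rw [← hlx]
        exact T.L'.add_mem h3 (hx n)
      rw [if_neg h3, Set.indicator_of_notMem h, zero_mul, mul_zero]
  rw [Finset.sum_congr rfl fun g _ => h1 g, ← Summable.tsum_finsetSum hsum, tsum_congr h2,
    tsum_mul_left]
  congr 1
  have h5 := tsum_subtype (T.N : Set K) ((T.L' : Set K).indicator (fun y => (D.gauss y : ℂ)))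
  rw [Set.indicator_indicator, Set.inter_eq_right.2 (fun y hy => T.L'_le_N hy),
    ← tsum_subtype] at h5
  refine h5.trans ?_
  let E : T.L' ≃ D.L :=
    { toFun := fun y => ⟨T.ν * y, y.2⟩
      invFun := fun y => ⟨T.ν' * y, T.inv_mul_mem y.2⟩
      left_inv := fun y => Subtype.ext (T.inv_mul_cancel _)
      right_inv := fun y => Subtype.ext (T.mul_inv_cancel _) }
  rw [← E.tsum_eq (fun l : D.L => (D.gauss l : ℂ))]
  refine tsum_congr fun y => ?_
  change _ = (D.gauss (T.ν * y) : ℂ)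
  rw [D.gauss_mul T.norm_emb]

/-- The modulus of the multiplier of the theta transformation formula. -/
lemma mul_conj_eq [Fintype T.G] {lam : ℂ}
    (h : ∀ c, ∑' n : T.N, T.term c n = lam * ∑' v : D.L, term₀ D c v) :
    lam * conj lam = Nat.card T.G := by
  have h1 := T.sum_tsum_term_rep
  have hθ : ∀ v : D.L, term₀ D 0 v = (D.gauss v : ℂ) := by
    intro v
    rw [term₀, map_zero, LinearMap.zero_apply, neg_zero, phase_zero, one_mul, zero_add]
  have h0 := h 0
  rw [tsum_congr hθ] at h0
  rw [T.tsum_N (T.summable_term le_rfl 0)] at h0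
  -- The sum over `L` at `c = T.rep g` is the conjugate of the part of the sum over `N` at `c = 0`
  -- in the coset of `T.rep g`. So the formula gets used a second time, conjugated.
  have hc : ∀ g, ∑' v : D.L, term₀ D (T.rep g) v = conj (∑' l : D.L, T.term 0 (l + T.rep g)) := by
    intro g
    rw [Complex.conj_tsum]
    refine tsum_congr fun l => ?_
    rw [term, term₀, T.phi_add l.2 (T.rep_mem g), map_mul, map_mul, conj_phase, conj_phase,
      Complex.conj_ofReal, zero_add, map_zero, LinearMap.zero_apply, neg_neg, neg_zero, neg_zero,
      phase_zero, mul_one, D.form_comm l, add_comm (l : K)]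
  rw [Finset.sum_congr rfl fun g _ => h (T.rep g), ← Finset.mul_sum,
    Finset.sum_congr rfl fun g _ => hc g, ← map_sum, h0, map_mul, Complex.conj_tsum] at h1
  simp only [Complex.conj_ofReal] at h1
  have hpos : (∑' l : D.L, (D.gauss l : ℂ)) ≠ 0 := by
    rw [← Complex.ofReal_tsum]
    have hs : Summable fun l : D.L => D.gauss l := by
      have := D.summable_gauss one_ne_zero (H := D.L) (fun h hh => by rwa [one_smul]) 0
      simpa only [zero_add] using this
    exact Complex.ofReal_ne_zero.2 (hs.tsum_pos (fun _ => (D.gauss_pos _).le) 0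
      (D.gauss_pos _)).ne'
  apply mul_right_cancel₀ hpos
  rw [← h1, mul_assoc]

end ThetaElement

end CMCritical

/-! ### Theta functions with characteristic -/

open scoped BigOperators ComplexConjugate

namespace CMCritical

namespace PolarizedLattice

variable {K Φ : Type*} [CommRing K] [Algebra ℚ K] [Fintype Φ] (D : PolarizedLattice K Φ)

/-- A theta characteristic: a quadratic refinement `L → {±1}` of the symplectic form modulo
two. -/
structure IsCharacteristic (q : K → ℂ) : Prop where
  sq_eq_one : ∀ x ∈ D.L, q x ^ 2 = 1
  add : ∀ x ∈ D.L, ∀ y ∈ D.L, q (x + y) = q x * q y * phase (D.form x y / 2)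

/-- The Gaussian `exp (-π |x|² / 2)`. -/
noncomputable def halfGauss (x : K) : ℝ := Real.exp (-(Real.pi / 2 * D.norm2 x))

lemma halfGauss_pos (x : K) : 0 < D.halfGauss x := Real.exp_pos _

lemma halfGauss_mul (x y : K) :
    D.halfGauss (x + y) * D.halfGauss (x - y) = D.gauss x * D.gauss y := by
  rw [halfGauss, halfGauss, gauss, gauss, ← Real.exp_add, ← Real.exp_add]
  congr 1
  linear_combination -(Real.pi / 2) * D.norm2_parallelogram x y

/-- The theta function of a characteristic. -/
noncomputable def theta (q : K → ℂ) (x : K) : ℂ :=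
  ∑' l : D.L, q l * phase (-D.form l x / 2) * D.halfGauss (x + l)

variable {D} {q : K → ℂ}

namespace IsCharacteristic

lemma norm_eq_one (hq : D.IsCharacteristic q) {x : K} (hx : x ∈ D.L) : ‖q x‖ = 1 := by
  have := congrArg norm (hq.sq_eq_one x hx)
  rw [norm_pow, norm_one] at this
  exact (pow_eq_one_iff_of_nonneg (norm_nonneg _) two_ne_zero).1 this

lemma double (hq : D.IsCharacteristic q) {x : K} (hx : x ∈ D.L) : q (x + x) = 1 := by
  rw [hq.add x hx x hx, D.form_self, zero_div, phase_zero, mul_one, ← sq, hq.sq_eq_one x hx]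

lemma map_zero (hq : D.IsCharacteristic q) : q 0 = 1 := by
  simpa using hq.double D.L.zero_mem

lemma summable (hq : D.IsCharacteristic q) (x : K) :
    Summable fun l : D.L => ‖q l * phase (-D.form l x / 2) * D.halfGauss (x + l)‖ := by
  refine (D.summable_exp_norm2 (half_pos Real.pi_pos) one_ne_zero (H := D.L)
    (fun h hh => by rwa [one_smul]) x).congr fun l => ?_
  rw [norm_mul, norm_mul, norm_phase, hq.norm_eq_one l.2, Complex.norm_real,
    Real.norm_of_nonneg (D.halfGauss_pos _).le, one_mul, one_mul, halfGauss]

lemma theta_add (hq : D.IsCharacteristic q) (x : K) {m : K} (hm : m ∈ D.L) :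
    D.theta q (x + m) = q m * phase (D.form m x / 2) * D.theta q x := by
  rw [theta, theta, ← (Equiv.subRight (⟨m, hm⟩ : D.L)).tsum_eq, ← tsum_mul_left]
  refine tsum_congr fun l => ?_
  rw [Equiv.subRight_apply, AddSubgroup.coe_sub]
  have h1 : q l = q (l - m) * q m * phase (D.form l m / 2) := by
    have := hq.add (l - m) (D.L.sub_mem l.2 hm) m hm
    rwa [sub_add_cancel, map_sub, LinearMap.sub_apply, D.form_self, sub_zero] at this
  have h2 := hq.sq_eq_one m hm
  have h3 : x + m + ((l : K) - m) = x + l := by ring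
  obtain ⟨n, hn⟩ := D.form_int l.2 hm
  have h4 : phase (-D.form (l - m) (x + m) / 2) =
      phase (D.form l m / 2) * (phase (D.form m x / 2) * phase (-D.form l x / 2)) := by
    rw [← phase_add, ← phase_add]
    apply phase_eq_of_sub (-n)
    have := D.form_self m
    simp only [map_sub, map_add, LinearMap.sub_apply]
    push_cast
    linarith
  rw [h3, h1, h4]
  simp only
  linear_combination -q (l - m) * phase (D.form l m / 2) * (phase (D.form m x / 2) *
    phase (-D.form l x / 2)) * D.halfGauss (x + l) * h2

/-- The factor in the product formula for theta functions. -/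
noncomputable def _root_.CMCritical.PolarizedLattice.productFactor (D : PolarizedLattice K Φ)
    (q : K → ℂ) (k s : K) : ℂ :=
  q s * phase (D.form (-((2⁻¹ : ℚ) • s)) k) * D.gauss (k + (2⁻¹ : ℚ) • s)

/-- For a fixed sum `s` of the two summation variables, the arguments `k + x + l` and `k - x + (s -
l)` have half sum `k + s / 2` and half difference `-s / 2 + l + x`. The parallelogram law then
separates `k` from `x`. -/
lemma product_term (hq : D.IsCharacteristic q) (k x : K) {s l : K} (hs : s ∈ D.L) (hl : l ∈ D.L) :
    q l * phase (-D.form l (k + x) / 2) * D.halfGauss (k + x + l) *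
      (q (s - l) * phase (-D.form (s - l) (k - x) / 2) * D.halfGauss (k - x + (s - l))) =
    D.productFactor q k s * (phase (-D.form l x) *
      phase (-D.form (-((2⁻¹ : ℚ) • s)) (l + x)) * D.gauss (-((2⁻¹ : ℚ) • s) + (l + x))) := by
  have h2 : s = (2⁻¹ : ℚ) • s + (2⁻¹ : ℚ) • s := by
    rw [← add_smul]
    norm_num
  set c := (2⁻¹ : ℚ) • s with hc
  have hg := D.halfGauss_mul (k + c) (-c + (l + x))
  have e1 : k + c + (-c + (l + x)) = k + x + l := by ring
  have e2 : k + c - (-c + (l + x)) = k - x + (s - l) := by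
    conv_rhs => rw [h2]
    ring
  rw [e1, e2] at hg
  have hg' : (D.halfGauss (k + x + l) : ℂ) * D.halfGauss (k - x + (s - l)) =
      D.gauss (k + c) * D.gauss (-c + (l + x)) := by exact_mod_cast hg
  have h1 := hq.add l hl (s - l) (D.L.sub_mem hs hl)
  rw [add_sub_cancel, map_sub, D.form_self, sub_zero] at h1
  have h3 : phase (-D.form l (k + x) / 2) * phase (-D.form (s - l) (k - x) / 2) =
      phase (D.form l s / 2) * phase (D.form (-c) k) * (phase (-D.form l x) *
        phase (-D.form (-c) (l + x))) := by
    simp only [← phase_add]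
    congr 1
    have h4 := D.form_comm l c
    rw [h2]
    simp only [map_sub, map_add, LinearMap.sub_apply, LinearMap.add_apply, map_neg,
      LinearMap.neg_apply]
    linarith
  rw [productFactor, h1]
  linear_combination q l * q (s - l) * (phase (D.form l s / 2) * phase (D.form (-c) k) *
    (phase (-D.form l x) * phase (-D.form (-c) (l + x)))) * hg' +
    q l * q (s - l) * D.halfGauss (k + x + l) * D.halfGauss (k - x + (s - l)) * h3

/-- The product formula for theta functions. -/
lemma theta_mul_theta (hq : D.IsCharacteristic q) (k x : K) :
    HasSum (fun s : D.L => D.productFactor q k s * ∑' l : D.L, phase (-D.form l x) *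
      phase (-D.form (-((2⁻¹ : ℚ) • (s : K))) (l + x)) *
        D.gauss (-((2⁻¹ : ℚ) • (s : K)) + (l + x)))
      (D.theta q (k + x) * D.theta q (k - x)) := by
  have h1 := summable_mul_of_summable_norm (hq.summable (k + x)) (hq.summable (k - x))
  let E : D.L × D.L ≃ D.L × D.L :=
    { toFun := fun p => (p.2, p.1 - p.2)
      invFun := fun p => (p.1 + p.2, p.1)
      left_inv := fun p => Prod.ext (by simp) (by simp)
      right_inv := fun p => Prod.ext (by simp) (by simp) }
  rw [theta, theta, tsum_mul_tsum_of_summable_norm (hq.summable _) (hq.summable _),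
    ← E.tsum_eq]
  have h2 := (E.summable_iff).2 h1
  have h3 : ∀ s : D.L, (D.productFactor q k s * ∑' l : D.L, phase (-D.form l x) *
      phase (-D.form (-((2⁻¹ : ℚ) • (s : K))) (l + x)) *
        D.gauss (-((2⁻¹ : ℚ) • (s : K)) + (l + x))) = ∑' l : D.L,
      q l * phase (-D.form l (k + x) / 2) * D.halfGauss (k + x + l) *
      (q (s - l) * phase (-D.form (s - l) (k - x) / 2) * D.halfGauss (k - x + (s - l))) := by
    intro s
    rw [← tsum_mul_left]
    exact tsum_congr fun l => (hq.product_term k x s.2 l.2).symm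
  have h5 := h2.prod.hasSum
  rw [← h2.tsum_prod] at h5
  simp only [h3]
  exact h5

end IsCharacteristic

end PolarizedLattice

end CMCritical

/-! ### A characteristic with nonzero theta constant -/

open scoped BigOperators ComplexConjugate

namespace CMCritical

lemma phase_half_int (n : ℤ) : phase (n / 2) = 1 ∨ phase (n / 2) = -1 := by
  have h : phase (n / 2) ^ 2 = 1 := by
    rw [sq, ← phase_add, add_halves, phase_int]
  exact mul_self_eq_one_iff.1 ((sq _).symm.trans h)

namespace PolarizedLattice

variable {K Φ : Type*} [CommRing K] [Algebra ℚ K] [Fintype Φ] (D : PolarizedLattice K Φ)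

/-- Coordinates of the lattice in an integral basis. -/
lemma exists_coords : ∃ (n : ℕ) (co : D.L →+ (Fin n → ℤ)) (e : Fin n → D.L),
    Function.Injective co ∧ ∀ x : D.L, (x : K) = ∑ i, co x i • (e i : K) := by
  obtain ⟨n, e, f, hef, he, -⟩ := D.exists_dual_bases (ε := 1) (one_mul 1)
  have heL : ∀ m, intComb e m ∈ D.L := by
    intro m
    obtain ⟨y, hy, hy2⟩ := (he _).2 ⟨m, rfl⟩
    rw [← hy2, AddMonoidHom.coe_mulLeft, one_mul]
    exact hy
  choose co hco using fun x : D.L => (he x).1 ⟨x, x.2, one_mul _⟩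
  have hf : ∀ (x : D.L) j, D.form (f j) x = co x j := fun x j => by rw [hco, form_intComb hef]
  refine ⟨n, AddMonoidHom.mk' co fun x y => ?_, fun i => ⟨e i, ?_⟩, fun x y h => ?_, hco⟩
  · funext j
    have := hf (x + y) j
    rw [AddSubgroup.coe_add, map_add, hf, hf] at this
    exact_mod_cast this.symm
  · have h := heL (Pi.single i 1)
    rwa [show intComb e (Pi.single i 1) = e i by
      rw [intComb, Finset.sum_eq_single i] <;> simp +contextual] at h
  · have h' : co x = co y := h
    exact Subtype.ext (by rw [hco x, hco y, h'])

/-- An integral bilinear form whose antisymmetrization is the symplectic form. -/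
lemma exists_half_form : ∃ A : D.L →+ D.L →+ ℤ, ∀ x y : D.L,
    D.form x y = ((A x y - A y x : ℤ) : ℚ) := by
  obtain ⟨n, co, e, -, hco⟩ := D.exists_coords
  choose w hw using fun i j : Fin n => D.form_int (e i).2 (e j).2
  let A : D.L →+ D.L →+ ℤ := AddMonoidHom.mk' (fun x => AddMonoidHom.mk'
      (fun y => ∑ i, ∑ j, if i < j then w i j * co x i * co y j else 0) (fun y z => by
        simp only [map_add, Pi.add_apply, ← Finset.sum_add_distrib]
        refine Finset.sum_congr rfl fun i _ => Finset.sum_congr rfl fun j _ => ?_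
        split_ifs <;> ring)) (fun x z => by
      ext y
      simp only [map_add, Pi.add_apply, AddMonoidHom.mk'_apply, AddMonoidHom.add_apply,
        ← Finset.sum_add_distrib]
      refine Finset.sum_congr rfl fun i _ => Finset.sum_congr rfl fun j _ => ?_
      split_ifs <;> ring)
  refine ⟨A, fun x y => ?_⟩
  have h1 : D.form x y = ∑ i, ∑ j, (w i j : ℚ) * co x i * co y j := by
    rw [hco x, hco y, map_sum D.form, LinearMap.sum_apply]
    refine Finset.sum_congr rfl fun i _ => ?_
    rw [map_sum]
    refine Finset.sum_congr rfl fun j _ => ?_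
    rw [map_zsmul, map_zsmul, LinearMap.smul_apply, hw]
    simp only [zsmul_eq_mul]
    ring
  have h2 : A y x = ∑ i, ∑ j, if j < i then w j i * co x i * co y j else 0 := by
    change ∑ i, ∑ j, (if i < j then w i j * co y i * co x j else 0) = _
    rw [Finset.sum_comm]
    refine Finset.sum_congr rfl fun i _ => Finset.sum_congr rfl fun j _ => ?_
    split_ifs <;> ring
  have h3 : A x y = ∑ i, ∑ j, if i < j then w i j * co x i * co y j else 0 := rfl
  rw [h1, h2, h3]
  push_cast
  rw [← Finset.sum_sub_distrib]
  refine Finset.sum_congr rfl fun i _ => ?_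
  rw [← Finset.sum_sub_distrib]
  refine Finset.sum_congr rfl fun j _ => ?_
  rcases lt_trichotomy i j with h | h | h
  · rw [if_pos h, if_neg h.not_gt, sub_zero]
  · subst h
    have h4 : (w i i : ℚ) = 0 := by rw [← hw, D.form_self]
    simp [h4]
  · have h4 : (w i j : ℚ) = -w j i := by rw [← hw, ← hw, D.form_comm]
    rw [if_neg h.not_gt, if_pos h, h4]
    ring

/-- There is a theta characteristic with nonvanishing theta constant. -/
lemma exists_isCharacteristic : ∃ q : K → ℂ, D.IsCharacteristic q ∧ D.theta q 0 ≠ 0 := by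
  classical
  obtain ⟨n, co, e, hinj, hco⟩ := D.exists_coords
  obtain ⟨A, hA⟩ := D.exists_half_form
  -- The sign of `A x x` is a quadratic refinement of `ω` modulo two; `s` twists it by the
  -- characters of `L / 2 L`.
  let q : (Fin n → Fin 2) → D.L → ℂ := fun s x =>
    phase ((A x x + ∑ i, (s i : ℤ) * co x i : ℤ) / 2)
  let Q : (Fin n → Fin 2) → K → ℂ := fun s x => if h : x ∈ D.L then q s ⟨x, h⟩ else 0
  have hQ : ∀ s (x : D.L), Q s x = q s x := fun s x => dif_pos x.2
  have hchar : ∀ s, D.IsCharacteristic (Q s) := by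
    refine fun s => ⟨fun x hx => ?_, fun x hx y hy => ?_⟩
    · rw [hQ s ⟨x, hx⟩]
      rcases phase_half_int (A ⟨x, hx⟩ ⟨x, hx⟩ + ∑ i, (s i : ℤ) * co ⟨x, hx⟩ i) with h | h
      · exact (congrArg (· ^ 2) h).trans (by norm_num)
      · exact (congrArg (· ^ 2) h).trans (by norm_num)
    · set x' : D.L := ⟨x, hx⟩
      set y' : D.L := ⟨y, hy⟩
      have h1 : x + y = (x' + y' : D.L) := rfl
      rw [h1, hQ, show x = x' from rfl, show y = y' from rfl, hQ, hQ, hA]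
      simp only [q, ← phase_add]
      apply phase_eq_of_sub (A y' x')
      simp only [map_add, AddMonoidHom.add_apply, Pi.add_apply, mul_add, Finset.sum_add_distrib]
      push_cast
      ring
  suffices h : ∃ s, D.theta (Q s) 0 ≠ 0 by
    obtain ⟨s, hs⟩ := h
    exact ⟨Q s, hchar s, hs⟩
  by_contra hall
  push Not at hall
  have h1 : ∀ s, HasSum (fun l : D.L => q s l * D.halfGauss l) 0 := by
    intro s
    have h2 := ((hchar s).summable 0).of_norm.hasSum
    rw [← theta, hall s] at h2
    have h3 : ∀ l : D.L, Q s l * phase (-D.form l 0 / 2) * D.halfGauss (0 + l) =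
        q s l * D.halfGauss l := by
      intro l
      rw [hQ, map_zero, neg_zero, zero_div, phase_zero, mul_one, zero_add]
    simpa only [h3] using h2
  -- Adding all the theta constants, orthogonality leaves only `l ∈ 2 L`, where the sign is `1`. A
  -- sum of positive terms cannot vanish.
  have h2 := hasSum_sum (s := Finset.univ) fun s _ => h1 s
  rw [Finset.sum_const_zero] at h2
  let r : D.L → ℝ := fun l => if ∀ i, Even (co l i) then 2 ^ n else 0
  have h3 : ∀ l : D.L, ∑ s, q s l * D.halfGauss l = ((r l * D.halfGauss l : ℝ) : ℂ) := by
    intro l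
    rw [← Finset.sum_mul]
    push_cast
    congr 1
    have h4 : ∀ s, q s l = phase (A l l / 2) * ∏ i, phase ((s i : ℤ) * co l i / 2) := by
      intro s
      simp only [q]
      have h5 : ∀ t : Finset (Fin n), ∏ i ∈ t, phase ((s i : ℤ) * co l i / 2) =
          phase (∑ i ∈ t, (s i : ℤ) * co l i / 2) := by
        intro t
        induction t using Finset.induction_on with
        | empty => simp [phase_zero]
        | insert a t ha ih => rw [Finset.prod_insert ha, Finset.sum_insert ha, phase_add, ih]
      rw [h5, ← phase_add]
      congr 1
      push_cast
      rw [add_div, Finset.sum_div]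
    simp only [h4]
    rw [← Finset.mul_sum]
    have h6 := Finset.prod_univ_sum (fun _ : Fin n => (Finset.univ : Finset (Fin 2)))
      (fun i j => phase ((((j : ℕ) : ℤ) : ℚ) * co l i / 2))
    rw [Fintype.piFinset_univ] at h6
    rw [← h6]
    simp only [r]
    split_ifs with hev
    · have h7 : ∀ i, ∑ j : Fin 2, phase ((((j : ℕ) : ℤ) : ℚ) * co l i / 2) = 2 := by
        intro i
        obtain ⟨a, ha⟩ := hev i
        rw [Fin.sum_univ_two, ha]
        have h8 : phase (((((1 : Fin 2) : ℕ) : ℤ) : ℚ) * ((a + a : ℤ) : ℚ) / 2) = 1 := by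
          rw [phase_eq_one_iff]
          exact ⟨a, by push_cast; simp⟩
        rw [h8]
        simp [phase_zero]
        norm_num
      simp only [h7]
      choose a ha using hev
      obtain ⟨x, hx⟩ : ∃ x : D.L, l = x + x := by
        refine ⟨∑ i, a i • e i, Subtype.ext ?_⟩
        rw [hco l, AddSubgroup.coe_add]
        push_cast
        rw [← Finset.sum_add_distrib]
        refine Finset.sum_congr rfl fun i _ => ?_
        rw [ha, add_smul]
      have h9 : phase (A l l / 2) = 1 := by
        rw [phase_eq_one_iff, hx]
        refine ⟨2 * A x x, ?_⟩
        simp only [map_add, AddMonoidHom.add_apply]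
        push_cast
        ring
      rw [h9]
      simp
    · push Not at hev
      obtain ⟨i, hi⟩ := hev
      rw [Int.not_even_iff_odd] at hi
      obtain ⟨a, ha⟩ := hi
      rw [Finset.prod_eq_zero (Finset.mem_univ i)]
      · simp
      · rw [Fin.sum_univ_two, ha]
        have h8 : phase (((((1 : Fin 2) : ℕ) : ℤ) : ℚ) * ((2 * a + 1 : ℤ) : ℚ) / 2) =
            phase (1 / 2) := by
          apply phase_eq_of_sub a
          push_cast
          simp
          ring
        have h10 : phase (1 / 2) = -1 := by
          rw [phase]
          push_cast
          rw [show (2 * Real.pi * Complex.I * (1 / 2) : ℂ) = Real.pi * Complex.I by ring,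
            Complex.exp_pi_mul_I]
        rw [h8, h10]
        simp [phase_zero]
  simp only [h3] at h2
  have h4 : HasSum (fun l : D.L => r l * D.halfGauss l) 0 := by
    rw [← Complex.ofReal_zero] at h2
    exact Complex.hasSum_ofReal.1 h2
  have h5 := (hasSum_zero_iff_of_nonneg (fun l => by
    have := D.halfGauss_pos l
    simp only [r]
    split_ifs <;> positivity)).1 h4
  have h6 := congrFun h5 0
  have h7 := D.halfGauss_pos 0
  simp only [r, Pi.zero_apply, map_zero, AddSubgroup.coe_zero] at h6
  rw [if_pos (by simp)] at h6
  exact absurd h6 (by positivity)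

end PolarizedLattice

end CMCritical

/-! ### The critical function and its critical value -/

open scoped BigOperators ComplexConjugate

namespace CMCritical

namespace ThetaElement

variable {K Φ : Type*} [CommRing K] [Algebra ℚ K] [Fintype Φ] {D : PolarizedLattice K Φ}
  (T : ThetaElement D) {q : K → ℂ}

lemma char_ν (hq : D.IsCharacteristic q) {x : K} (hx : x ∈ D.L) (hνx : T.ν * x ∈ D.L) :
    q (T.ν * x) = q x := by
  obtain ⟨y, hy, h⟩ := T.half x hx hνx
  obtain ⟨n, hn⟩ := D.form_int hx hy
  have h1 : T.ν * x = x + (y + y) := by rw [← h]; ring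
  rw [h1, hq.add x hx _ (D.L.add_mem hy hy), hq.double hy, map_add, hn, ← two_mul,
    mul_div_cancel_left₀ _ two_ne_zero, phase_int, mul_one, mul_one]

/-- The critical function, as a function on the lattice. -/
noncomputable def preCritical (D : PolarizedLattice K Φ) (T : ThetaElement D) (q : K → ℂ) (k : K) :
    ℂ := q k * D.theta q (T.ν' * k)

/-- The half condition gives `q (ν m) = q m`, and this sign and its phase cancel the
quasi-periodicity factor of `θ`. So the function descends to `L / (L ∩ ν L)`. -/
lemma preCritical_add (hq : D.IsCharacteristic q) {b m : K} (hb : b ∈ D.L) (hm : m ∈ D.L)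
    (hνm : T.ν * m ∈ D.L) : preCritical D T q (b + T.ν * m) = preCritical D T q b := by
  have h1 := hq.sq_eq_one m hm
  have h2 : phase (D.form b (T.ν * m) / 2) * phase (D.form m (T.ν' * b) / 2) = 1 := by
    rw [← phase_add, ← T.form_ν, D.form_comm b, neg_div, neg_add_cancel, phase_zero]
  rw [preCritical, preCritical, hq.add b hb _ hνm, T.char_ν hq hm hνm, mul_add, T.inv_mul_cancel,
    hq.theta_add _ hm]
  linear_combination q b * D.theta q (T.ν' * b) * (phase (D.form b (T.ν * m) / 2) *
    phase (D.form m (T.ν' * b) / 2) * h1 + h2)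

/-- The critical function. -/
noncomputable def critical (q : K → ℂ) (g : T.G) : ℂ := preCritical D T q (g.out : D.L)

lemma critical_mk (hq : D.IsCharacteristic q) (a : D.L) :
    T.critical q a = preCritical D T q a := by
  have h : ((a : T.G).out : T.G) = a := (a : T.G).out_eq
  have h1 := T.mk_eq_iff.1 h
  have h2 : (((a : T.G).out : D.L) : K) = a + T.ν * (T.ν' * (((a : T.G).out : D.L) - a)) := by
    rw [T.mul_inv_cancel]
    ring
  rw [critical, h2]
  refine T.preCritical_add hq a.2 h1 ?_
  rw [T.mul_inv_cancel]
  exact D.L.sub_mem (SetLike.coe_mem _) a.2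

lemma preCritical_mul (hq : D.IsCharacteristic q) {a h : K} (ha : a ∈ D.L) (hh : h ∈ D.L) :
    preCritical D T q (a + h) * preCritical D T q (a - h) =
      D.theta q (T.ν' * a + T.ν' * h) * D.theta q (T.ν' * a - T.ν' * h) := by
  have h1 : q (a + h) * q (a - h) = 1 := by
    have h2 := hq.add _ (D.L.add_mem ha hh) _ (D.L.sub_mem ha hh)
    obtain ⟨n, hn⟩ := D.form_int ha hh
    have h3 : phase (D.form (a + h) (a - h) / 2) = 1 := by
      rw [phase_eq_one_iff]
      refine ⟨-n, ?_⟩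
      have h4 := D.form_comm h a
      have h5 := D.form_self a
      have h6 := D.form_self h
      push_cast
      rw [← hn]
      simp only [map_sub, map_add, LinearMap.add_apply]
      linarith
    rw [h3, show a + h + (a - h) = a + a by ring, hq.double ha, mul_one] at h2
    exact h2.symm
  rw [preCritical, preCritical, mul_add, mul_sub]
  linear_combination D.theta q (T.ν' * a + T.ν' * h) * D.theta q (T.ν' * a - T.ν' * h) * h1

/-- Expand both sides by the product formula. For each `s`, the sum over `g` of the inner sums is
the sum over `N` at `c = -s / 2`; its multiplier `lam` does not depend on `c` and factors out. -/
lemma sum_theta_mul_theta [Fintype T.G] (hq : D.IsCharacteristic q) {lam : ℂ}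
    (h : ∀ c, ∑' n : T.N, T.term c n = lam * ∑' v : D.L, term₀ D c v) (k : K) :
    ∑ g, D.theta q (k + T.rep g) * D.theta q (k - T.rep g) = lam * D.theta q k ^ 2 := by
  have h1 := hasSum_sum (s := Finset.univ) fun g _ => hq.theta_mul_theta k (T.rep g)
  have h2 := (hq.theta_mul_theta k 0).mul_left lam
  rw [add_zero, sub_zero, ← sq] at h2
  refine h1.unique (Eq.subst (motive := fun F => HasSum F _ _) (funext fun s => ?_) h2)
  set c := -((2⁻¹ : ℚ) • (s : K))
  have h3 : ∀ g, ∑' l : D.L, phase (-D.form l (T.rep g)) * phase (-D.form c (l + T.rep g)) *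
      D.gauss (c + (l + T.rep g)) = ∑' l : D.L, T.term c (l + T.rep g) := by
    intro g
    refine tsum_congr fun l => ?_
    rw [term, T.phi_add l.2 (T.rep_mem g)]
  have h4 : ∑' l : D.L, phase (-D.form l 0) * phase (-D.form c (l + 0)) *
      D.gauss (c + (l + 0)) = ∑' l : D.L, term₀ D c l := by
    refine tsum_congr fun l => ?_
    rw [term₀, map_zero, neg_zero, phase_zero, one_mul, add_zero]
  rw [← Finset.mul_sum, Finset.sum_congr rfl fun g _ => h3 g, h4,
    ← T.tsum_N (T.summable_term le_rfl c), h]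
  ring

/-- The theta transformation formula yields critical values. -/
theorem exists_critical [Fintype T.G] : ∃ lam : ℂ, lam * conj lam = Nat.card T.G ∧
    (∃ t : ℝ, 0 ≤ t ∧ lam ^ 4 = t * (∏ ρ : T.Φ₁, (1 - D.emb ρ T.ν)⁻¹) ^ 4) ∧
    ∃ f : T.G → ℂ, f ≠ 0 ∧ ∀ k, ∑ l, f (k + l) * f (k - l) = lam * f k ^ 2 := by
  obtain ⟨lam, h4, h⟩ := T.exists_tsum_term
  obtain ⟨q, hq, hq0⟩ := D.exists_isCharacteristic
  refine ⟨lam, T.mul_conj_eq h, h4, T.critical q, fun h0 => hq0 ?_, fun k => ?_⟩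
  · have h1 := T.critical_mk hq 0
    rw [h0, AddSubgroup.coe_zero, preCritical, hq.map_zero, mul_zero, one_mul] at h1
    exact h1.symm
  · obtain ⟨a, rfl⟩ := QuotientAddGroup.mk_surjective k
    have h1 : ∀ g : T.G, T.critical q (a + g) * T.critical q (a - g) =
        D.theta q (T.ν' * a + T.rep g) * D.theta q (T.ν' * a - T.rep g) := by
      intro g
      have hg : (g.out : T.G) = g := g.out_eq
      rw [rep, ← T.preCritical_mul hq a.2 g.out.2, ← AddSubgroup.coe_add, ← AddSubgroup.coe_sub,
        ← T.critical_mk hq, ← T.critical_mk hq, QuotientAddGroup.mk_add, QuotientAddGroup.mk_sub,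
        hg]
    rw [Finset.sum_congr rfl fun g _ => h1 g, T.sum_theta_mul_theta hq h, T.critical_mk hq,
      preCritical, mul_pow, hq.sq_eq_one _ a.2, one_mul]

/-- From `1 - u = -u * (1 - conj u)` one gets `(1 - u) ^ 2 = -u * |1 - u| ^ 2`. -/
lemma inv_one_sub_pow_four {u : ℂ} (h1 : ‖u‖ = 1) (h2 : u ≠ 1) :
    ((1 - u)⁻¹) ^ 4 * u ^ 2 = (((‖1 - u‖ ^ 4)⁻¹ : ℝ) : ℂ) := by
  have h3 : u * conj u = 1 := by
    rw [Complex.mul_conj, Complex.normSq_eq_norm_sq, h1]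
    norm_num
  have h4 : 1 - u ≠ 0 := sub_ne_zero.2 (Ne.symm h2)
  have h5 : ((‖1 - u‖ : ℝ) : ℂ) ^ 2 = (1 - u) * (1 - conj u) := by
    rw [← Complex.ofReal_pow, ← Complex.normSq_eq_norm_sq, ← Complex.mul_conj, map_sub, map_one]
  have h7 : 1 - conj u ≠ 0 := by
    rw [← map_one (starRingEnd ℂ), ← map_sub]
    exact (map_ne_zero _).2 h4
  have h6 : ((‖1 - u‖ : ℝ) : ℂ) ^ 4 = ((1 - u) * (1 - conj u)) ^ 2 := by
    rw [← h5]
    ring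
  push_cast
  rw [h6]
  field_simp
  linear_combination (u * conj u + 1 - 2 * u) * h3

/-- The critical value attached to a unitary element of the theta group. -/
theorem exists_critical_pow_four [Fintype T.G] : ∃ lam : ℂ,
    lam ^ 4 = Nat.card T.G ^ 2 * (∏ ρ, D.emb ρ T.ν) ^ 2 ∧
    ∃ f : T.G → ℂ, f ≠ 0 ∧ ∀ k, ∑ l, f (k + l) * f (k - l) = lam * f k ^ 2 := by
  obtain ⟨lam, hd, ⟨t, ht, h4⟩, f, hf, hcrit⟩ := T.exists_critical
  set P := ∏ ρ, D.emb ρ T.ν with hP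
  have hP1 : P * conj P = 1 := by
    rw [hP, map_prod, ← Finset.prod_mul_distrib]
    refine Finset.prod_eq_one fun ρ _ => ?_
    rw [Complex.mul_conj, Complex.normSq_eq_norm_sq, T.norm_emb]
    norm_num
  have hPΦ : P = ∏ ρ : T.Φ₁, D.emb ρ T.ν := by
    classical
    rw [hP, ← Finset.prod_subset (Finset.subset_univ (Finset.univ.filter
      fun ρ => D.emb ρ T.ν ≠ 1)) fun ρ _ hρ => by simpa using hρ]
    exact Finset.prod_subtype _ (by simp) _
  obtain ⟨r, hr, hr4⟩ : ∃ r : ℝ, 0 ≤ r ∧ lam ^ 4 * P ^ 2 = r := by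
    refine ⟨t * ∏ ρ : T.Φ₁, (‖1 - D.emb ρ T.ν‖ ^ 4)⁻¹, mul_nonneg ht
      (Finset.prod_nonneg fun ρ _ => by positivity), ?_⟩
    rw [h4, hPΦ, ← Finset.prod_pow, ← Finset.prod_pow, mul_assoc, ← Finset.prod_mul_distrib]
    push_cast
    congr 1
    refine Finset.prod_congr rfl fun ρ _ => ?_
    rw [inv_one_sub_pow_four (T.norm_emb ρ) ρ.2]
    push_cast
    rfl
  -- A nonnegative real is determined by its modulus, known from `|lam| ^ 2 = d` and `|P| = 1`.
  have hrd : r = (Nat.card T.G : ℝ) ^ 2 := by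
    have h1 : ((r * r : ℝ) : ℂ) = ((((Nat.card T.G : ℝ) ^ 2) * (Nat.card T.G : ℝ) ^ 2 : ℝ) : ℂ) := by
      have h2 : conj (lam ^ 4 * P ^ 2) = r := by rw [hr4, Complex.conj_ofReal]
      rw [map_mul, map_pow, map_pow] at h2
      push_cast
      rw [← hd]
      calc (r : ℂ) * r = (lam ^ 4 * P ^ 2) * (conj lam ^ 4 * conj P ^ 2) := by rw [h2, hr4]
        _ = (lam * conj lam) ^ 2 * (lam * conj lam) ^ 2 * (P * conj P) ^ 2 := by ring
        _ = _ := by rw [hP1]; ring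
    have h3 : r * r = ((Nat.card T.G : ℝ) ^ 2) * (Nat.card T.G : ℝ) ^ 2 := by exact_mod_cast h1
    exact (mul_self_inj hr (by positivity)).1 h3
  -- Conjugating turns `lam ^ 4 * P ^ 2 = d ^ 2` into a formula with `P ^ 2` on the right; the
  -- conjugate of `f` is critical for `conj lam`.
  refine ⟨conj lam, ?_, fun g => conj (f g), fun h0 => hf ?_, fun k => ?_⟩
  · have h1 : conj lam ^ 4 * conj P ^ 2 = Nat.card T.G ^ 2 := by
      have h2 : conj (lam ^ 4 * P ^ 2) = r := by rw [hr4, Complex.conj_ofReal]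
      rw [map_mul, map_pow, map_pow, hrd] at h2
      rw [h2]
      push_cast
      rfl
    linear_combination P ^ 2 * h1 - conj lam ^ 4 * (P * conj P + 1) * hP1
  · funext g
    have := congrFun h0 g
    simpa using this
  · have := congrArg conj (hcrit k)
    rw [map_sum, map_mul, map_pow] at this
    simpa only [map_mul] using this

end ThetaElement

end CMCritical

/-! ### Embeddings, traces and conjugation in a product of number fields -/

open scoped BigOperators ComplexConjugate

namespace CMCritical

section ProductOfFields

variable {ι : Type*} [Fintype ι] {F : ι → Type*} [∀ j, Field (F j)] [∀ j, NumberField (F j)]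

/-- The complex embeddings of a product of number fields are those of its factors. -/
lemma bijective_comp_evalAlgHom : Function.Bijective
    (fun p : Σ j, (F j →ₐ[ℚ] ℂ) => p.2.comp (Pi.evalAlgHom ℚ F p.1)) := by
  classical
  constructor
  · rintro ⟨j, σ⟩ ⟨j', σ'⟩ h
    have hj : j = j' := by
      by_contra hne
      have h1 := DFunLike.congr_fun h (Pi.single j 1)
      simp [Pi.single_eq_of_ne (Ne.symm hne)] at h1
    subst hj
    have : σ = σ' := by
      ext a
      have h1 := DFunLike.congr_fun h (Pi.single j a)
      simpa using h1
    rw [this]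
  · intro ρ
    -- The images of the primitive idempotents are `0` or `1` with sum `1`, so some factor has image
    -- `1` and `ρ` factors through it.
    have hsum : ∑ j, ρ (Pi.single j 1) = 1 := by
      rw [← map_sum, ← map_one ρ]
      congr 1
      exact Finset.univ_sum_single (1 : ∀ j, F j)
    obtain ⟨j, -, hj⟩ : ∃ j ∈ Finset.univ, ρ (Pi.single j 1) ≠ 0 :=
      Finset.exists_ne_zero_of_sum_ne_zero (by rw [hsum]; exact one_ne_zero)
    have h1 : ρ (Pi.single j 1) = 1 := by
      have : ρ (Pi.single j 1) * ρ (Pi.single j 1) = ρ (Pi.single j 1) := by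
        rw [← map_mul, ← Pi.single_mul, one_mul]
      exact mul_right_cancel₀ hj (by rw [this, one_mul])
    refine ⟨⟨j, AlgHom.ofLinearMap (ρ.toLinearMap ∘ₗ LinearMap.single ℚ F j) (by simpa using h1)
      (fun a b => by simp [Pi.single_mul])⟩, ?_⟩
    ext x
    have : ρ x = ρ (Pi.single j (x j)) := by
      conv_lhs => rw [← mul_one (ρ x), ← h1, ← map_mul]
      congr 1
      ext i
      by_cases hi : i = j
      · subst hi; simp
      · simp [Pi.single_eq_of_ne hi]
    exact this.symm

lemma trace_single [DecidableEq ι] (j : ι) (a : F j) :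
    Algebra.trace ℚ (∀ j, F j) (Pi.single j a) = Algebra.trace ℚ (F j) a := by
  rw [Algebra.trace_apply, Algebra.trace_apply]
  have h1 : Algebra.lmul ℚ (∀ j, F j) (Pi.single j a) =
      LinearMap.single ℚ F j ∘ₗ (Algebra.lmul ℚ (F j) a ∘ₗ LinearMap.proj j) := by
    refine LinearMap.ext fun x => funext fun i => ?_
    by_cases hi : i = j
    · subst hi; simp
    · simp [Pi.single_eq_of_ne hi]
  have h2 : (Algebra.lmul ℚ (F j) a ∘ₗ LinearMap.proj j) ∘ₗ LinearMap.single ℚ F j =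
      Algebra.lmul ℚ (F j) a := by
    ext x; simp
  rw [h1, LinearMap.trace_comp_comm', h2]

lemma trace_pi (x : ∀ j, F j) :
    Algebra.trace ℚ (∀ j, F j) x = ∑ j, Algebra.trace ℚ (F j) (x j) := by
  classical
  conv_lhs => rw [← Finset.univ_sum_single x]
  rw [map_sum]
  exact Finset.sum_congr rfl fun j _ => trace_single j (x j)

lemma trace_eq_sum_algHom [Fintype ((∀ j, F j) →ₐ[ℚ] ℂ)] (x : ∀ j, F j) :
    ((Algebra.trace ℚ (∀ j, F j) x : ℚ) : ℂ) = ∑ ρ : (∀ j, F j) →ₐ[ℚ] ℂ, ρ x := by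
  classical
  rw [← (Equiv.ofBijective _ (bijective_comp_evalAlgHom (F := F))).sum_comp (fun ρ => ρ x),
    Fintype.sum_sigma, trace_pi, Rat.cast_sum]
  refine Finset.sum_congr rfl fun j _ => ?_
  have := trace_eq_sum_embeddings (K := ℚ) (L := F j) ℂ (x := x j)
  rw [eq_ratCast] at this
  rw [this]
  rfl

lemma eq_zero_of_trace_mul (x : ∀ j, F j)
    (h : ∀ y, Algebra.trace ℚ (∀ j, F j) (x * y) = 0) : x = 0 := by
  classical
  funext j
  refine (traceForm_nondegenerate ℚ (F j)).1 (x j) fun b => ?_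
  have := h (Pi.single j b)
  rw [show x * Pi.single j b = Pi.single j (x j * b) from ?_, trace_single] at this
  · exact this
  · ext i
    by_cases hi : i = j
    · subst hi; simp
    · simp [Pi.single_eq_of_ne hi]

variable [∀ j, NumberField.IsCMField (F j)]

lemma algHom_conj (ρ : (∀ j, F j) →ₐ[ℚ] ℂ) (x : ∀ j, F j) :
    ρ (CMCritical.conj x) = starRingEnd ℂ (ρ x) := by
  obtain ⟨⟨j, σ⟩, rfl⟩ := bijective_comp_evalAlgHom.2 ρ
  exact NumberField.IsCMField.complexEmbedding_complexConj (K := F j) σ.toRingHom (x j)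

end ProductOfFields

section Conj

variable {ι : Type*} {F : ι → Type*} [∀ j, Field (F j)] [∀ j, NumberField (F j)]
  [∀ j, NumberField.IsCMField (F j)]

lemma conj_add (x y : ∀ j, F j) :
    CMCritical.conj (x + y) = CMCritical.conj x + CMCritical.conj y := by
  ext j; simp [CMCritical.conj]

lemma conj_mul (x y : ∀ j, F j) :
    CMCritical.conj (x * y) = CMCritical.conj x * CMCritical.conj y := by
  ext j; simp [CMCritical.conj]

lemma conj_smul (q : ℚ) (x : ∀ j, F j) :
    CMCritical.conj (q • x) = q • CMCritical.conj x := by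
  ext j; simp [CMCritical.conj, Algebra.smul_def]

lemma conj_conj (x : ∀ j, F j) : CMCritical.conj (CMCritical.conj x) = x := by
  ext j; simp [CMCritical.conj]

end Conj

end CMCritical

/-! ### Lattices and odd denominators -/

open scoped BigOperators ComplexConjugate

namespace CMCritical

section LatticeFacts

variable {ι : Type*} [Fintype ι] {F : ι → Type*} [∀ j, Field (F j)] [∀ j, NumberField (F j)]

lemma exists_nsmul_mem_ringOfIntegers (x : ∀ j, F j) :
    ∃ n : ℕ, n ≠ 0 ∧ n • x ∈ ringOfIntegers F := by
  classical
  have h : ∀ j, ∃ n : ℕ, n ≠ 0 ∧ IsIntegral ℤ (n • x j) := fun j => by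
    obtain ⟨m, hm, hi⟩ := ((IsFractionRing.isAlgebraic_iff ℤ ℚ (F j)).2
      (Algebra.IsAlgebraic.isAlgebraic (x j))).exists_integral_multiple
    refine ⟨m.natAbs, Int.natAbs_ne_zero.2 hm, ?_⟩
    rcases Int.natAbs_eq m with h | h
    · rw [← natCast_zsmul, ← h]; exact hi
    · rw [← natCast_zsmul, show ((m.natAbs : ℕ) : ℤ) = -m by omega, neg_smul]; exact hi.neg
  choose n hn hi using h
  refine ⟨∏ j, n j, Finset.prod_ne_zero_iff.2 fun j _ => hn j, ?_⟩
  rw [ringOfIntegers, AddSubgroup.mem_pi]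
  intro j _
  have : IsIntegral ℤ ((∏ j, n j) • x j) := by
    rw [← Finset.prod_erase_mul _ _ (Finset.mem_univ j), mul_smul]
    exact (hi j).nsmul _
  exact ⟨⟨_, this⟩, rfl⟩

lemma IsLattice.exists_nsmul_mem {L : AddSubgroup (∀ j, F j)} (hL : IsLattice F L)
    (x : ∀ j, F j) : ∃ n : ℕ, n ≠ 0 ∧ n • x ∈ L := by
  obtain ⟨n, hn, hx⟩ := exists_nsmul_mem_ringOfIntegers x
  obtain ⟨m, hm, -, hm'⟩ := AddSubgroup.exists_nsmul_mem_of_relIndex_ne_zero hL.1 hx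
  exact ⟨m * n, mul_ne_zero hm.ne' hn, by rw [mul_smul]; exact hm'.1⟩

/-- A nonzero multiple of `L` lies in the ring of integers, which is Noetherian over `ℤ`, and
multiplication by an integer is injective. -/
lemma IsLattice.fg {L : AddSubgroup (∀ j, F j)} (hL : IsLattice F L) : L.FG := by
  let φ : (∀ j, NumberField.RingOfIntegers (F j)) →ₗ[ℤ] (∀ j, F j) :=
    LinearMap.pi fun j => (Algebra.linearMap (NumberField.RingOfIntegers (F j))
      (F j)).restrictScalars ℤ ∘ₗ LinearMap.proj j
  have hS : IsNoetherian ℤ (LinearMap.range φ) := inferInstance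
  have hle : ∀ x ∈ ringOfIntegers F, x ∈ LinearMap.range φ := by
    intro x hx
    rw [ringOfIntegers, AddSubgroup.mem_pi] at hx
    choose y hy using fun j => hx j (Set.mem_univ j)
    exact ⟨y, funext hy⟩
  -- Each element is brought into the ring of integers by some positive integer at most the index;
  -- the factorial works for all.
  set m := ((ringOfIntegers F).relIndex L).factorial with hm
  have hmem : ∀ x ∈ L, m • x ∈ ringOfIntegers F := fun x hx =>
    (AddSubgroup.nsmul_mem_of_relIndex_ne_zero_of_dvd hL.2 hx
      fun k hk hk' => Nat.dvd_factorial hk hk').1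
  let ψ : (∀ j, F j) →ₗ[ℤ] (∀ j, F j) := (m : ℤ) • LinearMap.id
  have hm0 : (m : ℤ) ≠ 0 := Int.natCast_ne_zero.2 (Nat.factorial_ne_zero _)
  have hψ : Function.Injective ψ := fun x y h => smul_right_injective _ hm0 h
  have : (AddSubgroup.toIntSubmodule L).FG := by
    refine Submodule.fg_of_fg_map_injective ψ hψ (isNoetherian_submodule.1 hS _ ?_)
    rintro _ ⟨x, hx, rfl⟩
    refine hle _ ?_
    simpa [ψ] using hmem x hx
  simpa using (Submodule.fg_iff_addSubgroup_fg _).1 this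

end LatticeFacts

section OddDenominators

variable {ι : Type*} {F : ι → Type*} [∀ j, Field (F j)] [∀ j, NumberField (F j)]

lemma exists_odd_nsmul_mem {L : AddSubgroup (∀ j, F j)} {x : ∀ j, F j}
    (hx : x ∈ localizeTwo L) : ∃ n : ℕ, Odd n ∧ n • x ∈ L := by
  induction hx using Submodule.span_induction with
  | mem x hx => exact ⟨1, odd_one, by simpa using hx⟩
  | zero => exact ⟨1, odd_one, by simp⟩
  | add x y _ _ hx hy =>
    obtain ⟨n, hn, hx⟩ := hx
    obtain ⟨m, hm, hy⟩ := hy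
    refine ⟨n * m, hn.mul hm, ?_⟩
    rw [smul_add]
    refine L.add_mem ?_ ?_
    · rw [mul_comm, mul_smul]; exact L.nsmul_mem hx m
    · rw [mul_smul]; exact L.nsmul_mem hy n
  | smul r x _ hx =>
    obtain ⟨n, hn, hx⟩ := hx
    refine ⟨(r : ℚ).den * n, Odd.mul r.2 hn, ?_⟩
    have : ((r : ℚ).den * n) • (r • x) = (r : ℚ).num • (n • x) := by
      rw [show r • x = (r : ℚ) • x from rfl, ← Nat.cast_smul_eq_nsmul ℚ,
        ← Int.cast_smul_eq_zsmul ℚ, ← Nat.cast_smul_eq_nsmul ℚ, smul_smul, smul_smul]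
      congr 1
      push_cast
      linear_combination (n : ℚ) * Rat.den_mul_eq_num (r : ℚ)
    rw [this]
    exact L.zsmul_mem hx _

lemma mem_of_odd_nsmul_mem {A : Type*} [AddCommGroup A] {L : AddSubgroup A} {x : A} {n : ℕ}
    (hn : Odd n) (hx : n • x ∈ L) (h2 : 2 • x ∈ L) : x ∈ L := by
  obtain ⟨m, rfl⟩ := hn
  have : x = (2 * m + 1) • x - m • (2 • x) := by
    rw [add_smul, one_smul, mul_comm, mul_smul]; abel
  rw [this]
  exact L.sub_mem hx (L.nsmul_mem h2 m)

/-- A denominator that is odd on each element of a finitely generated group is uniformly odd. -/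
lemma exists_odd_nsmul_mem_of_fg {A : Type*} [AddCommGroup A] {L : AddSubgroup A} (hL : L.FG)
    (φ : A →+ A) (h : ∀ x ∈ L, ∃ n : ℕ, Odd n ∧ n • φ x ∈ L) :
    ∃ o : ℕ, Odd o ∧ ∀ x ∈ L, o • φ x ∈ L := by
  classical
  obtain ⟨S, rfl⟩ := hL
  choose! n hn hmem using fun x (hx : x ∈ S) => h x (AddSubgroup.subset_closure hx)
  refine ⟨∏ x ∈ S, n x, Finset.prod_induction _ Odd (fun _ _ => Odd.mul) odd_one hn,
    fun x hx => ?_⟩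
  induction hx using AddSubgroup.closure_induction with
  | mem x hx =>
    rw [← Finset.prod_erase_mul _ _ hx, mul_smul]
    exact AddSubgroup.nsmul_mem _ (hmem x hx) _
  | zero => simp
  | add x y _ _ hx hy => rw [map_add, smul_add]; exact AddSubgroup.add_mem _ hx hy
  | neg x _ hx => rw [map_neg, smul_neg]; exact AddSubgroup.neg_mem _ hx

lemma exists_int_eq_four_mul {r q : ℚ} (hr : ∃ n : ℤ, r = n) (hq : q ∈ ZTwo) (h : r = 4 * q) :
    ∃ n : ℤ, r = 4 * n := by
  obtain ⟨n, rfl⟩ := hr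
  have hq' : Odd q.den := hq
  have h1 : n * (q.den : ℤ) = 4 * q.num := by
    have := Rat.den_mul_eq_num q
    have : (n : ℚ) * q.den = 4 * q.num := by rw [h]; linear_combination 4 * this
    exact_mod_cast this
  have h4 : (4 : ℤ) ∣ n := by
    refine IsCoprime.dvd_of_dvd_mul_right (z := (q.den : ℤ)) ?_ ⟨q.num, h1⟩
    have : Nat.Coprime 4 q.den := Nat.Coprime.pow_left 2 (Nat.coprime_two_left.2 hq')
    exact_mod_cast Nat.isCoprime_iff_coprime.2 this
  obtain ⟨k, rfl⟩ := h4
  exact ⟨k, by push_cast; ring⟩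

end OddDenominators

end CMCritical

/-! ### The symplectic form as a positive sum over the CM type -/

open scoped BigOperators ComplexConjugate

namespace CMCritical

lemma inv_mul_cancel_pi {ι : Type*} {F : ι → Type*} [∀ j, Field (F j)] {t : ∀ j, F j}
    (ht : IsUnit t) : t⁻¹ * t = 1 := by
  funext j
  exact inv_mul_cancel₀ ((Pi.isUnit_iff.1 ht j).ne_zero)

section Embeddings

variable {ι : Type*} {F : ι → Type*} [∀ j, Field (F j)] [∀ j, NumberField (F j)] {t : ∀ j, F j}

lemma map_inv_pi (ht : IsUnit t) (ρ : (∀ j, F j) →ₐ[ℚ] ℂ) : ρ t⁻¹ = (ρ t)⁻¹ := by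
  refine eq_inv_of_mul_eq_one_left ?_
  rw [← map_mul, inv_mul_cancel_pi ht, map_one]

lemma im_ne_zero_of_isTotallyImaginary (hti : IsTotallyImaginary t) (ht : IsUnit t)
    (ρ : (∀ j, F j) →ₐ[ℚ] ℂ) : (ρ t).im ≠ 0 := fun h =>
  (ht.map ρ).ne_zero (Complex.ext (hti ρ) h)

variable (F) in
/-- The conjugate of a complex embedding. -/
noncomputable def conjEmbedding : Equiv.Perm ((∀ j, F j) →ₐ[ℚ] ℂ) :=
  Function.Involutive.toPerm
    (fun ρ => (Complex.conjAe.restrictScalars ℚ : ℂ →ₐ[ℚ] ℂ).comp ρ)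
    (fun ρ => by ext x; simp)

@[simp] lemma conjEmbedding_apply (ρ : (∀ j, F j) →ₐ[ℚ] ℂ) (x : ∀ j, F j) :
    conjEmbedding F ρ x = starRingEnd ℂ (ρ x) := rfl

variable [∀ j, NumberField.IsCMField (F j)]

lemma symplecticForm_conj_mul (x y ν : ∀ j, F j) :
    symplecticForm t (CMCritical.conj ν * x) y = symplecticForm t x (ν * y) := by
  rw [symplecticForm, symplecticForm, conj_mul]
  congr 2
  ring

end Embeddings

section SymplecticForm

variable {ι : Type*} [Fintype ι] {F : ι → Type*} [∀ j, Field (F j)] [∀ j, NumberField (F j)]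
  [∀ j, NumberField.IsCMField (F j)]

/-- The form `ω_t` as a bilinear map. -/
noncomputable def symplecticBilin (t : ∀ j, F j) : (∀ j, F j) →ₗ[ℚ] (∀ j, F j) →ₗ[ℚ] ℚ :=
  LinearMap.mk₂ ℚ (symplecticForm t)
    (fun x x' y => by 
      rw [symplecticForm, symplecticForm, symplecticForm, ← map_add, add_mul, div_eq_mul_inv,
        div_eq_mul_inv, div_eq_mul_inv, add_mul])
    (fun q x y => by
      rw [symplecticForm, smul_mul_assoc, div_eq_mul_inv, smul_mul_assoc, map_smul,
        ← div_eq_mul_inv]; rfl)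
    (fun x y y' => by 
      rw [symplecticForm, symplecticForm, symplecticForm, ← map_add, conj_add, mul_add,
        div_eq_mul_inv, div_eq_mul_inv, div_eq_mul_inv, add_mul])
    (fun q x y => by
      rw [symplecticForm, conj_smul, mul_smul_comm, div_eq_mul_inv, smul_mul_assoc, map_smul,
        ← div_eq_mul_inv]; rfl)

variable {t : ∀ j, F j}

lemma eq_zero_of_symplecticForm (ht : IsUnit t) (x : ∀ j, F j)
    (h : ∀ y, symplecticForm t x y = 0) : x = 0 := by
  refine eq_zero_of_trace_mul x fun y => ?_
  have := h (CMCritical.conj (t * y))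
  rw [symplecticForm, conj_conj, div_eq_mul_inv] at this
  rw [← this]
  congr 1
  linear_combination (-(x * y)) * inv_mul_cancel_pi ht

lemma norm_algHom_of_mem {ν : ∀ j, F j} (hν : ν ∈ unitaryElements)
    (ρ : (∀ j, F j) →ₐ[ℚ] ℂ) : ‖ρ ν‖ = 1 := by
  have h := congrArg ρ (show ν * CMCritical.conj ν = 1 from hν)
  rw [map_mul, algHom_conj, map_one, Complex.mul_conj, Complex.normSq_eq_norm_sq] at h
  have h' : ‖ρ ν‖ ^ 2 = 1 := by exact_mod_cast h
  exact (pow_eq_one_iff_of_nonneg (norm_nonneg _) two_ne_zero).1 h'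

variable [Fintype (cmType t)]

/-- The trace is the sum over all embeddings. Conjugate embeddings contribute equally, hence the
factor `2`, and `Re (z / (i a)) = Im z / a`. Restricting to `Im (ρ t) > 0` makes the weights
positive. -/
lemma symplecticForm_eq (hti : IsTotallyImaginary t) (ht : IsUnit t) (x y : ∀ j, F j) :
    (symplecticForm t x y : ℝ) =
      ∑ ρ : cmType t, 2 / (ρ.1 t).im * (ρ.1 x * starRingEnd ℂ (ρ.1 y)).im := by
  classical
  have : Fintype ((∀ j, F j) →ₐ[ℚ] ℂ) := Fintype.ofFinite _
  set g : ((∀ j, F j) →ₐ[ℚ] ℂ) → ℝ := fun ρ => (ρ x * starRingEnd ℂ (ρ y)).im / (ρ t).im with hg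
  have hgc : ∀ ρ, g (conjEmbedding F ρ) = g ρ := fun ρ => by
    simp only [hg, conjEmbedding_apply, ← map_mul, Complex.conj_im, neg_div_neg_eq]
  have h1 : (symplecticForm t x y : ℝ) = ∑ ρ, g ρ := by
    have h := congrArg Complex.re (trace_eq_sum_algHom (x * CMCritical.conj y / t))
    rw [Complex.ratCast_re, Complex.re_sum] at h
    rw [symplecticForm, h]
    refine Finset.sum_congr rfl fun ρ _ => ?_
    have him := im_ne_zero_of_isTotallyImaginary hti ht ρ
    have ht' : ρ t = (ρ t).im * Complex.I := Complex.ext (by simp [hti ρ]) (by simp)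
    rw [div_eq_mul_inv, map_mul, map_mul, algHom_conj, map_inv_pi ht, ← div_eq_mul_inv]
    change _ = (ρ x * starRingEnd ℂ (ρ y)).im / (ρ t).im
    generalize ρ x * starRingEnd ℂ (ρ y) = z
    rw [ht']
    generalize (ρ t).im = a at him ⊢
    rw [Complex.div_re]
    simp
    field_simp
  have h2 : ∑ ρ with ¬ 0 < (ρ t).im, g ρ = ∑ ρ with 0 < (ρ t).im, g ρ := by
    refine Finset.sum_equiv (conjEmbedding F) (fun ρ => ?_) (fun ρ _ => (hgc ρ).symm)
    have him := im_ne_zero_of_isTotallyImaginary hti ht ρ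
    simp only [Finset.mem_filter, Finset.mem_univ, true_and, conjEmbedding_apply, Complex.conj_im,
      Left.neg_pos_iff, not_lt]
    exact ⟨fun h => lt_of_le_of_ne h him, le_of_lt⟩
  rw [h1, ← Finset.sum_filter_add_sum_filter_not Finset.univ (fun ρ => 0 < (ρ t).im), h2, ← two_mul,
    Finset.mul_sum]
  rw [Finset.sum_subtype (p := fun ρ => ρ ∈ cmType t) (F := inferInstance) _ (fun ρ => by
    simp [cmType])]
  refine Finset.sum_congr rfl fun ρ _ => ?_
  simp only [hg]
  ring

/-- The polarized lattice given by an autodual lattice of a CM algebra. -/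
noncomputable def polarizedLattice (hti : IsTotallyImaginary t) (ht : IsUnit t)
    (L : AddSubgroup (∀ j, F j)) (hL : IsLattice F L) (hLd : IsAutodual t L) :
    PolarizedLattice (∀ j, F j) (cmType t) where
  emb ρ := ρ.1
  emb_injective ρ ρ' h := Subtype.ext (AlgHom.coe_ringHom_injective h)
  emb_ne_conj ρ ρ' h := by
    have h1 := congrArg Complex.im (DFunLike.congr_fun h t)
    have h2 : 0 < (ρ.1 t).im := ρ.2
    have h3 : 0 < (ρ'.1 t).im := ρ'.2
    simp at h1
    linarith
  wt ρ := 2 / (ρ.1 t).im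
  wt_pos ρ := div_pos two_pos ρ.2
  form := symplecticBilin t
  form_eq x y := symplecticForm_eq hti ht x y
  form_nondeg x h := eq_zero_of_symplecticForm ht x h
  L := L
  mem_iff := hLd
  fg := hL.fg
  exists_nsmul_mem := hL.exists_nsmul_mem

end SymplecticForm

end CMCritical

/-! ### From the theta subgroup to theta elements -/

open scoped BigOperators ComplexConjugate

namespace CMCritical

section ThetaSubgroup

variable {ι : Type*} [Fintype ι] {F : ι → Type*} [∀ j, Field (F j)] [∀ j, NumberField (F j)]
  [∀ j, NumberField.IsCMField (F j)] {t : ∀ j, F j}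

/-- An element of the theta subgroup of level 2 gives a theta element of the polarized lattice. -/
lemma exists_thetaElement [Fintype (cmType t)] (hti : IsTotallyImaginary t) (ht : IsUnit t)
    (L : AddSubgroup (∀ j, F j)) (hL : IsLattice F L) (hLd : IsAutodual t L)
    {ν : ∀ j, F j} (hν : ν ∈ thetaSubgroup t L) :
    ∃ T : ThetaElement (polarizedLattice hti ht L hL hLd), T.ν = ν := by
  classical
  obtain ⟨⟨hu, h2⟩, h4⟩ := hν
  have hmul : ν * CMCritical.conj ν = 1 := hu
  have hodd : ∀ x ∈ L, ∃ n : ℕ, Odd n ∧ n • AddMonoidHom.mulLeft ν x ∈ L := fun x hx => by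
    obtain ⟨y, hy, hxy⟩ := h2 x (Submodule.subset_span hx)
    obtain ⟨n, hn, hny⟩ := exists_odd_nsmul_mem hy
    refine ⟨n, hn, ?_⟩
    have : n • AddMonoidHom.mulLeft ν x = n • x + 2 • (n • y) := by
      rw [AddMonoidHom.coe_mulLeft, show ν * x = x + 2 * y by rw [← hxy]; ring]
      simp only [nsmul_eq_mul]
      push_cast
      ring
    rw [this]
    exact L.add_mem (L.nsmul_mem hx n) (L.nsmul_mem hny 2)
  obtain ⟨o, ho, homem⟩ := exists_odd_nsmul_mem_of_fg hL.fg _ hodd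
  have hone : ∀ j, ν j * CMCritical.conj ν j = 1 := fun j => congrFun hmul j
  refine ⟨{
    ν := ν
    ν' := CMCritical.conj ν
    mul_inv := hmul
    norm_emb := fun ρ => norm_algHom_of_mem hu ρ.1
    o := o
    odd := ho
    smul_mem := homem
    smul_mem' := fun x hx => (hLd _).2 fun y hy => ?_
    half := fun x hx hνx => ?_
    theta := fun x hx hνx => ?_
    ε := fun j => if ν j = 1 then 0 else 1
    -- The convention `0⁻¹ = 0` makes `δ` vanish on the factors where `ν = 1`.
    δ := fun j => (1 - CMCritical.conj ν j)⁻¹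
    ε_idem := by ext j; by_cases h : ν j = 1 <;> simp [h]
    δ_mul := ?_
    δ_mul_ε := ?_
    one_sub_mul := by ext j; by_cases h : ν j = 1 <;> simp [h] }, rfl⟩
  -- By adjunction and autoduality, the denominator found for `ν` also serves for its inverse.
  · have h1 : o • (CMCritical.conj ν * x) = CMCritical.conj ν * (o • x) := by
      rw [mul_smul_comm]
    have h3 : symplecticForm t (o • x) (ν * y) = symplecticForm t x (o • (ν * y)) := by
      rw [← Nat.cast_smul_eq_nsmul ℚ, ← Nat.cast_smul_eq_nsmul ℚ]
      have h5 := (symplecticBilin t).map_smul₂ (o : ℚ) x (ν * y)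
      have h6 := (symplecticBilin t x).map_smul (o : ℚ) (ν * y)
      exact h5.trans h6.symm
    rw [h1, symplecticForm_conj_mul, h3]
    exact (hLd x).1 hx _ (homem y hy)
  · obtain ⟨y, hy, hxy⟩ := h2 x (Submodule.subset_span hx)
    obtain ⟨n, hn, hny⟩ := exists_odd_nsmul_mem hy
    have h3 : ν * x - x = 2 • y := by
      rw [two_nsmul, ← two_mul, ← hxy]; ring
    refine ⟨y, mem_of_odd_nsmul_mem hn hny ?_, by rw [h3, two_nsmul]⟩
    rw [← h3]
    exact L.sub_mem hνx hx
  · obtain ⟨q, hq, h⟩ := h4 x (Submodule.subset_span hx)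
    exact exists_int_eq_four_mul ((hLd _).1 hνx x hx) hq h
  · ext j
    by_cases h : ν j = 1
    · have := hone j
      rw [h, one_mul] at this
      simp [h, this]
    · have h' : 1 - CMCritical.conj ν j ≠ 0 := fun h0 => h (by
        have := hone j
        rwa [← sub_eq_zero.1 h0, mul_one] at this)
      simp [h, h']
  · ext j
    by_cases h : ν j = 1
    · have := hone j
      rw [h, one_mul] at this
      simp [h, this]
    · simp [h]

/-- Every element of the theta subgroup of level 2 gives a critical value whose fourth power is
known. -/
lemma exists_isCriticalValue (hti : IsTotallyImaginary t) (ht : IsUnit t)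
    {L : AddSubgroup (∀ j, F j)} (hL : IsLattice F L) (hLd : IsAutodual t L)
    {ν : ∀ j, F j} (hν : ν ∈ thetaSubgroup t L) :
    ∃ lam : ℂ, lam ^ 4 = Nat.card (latticeQuotient L ν) ^ 2 * reflexNorm (cmType t) ν ^ 2 ∧
      0 < Nat.card (latticeQuotient L ν) ∧ IsCriticalValue (latticeQuotient L ν) lam := by
  classical
  have : Fintype (cmType t) := Fintype.ofFinite _
  obtain ⟨T, rfl⟩ := exists_thetaElement hti ht L hL hLd hν
  have inst : Fintype T.G := Fintype.ofFinite _
  obtain ⟨lam, h4, f, hf, hcrit⟩ := T.exists_critical_pow_four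
  have hodd : Odd (Fintype.card T.G) := by
    rw [← Nat.card_eq_fintype_card]
    exact T.odd_card_G
  have hC : IsCriticalValue T.G lam := ⟨inst, hodd, f, hf, hcrit⟩
  refine ⟨lam, ?_, Nat.card_pos (α := T.G), hC⟩
  rw [h4]
  congr 2
  rw [reflexNorm, Finset.prod_subtype (p := fun ρ => ρ ∈ cmType t) (F := inferInstance) _
    (fun ρ => by simp)]
  rfl

end ThetaSubgroup

end CMCritical

/-! ### Integrality and the moduli of the conjugates -/

open scoped BigOperators ComplexConjugate

namespace CMCritical

section Weil

lemma prod_mem_span_pow {G : Type*} (f : G → ℂ) {α : Type*} (S : Finset α) (g : α → G) :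
    ∏ i ∈ S, f (g i) ∈ Submodule.span ℤ (Set.range f) ^ S.card := by
  classical
  induction S using Finset.induction_on with
  | empty => simp
  | insert a S ha ih =>
    rw [Finset.prod_insert ha, Finset.card_insert_of_notMem ha, pow_succ']
    exact Submodule.mul_mem_mul (Submodule.subset_span ⟨_, rfl⟩) ih

/-- Critical values are algebraic integers. -/
lemma IsCriticalValue.isIntegral {G : Type*} [AddCommGroup G] {lam : ℂ}
    (h : IsCriticalValue G lam) : IsIntegral ℤ lam := by
  classical
  obtain ⟨_, -, f, hf, hcrit⟩ := h
  obtain ⟨a, ha⟩ := Function.ne_iff.1 hf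
  set n := Fintype.card G + 1 with hn
  set I := Submodule.span ℤ (Set.range f) with hI
  have hmem : ∀ k, f k ∈ I := fun k => Submodule.subset_span ⟨k, rfl⟩
  -- `I ^ n` is a nonzero finitely generated group stable under `lam`. Among `n = |G| + 1` factors
  -- two are equal, and the critical equation rewrites `lam * f k ^ 2` as a sum of products of two
  -- values of `f`.
  refine isIntegral_of_smul_mem_submodule (I ^ n)
    ((Submodule.ne_bot_iff _).2 ⟨f a ^ n, Submodule.pow_mem_pow _ (hmem a) _, pow_ne_zero _ ha⟩)
    (Submodule.FG.pow (Submodule.fg_span (Set.finite_range f)) n) lam fun x hx => ?_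
  rw [hI, Submodule.span_pow] at hx
  induction hx using Submodule.span_induction with
  | zero => simp
  | add x y _ _ hx hy => rw [smul_add]; exact add_mem hx hy
  | smul c x _ hx => rw [smul_comm]; exact Submodule.smul_mem _ c hx
  | mem x hx =>
    obtain ⟨u, rfl⟩ := Set.mem_pow.1 hx
    choose g hg using fun i => (u i).2
    obtain ⟨i, j, hij, hgij⟩ := Fintype.exists_ne_map_eq_of_card_lt g (by simp [hn])
    have h1 : (List.ofFn fun i => (u i : ℂ)).prod =
        f (g i) ^ 2 * ∏ m ∈ (Finset.univ.erase i).erase j, f (g m) := by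
      rw [List.prod_ofFn, ← Finset.mul_prod_erase _ _ (Finset.mem_univ i),
        ← Finset.mul_prod_erase _ _ (Finset.mem_erase.2 ⟨hij.symm, Finset.mem_univ j⟩)]
      simp only [← hg, ← hgij]
      ring
    rw [h1, smul_eq_mul, ← mul_assoc, ← hcrit]
    have hcard : n = 2 + ((Finset.univ.erase i).erase j).card := by
      rw [Finset.card_erase_of_mem (Finset.mem_erase.2 ⟨hij.symm, Finset.mem_univ j⟩),
        Finset.card_erase_of_mem (Finset.mem_univ i), Finset.card_fin]
      have := Fintype.card_pos_iff.2 ⟨a⟩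
      omega
    rw [show I ^ n = I ^ 2 * I ^ _ from (congrArg (I ^ ·) hcard).trans (pow_add ..)]
    refine Submodule.mul_mem_mul (Submodule.sum_mem _ fun l _ => ?_) (prod_mem_span_pow f _ g)
    rw [pow_two]
    exact Submodule.mul_mem_mul (hmem _) (hmem _)

/-- The conjugates of a fourth root of `d ^ 2 * (∏ ρ, ρ ν) ^ 2`, when all conjugates of `ν` have
modulus one. -/
lemma norm_of_isConjRoot {K : Type*} [CommRing K] [Algebra ℚ K] [Algebra.IsIntegral ℚ K]
    {ν : K} (hν : ∀ ρ : K →ₐ[ℚ] ℂ, ‖ρ ν‖ = 1) (S : Finset (K →ₐ[ℚ] ℂ)) {d : ℕ} {lam w : ℂ}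
    (hlam : lam ^ 4 = d ^ 2 * (∏ ρ ∈ S, ρ ν) ^ 2) (hint : IsIntegral ℚ lam)
    (hw : IsConjRoot ℚ lam w) : ‖w‖ = Real.sqrt d := by
  let E := algebraicClosure ℚ ℂ
  have hE : ∀ x : K, ∀ ρ : K →ₐ[ℚ] ℂ, ρ x ∈ E := fun x ρ =>
    mem_algebraicClosure_iff'.2 ((Algebra.IsIntegral.isIntegral x).map ρ)
  let lamE : E := ⟨lam, mem_algebraicClosure_iff'.2 hint⟩
  let wE : E := ⟨w, mem_algebraicClosure_iff'.2 (hw.isIntegral hint)⟩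
  have hc : IsConjRoot ℚ lamE wE :=
    (isConjRoot_algHom_iff E.val).1 hw
  have : IsAlgClosure ℚ E := algebraicClosure.isAlgClosure ℚ ℂ
  have : Normal ℚ E := IsAlgClosure.normal ℚ E
  -- Inside the algebraic closure of `ℚ` in `ℂ`, which is normal, the conjugate is the image of
  -- `lam` under an automorphism.
  obtain ⟨σ, hσ⟩ := hc.symm.exists_algEquiv
  have hlamE : lamE ^ 4 = d ^ 2 * (∏ ρ ∈ S, (⟨ρ ν, hE ν ρ⟩ : E)) ^ 2 := by
    apply Subtype.ext
    simpa using hlam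
  -- Composing an embedding with `σ` gives another embedding, where `ν` still has modulus one.
  let τ : (K →ₐ[ℚ] ℂ) → (K →ₐ[ℚ] ℂ) := fun ρ =>
    E.val.comp (σ.toAlgHom.comp (ρ.codRestrict E.toSubalgebra fun x => hE x ρ))
  have h1 := congrArg (fun z : E => ‖(σ z : ℂ)‖) hlamE
  have h2 : ∀ ρ, ‖((σ ⟨ρ ν, hE ν ρ⟩ : E) : ℂ)‖ = 1 := fun ρ => hν (τ ρ)
  simp only [map_pow, map_mul, map_prod, map_natCast, hσ] at h1
  push_cast at h1
  rw [norm_pow, norm_mul, norm_pow, norm_pow, norm_prod, Finset.prod_congr rfl fun ρ _ => h2 ρ]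
    at h1
  simp at h1
  rw [eq_comm, Real.sqrt_eq_iff_mul_self_eq (by positivity) (norm_nonneg _)]
  refine (pow_left_inj₀ (by positivity) (by positivity) two_ne_zero).1 ?_
  rw [← h1]
  ring

end Weil

end CMCritical

/-! ### Assembly -/

theorem theorem5p4 {ι : Type*} [Fintype ι] (F : ι → Type*) [∀ j, Field (F j)]
    [∀ j, NumberField (F j)] [∀ j, NumberField.IsCMField (F j)]
    (t₀ : ∀ j, F j) (ht₀ : CMCritical.IsTotallyImaginary t₀) (ht₀_unit : IsUnit t₀)
    (L : AddSubgroup (∀ j, F j)) (hL : CMCritical.IsLattice F L)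
    (hL_dual : CMCritical.IsAutodual t₀ L)
    (ν : ∀ j, F j) (hν : ν ∈ CMCritical.thetaSubgroup t₀ L)
    (s : ℂ) (hs : s ^ 2 = CMCritical.reflexNorm (CMCritical.cmType t₀) ν) :
    ∃ κ lam : ℂ, κ ^ 4 = 1 ∧
      lam = κ * (Real.sqrt (Nat.card (CMCritical.latticeQuotient L ν)) : ℂ) * s ∧
      CMCritical.IsCriticalValue (CMCritical.latticeQuotient L ν) lam ∧
      CMCritical.IsWeilNumber (Nat.card (CMCritical.latticeQuotient L ν)) lam := by
  obtain ⟨lam, h4, hd, hcrit⟩ := CMCritical.exists_isCriticalValue ht₀ ht₀_unit hL hL_dual hν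
  have hν1 : ∀ ρ : (∀ j, F j) →ₐ[ℚ] ℂ, ‖ρ ν‖ = 1 := CMCritical.norm_algHom_of_mem hν.1.1
  set d := Nat.card (CMCritical.latticeQuotient L ν) with hd_def
  have hs0 : s ≠ 0 := by
    rintro rfl
    rw [zero_pow two_ne_zero] at hs
    refine Finset.prod_ne_zero_iff.2 (fun ρ _ => ?_) hs.symm
    exact norm_ne_zero_iff.1 (by rw [hν1 ρ]; exact one_ne_zero)
  have hd0 : ((Real.sqrt d : ℝ) : ℂ) ≠ 0 := by
    exact_mod_cast (Real.sqrt_pos.2 (Nat.cast_pos.2 hd)).ne'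
  have hd2 : ((Real.sqrt d : ℝ) : ℂ) ^ 2 = d := by
    exact_mod_cast congrArg (fun r : ℝ => (r : ℂ)) (Real.sq_sqrt (Nat.cast_nonneg (α := ℝ) d))
  -- The root of unity is forced. Its fourth power is `1` because `lam ^ 4 = d ^ 2 * s ^ 4`,
  -- whichever square root `s` is given.
  refine ⟨lam / ((Real.sqrt d : ℝ) * s), lam, ?_, ?_, hcrit, hd, hcrit.isIntegral, fun w hw => ?_⟩
  · rw [div_pow, h4, ← hs, ← hd2]
    rw [div_eq_one_iff_eq (by positivity)]
    ring
  · field_simp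
  · exact CMCritical.norm_of_isConjRoot hν1 _ h4 (hcrit.isIntegral.tower_top) hw
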